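/- **Theorem (duality of $(\mathfrak{gl}_d,\mathfrak{gl}_{p+m|q+n})$ for Gaudin models with irregular singularities).** All vector spaces and algebras are over $\mathbb C$. *Data.* Let $d\ge 1$ and let $p,q,m,n\ge 0$ be integers, not all zero; put $N=p+q+m+n$. For $1\le i\le N$ let $|i|=0\in\mathbb Z/2$ if $i\le p$ or $p+q<i\le p+q+m$, and $|i|=1$ otherwise. Let $\mathfrak g=\mathfrak{gl}_{p+q|m+n}$ (general linear Lie superalgebra of $\mathbb C^{p|q}\oplus\mathbb C^{m|n}$) have the homogeneous basis $E^i_j$ ($1\le i,j\le N$) of parity $|i|+|j|$ with $$[E^i_j,E^r_s]=\delta_{jr}E^i_s-(-1)^{(|i|+|j|)(|r|+|s|)}\delta_{is}E^r_j ,$$ and let $\mathfrak{gl}_d$ have the usual basis $e_{ab}$. Let $\xi=(\xi_1,\dots,\xi_{d'})$ be positive integers with sum $d$. Let $\gamma=(\gamma_1,\dots,\gamma_\ell)$ be the concatenation of four (possibly empty) sequences of positive integers with sums $p$, $q$, $m$, $n$, respectively. Let $w\in\mathbb C^{d'}$, $z\in\mathbb C^{\ell}$ be arbitrary. The blocks of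 $\xi$ (of $\gamma$) are the consecutive intervals of $\{1,\dots,d\}$ (of $\{1,\dots,N\}$) of lengths $\xi_a$ (of lengths $\gamma_i$). Let $J_\xi(w)$ be the block diagonal matrix of upper triangular Jordan blocks of size $\xi_a$ with eigenvalue $w_a$ (ones on the superdiagonal of each block), and similarly $J_\gamma(z)$. *Gaudin algebras.* For a Lie superalgebra $\mathfrak a$ and $g=(g_1,\dots,g_k)$ let $U_g(\mathfrak a)$ be the universal enveloping algebra of $\bigoplus_{i=1}^{k}\mathfrak a\otimes\mathbb C[t]/(t^{g_i})$, and write $X\otimes t_i^s$ for the elements of the $i$-th summand. For a ring $A$ let $A((u^{-1},\partial_u^{-1}))$ be the ring of formal series $\sum a_{ij}u^i\partial_u^j$, with $a_{ij}\in A$ and exponents $i,j\in\mathbb Z$ bounded above, in which $A$ commutes with $u,\partial_u$ and $\partial_u^{j}u^{k}=\sum_{t\ge0}\binom jt\binom kt t!\,u^{k-t}\partial_u^{j-t}$; negative powers of $u-c$ are expanded in $u^{-1}$. Put $$L_{ab}=\delta_{ab}\partial_u-J_\xi(w)_{ab}-\sum_{i=1}^{\ell}\sum_{k=0}^{\gamma_i-1}\frac{e_{ab}\otimes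 t_i^k}{(u-z_i)^{k+1}}\qquad(1\le a,b\le d),$$ $$\mathcal L_{ij}=\delta_{ij}\partial_u-J_\gamma(z)_{ij}-(-1)^{|i|}\sum_{a=1}^{d'}\sum_{k=0}^{\xi_a-1}\frac{E^i_j\otimes t_a^k}{(u-w_a)^{k+1}}\qquad(1\le i,j\le N).$$ These matrices have entries in $U_\gamma(\mathfrak{gl}_d)((u^{-1},\partial_u^{-1}))$ and $U_\xi(\mathfrak g)((u^{-1},\partial_u^{-1}))$, respectively. Let $\mathrm{cdet}\,L=\sum_{\sigma\in S_d}\mathrm{sgn}(\sigma)L_{\sigma(1),1}\cdots L_{\sigma(d),d}=\partial_u^d+\sum_{i=1}^{d}a_i(u)\partial_u^{i-1}$, and let $\mathcal A_d^{w,\xi}(z,\gamma)\subseteq U_\gamma(\mathfrak{gl}_d)$ be the unital subalgebra generated by the coefficients of the series $a_1(u),\dots,a_d(u)$. Let $\mathrm{Ber}\,\mathcal L=d_1(\mathcal L)^{(-1)^{|1|}}\cdots d_N(\mathcal L)^{(-1)^{|N|}}=\sum_i b_i(u)\partial_u^i$, where $d_i(\mathcal L)$ is the inverse of the $(i,i)$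 entry of the inverse of the leading $i\times i$ submatrix of $\mathcal L$, and let $\mathcal A_{p+q|m+n}^{z,\gamma}(w,\xi)\subseteq U_\xi(\mathfrak g)$ be the unital subalgebra generated by the coefficients of all the series $b_i(u)$, $i\in\mathbb Z$. *Fock space.* Let $\mathcal F$ be the polynomial superalgebra in the variables $y^a_r$ ($1\le r\le p+q$) of parity $|r|$ and $x^a_i$ ($1\le i\le m+n$) of parity $|p+q+i|$, where $1\le a\le d$. Let $\mathcal D\subseteq\mathrm{End}(\mathcal F)$ be the Weyl superalgebra, generated by multiplication by these variables and by the left derivatives with respect to them. Let $\varphi:U_\gamma(\mathfrak{gl}_d)\to\mathcal D$ and $\phi:U_\xi(\mathfrak g)\to\mathcal D$ be the algebra homomorphisms determined as follows. For a block $i$ of $\gamma$ contained in $\{1,\dots,p+q\}$, $$\varphi(e_{ab}\otimes t_i^k)=-\sum_r y^b_r\,\partial_{y^a_{r+k}},$$ the sum over those $r$ for which $r$ and $r+k$ both lie in the block. For the other blocks $$\varphi(e_{ab}\otimes t_i^k)=\sum_r(-1)^{|p+q+r|}\,\partial_{x^b_r}\,x^a_{r+k},$$ the sum over those $r$ for which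 $p+q+r$ and $p+q+r+k$ both lie in the block. With $\alpha$ running over the integers such that $\alpha$ and $\alpha+k$ lie in the $a$-th block of $\xi$, and with $1\le r,s\le p+q$, $1\le i,j\le m+n$, $$\phi(E^r_s\otimes t_a^k)=\sum_\alpha(-1)^{|s|+1}\partial_{y^{\alpha+k}_r}y^\alpha_s,\qquad \phi(E^r_{p+q+j}\otimes t_a^k)=\sum_\alpha\partial_{y^{\alpha+k}_r}\partial_{x^\alpha_j},$$ $$\phi(E^{p+q+i}_s\otimes t_a^k)=\sum_\alpha(-1)^{|s|+1}x^{\alpha+k}_iy^\alpha_s,\qquad \phi(E^{p+q+i}_{p+q+j}\otimes t_a^k)=\sum_\alpha x^{\alpha+k}_i\partial_{x^\alpha_j}.$$ *Claim.* The Berezinian $\mathrm{Ber}\,\mathcal L$ is well defined (the leading submatrices of $\mathcal L$ and the lower right entries of their inverses are invertible), and $$\varphi\big(\mathcal A_d^{w,\xi}(z,\gamma)\big)=\phi\big(\mathcal A_{p+q|m+n}^{z,\gamma}(w,\xi)\big)$$ as subalgebras of $\mathcal D$. In particular the two Gaudin algebras have the same image in $\mathrm{End}(\mathcal F)$. -/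

import Mathlib

namespace GaudinDuality

/-! ### Pseudo-differential operators -/

/-- The additive group of formal series `∑ c i j z^i ∂^j` (`i, j ∈ ℤ`), exponents bounded above. -/
def PDO.seriesGroup (A : Type*) [Ring A] : AddSubgroup (ℤ → ℤ → A) where
  carrier := {c | ∃ r s : ℤ, ∀ i j, c i j ≠ 0 → i ≤ r ∧ j ≤ s}
  zero_mem' := ⟨0, 0, fun _ _ h => absurd rfl h⟩
  add_mem' := by
    rintro a b ⟨r, s, h⟩ ⟨r', s', h'⟩
    refine ⟨max r r', max s s', fun i j hij => ?_⟩
    by_cases ha : a i j = 0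
    · have hb : b i j ≠ 0 := fun hb => hij (by simp [ha, hb])
      exact ⟨(h' i j hb).1.trans (le_max_right _ _), (h' i j hb).2.trans (le_max_right _ _)⟩
    · exact ⟨(h i j ha).1.trans (le_max_left _ _), (h i j ha).2.trans (le_max_left _ _)⟩
  neg_mem' := by
    rintro a ⟨r, s, h⟩
    exact ⟨r, s, fun i j hij => h i j (fun h0 => hij (by simp [h0]))⟩

/-- The ring `A((z⁻¹, ∂⁻¹))` of pseudo-differential operators over `A`: formal series
`∑ c i j z^i ∂^j` with exponents bounded above, `c i j ∈ A`. The elements of `A` commute with `z` and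
`∂`, and `∂^j z^k = ∑_t binom(j,t) binom(k,t) t! z^(k-t) ∂^(j-t)` for all `j, k ∈ ℤ`. -/
def PDO (A : Type*) [Ring A] : Type _ := PDO.seriesGroup A

namespace PDO

variable {A : Type*} [Ring A]

instance : AddCommGroup (PDO A) := inferInstanceAs (AddCommGroup (PDO.seriesGroup A))

/-- The coefficient of `z^i ∂^j`. -/
def coeff (a : PDO A) (i j : ℤ) : A := a.1 i j

theorem ext' {a b : PDO A} (h : ∀ i j, a.coeff i j = b.coeff i j) : a = b :=
  Subtype.ext (funext fun i => funext fun j => h i j)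

theorem coeff_add (a b : PDO A) (i j : ℤ) : (a + b).coeff i j = a.coeff i j + b.coeff i j := rfl

theorem coeff_zero (i j : ℤ) : (0 : PDO A).coeff i j = 0 := rfl

theorem bdd (a : PDO A) : ∃ r s : ℤ, ∀ i j, a.coeff i j ≠ 0 → i ≤ r ∧ j ≤ s := a.2

/-- The integer `binom(j,t) binom(k,t) t!`, coefficient of `z^(k-t) ∂^(j-t)` in `∂^j z^k`. -/
def wt (j k : ℤ) (t : ℕ) : ℤ := Ring.choose j t * Ring.choose k t * (t.factorial : ℤ)

/-- The contribution, to the coefficient of `z^I ∂^J` in `a * b`, of the term of order `t` in the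
product of the monomial of `a` at `z^i ∂^j` with the monomial of `b` at
`z^(I-i+t) ∂^(J-j+t)`, where `x = (i, j, t)`. -/
def mulTerm (a b : PDO A) (I J : ℤ) (x : ℤ × ℤ × ℕ) : A :=
  wt x.2.1 (I - x.1 + x.2.2) x.2.2 •
    (a.coeff x.1 x.2.1 * b.coeff (I - x.1 + x.2.2) (J - x.2.1 + x.2.2))

theorem mulTerm_finite (a b : PDO A) (I J : ℤ) : (Function.support (mulTerm a b I J)).Finite := by
  obtain ⟨r, s, h⟩ := a.bdd
  obtain ⟨r', s', h'⟩ := b.bdd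
  refine ((Set.finite_Icc (I - r') r).prod ((Set.finite_Icc (J - s') s).prod
    (Set.finite_Iic (r + r' - I).toNat))).subset ?_
  rintro ⟨i, j, t⟩ hx
  have ha : a.coeff i j ≠ 0 := fun h0 => hx (by simp [mulTerm, h0])
  have hb : b.coeff (I - i + t) (J - j + t) ≠ 0 := fun h0 => hx (by simp [mulTerm, h0])
  have h1 := h _ _ ha
  have h2 := h' _ _ hb
  simp only [Set.mem_prod, Set.mem_Icc, Set.mem_Iic]
  omega

/-- The coefficient of `z^I ∂^J` in `a * b` is the (finite) sum of all `mulTerm a b I J x`. -/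
noncomputable instance : Mul (PDO A) where
  mul a b := ⟨fun I J => ∑ᶠ x : ℤ × ℤ × ℕ, mulTerm a b I J x, by
    obtain ⟨r, s, h⟩ := a.bdd
    obtain ⟨r', s', h'⟩ := b.bdd
    refine ⟨r + r', s + s', fun I J hIJ => ?_⟩
    obtain ⟨⟨i, j, t⟩, hx⟩ : ∃ x, mulTerm a b I J x ≠ 0 := by
      by_contra! h0
      exact hIJ (by simp [h0])
    have ha : a.coeff i j ≠ 0 := fun h0 => hx (by simp [mulTerm, h0])
    have hb : b.coeff (I - i + t) (J - j + t) ≠ 0 := fun h0 => hx (by simp [mulTerm, h0])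
    have h1 := h _ _ ha
    have h2 := h' _ _ hb
    omega⟩

theorem coeff_mul (a b : PDO A) (I J : ℤ) :
    (a * b).coeff I J = ∑ᶠ x : ℤ × ℤ × ℕ, mulTerm a b I J x := rfl

/-- The monomial `c z^i ∂^j`. -/
def monomial (i j : ℤ) (c : A) : PDO A :=
  ⟨fun i' j' => if i' = i ∧ j' = j then c else 0, i, j, fun i' j' h => by
    by_contra hc
    exact h (if_neg (fun hh => hc ⟨hh.1.le, hh.2.le⟩))⟩

theorem coeff_monomial (i j : ℤ) (c : A) (i' j' : ℤ) :
    (monomial i j c).coeff i' j' = if i' = i ∧ j' = j then c else 0 := rfl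

instance : One (PDO A) := ⟨monomial 0 0 1⟩

theorem coeff_one (i j : ℤ) : (1 : PDO A).coeff i j = if i = 0 ∧ j = 0 then 1 else 0 := rfl

theorem wt_zero (j k : ℤ) : wt j k 0 = 1 := by simp [wt]

theorem wt_zero_left (k : ℤ) {t : ℕ} (ht : t ≠ 0) : wt 0 k t = 0 := by
  simp [wt, Ring.choose_zero_pos ℤ (Nat.pos_of_ne_zero ht)]

theorem wt_zero_right (j : ℤ) {t : ℕ} (ht : t ≠ 0) : wt j 0 t = 0 := by
  simp [wt, Ring.choose_zero_pos ℤ (Nat.pos_of_ne_zero ht)]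

protected theorem one_mul' (a : PDO A) : 1 * a = a := by
  refine ext' fun I J => ?_
  rw [coeff_mul, finsum_eq_single _ ((0 : ℤ), (0 : ℤ), (0 : ℕ))]
  · simp [mulTerm, coeff_one, wt_zero]
  · rintro ⟨i, j, t⟩ hx
    simp only [mulTerm, coeff_one]
    split_ifs with h
    · obtain ⟨rfl, rfl⟩ := h
      have ht : t ≠ 0 := by rintro rfl; exact hx rfl
      simp [wt_zero_left _ ht]
    · simp

protected theorem mul_one' (a : PDO A) : a * 1 = a := by
  refine ext' fun I J => ?_
  rw [coeff_mul, finsum_eq_single _ (I, J, (0 : ℕ))]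
  · simp [mulTerm, coeff_one, wt_zero]
  · rintro ⟨i, j, t⟩ hx
    simp only [mulTerm, coeff_one]
    split_ifs with h
    · obtain ⟨h1, h2⟩ := h
      have ht : t ≠ 0 := by
        rintro rfl
        apply hx
        simp only [Nat.cast_zero, add_zero] at h1 h2
        simp only [Prod.mk.injEq, and_true]
        omega
      simp [h1, wt_zero_right _ ht]
    · simp

protected theorem add_mul' (a b c : PDO A) : (a + b) * c = a * c + b * c := by
  refine ext' fun I J => ?_
  rw [coeff_add, coeff_mul, coeff_mul, coeff_mul,
    ← finsum_add_distrib (mulTerm_finite a c I J) (mulTerm_finite b c I J)]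
  refine finsum_congr fun x => ?_
  simp [mulTerm, coeff_add, add_mul]

protected theorem mul_add' (a b c : PDO A) : a * (b + c) = a * b + a * c := by
  refine ext' fun I J => ?_
  rw [coeff_add, coeff_mul, coeff_mul, coeff_mul,
    ← finsum_add_distrib (mulTerm_finite a b I J) (mulTerm_finite a c I J)]
  refine finsum_congr fun x => ?_
  simp [mulTerm, coeff_add, mul_add]

theorem choose_mul_choose_sub (x : ℤ) (s u : ℕ) :
    Ring.choose x s * Ring.choose (x - s) u = ((s + u).choose s : ℤ) * Ring.choose x (s + u) := by
  have := Ring.choose_smul_choose x (Nat.le_add_right s u)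
  simp only [Nat.add_sub_cancel_left, nsmul_eq_mul] at this
  exact this.symm

/-- The combinatorial identity behind associativity. -/
theorem wt_assoc (j₁ j₂ i₂ i₃ : ℤ) (T : ℕ) :
    ∑ x ∈ Finset.HasAntidiagonal.antidiagonal T, wt j₁ i₂ x.1 * wt (j₁ + j₂ - x.1) i₃ x.2 =
    ∑ x ∈ Finset.HasAntidiagonal.antidiagonal T, wt j₁ (i₂ + i₃ - x.2) x.1 * wt j₂ i₃ x.2 := by
  have hL : ∀ x ∈ Finset.HasAntidiagonal.antidiagonal T, wt j₁ i₂ x.1 * wt (j₁ + j₂ - x.1) i₃ x.2 =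
      ∑ y ∈ Finset.HasAntidiagonal.antidiagonal x.2, Ring.choose j₁ (x.1 + y.1) * Ring.choose i₂ x.1 *
        Ring.choose j₂ y.2 * Ring.choose i₃ (y.1 + y.2) *
        (((x.1 + y.1).choose x.1 * x.1.factorial * (y.1 + y.2).factorial : ℕ) : ℤ) := by
    rintro ⟨s, t⟩ -
    have h := Ring.add_choose_eq (r := j₁ - s) (s := j₂) t (Commute.all _ _)
    have e : j₁ + j₂ - (s : ℤ) = j₁ - s + j₂ := by ring
    simp only [wt]
    rw [e, h, Finset.sum_mul, Finset.sum_mul, Finset.mul_sum]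
    refine Finset.sum_congr rfl ?_
    rintro ⟨u, v⟩ huv
    rw [Finset.HasAntidiagonal.mem_antidiagonal] at huv
    simp only at huv
    subst huv
    have h2 := choose_mul_choose_sub j₁ s u
    push_cast
    linear_combination (Ring.choose i₂ s * (s.factorial : ℤ) * Ring.choose j₂ v *
      Ring.choose i₃ (u + v) * ((u + v).factorial : ℤ)) * h2
  have hR : ∀ x ∈ Finset.HasAntidiagonal.antidiagonal T, wt j₁ (i₂ + i₃ - x.2) x.1 * wt j₂ i₃ x.2 =
      ∑ y ∈ Finset.HasAntidiagonal.antidiagonal x.1, Ring.choose j₁ (y.1 + y.2) * Ring.choose i₂ y.1 *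
        Ring.choose j₂ x.2 * Ring.choose i₃ (y.2 + x.2) *
        (((y.1 + y.2).choose y.1 * y.1.factorial * (y.2 + x.2).factorial : ℕ) : ℤ) := by
    rintro ⟨s', v⟩ -
    have h := Ring.add_choose_eq (r := i₂) (s := i₃ - v) s' (Commute.all _ _)
    have e : i₂ + i₃ - (v : ℤ) = i₂ + (i₃ - v) := by ring
    simp only [wt]
    rw [e, h, Finset.mul_sum, Finset.sum_mul, Finset.sum_mul]
    refine Finset.sum_congr rfl ?_
    rintro ⟨s, u⟩ hsu
    rw [Finset.HasAntidiagonal.mem_antidiagonal] at hsu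
    simp only at hsu
    subst hsu
    have h2 := choose_mul_choose_sub i₃ v u
    have h3 : ((v + u).choose v * v.factorial * u.factorial : ℤ) = ((v + u).factorial : ℤ) := by
      have := Nat.add_choose_mul_factorial_mul_factorial v u
      rw [← Nat.choose_symm_add] at this
      exact_mod_cast this
    have h4 : ((s + u).choose s * s.factorial * u.factorial : ℤ) = ((s + u).factorial : ℤ) := by
      have := Nat.add_choose_mul_factorial_mul_factorial s u
      rw [← Nat.choose_symm_add] at this
      exact_mod_cast this
    rw [add_comm u v]
    push_cast
    rw [← h4, ← h3]
    linear_combination (Ring.choose j₁ (s + u) * Ring.choose i₂ s * Ring.choose j₂ v *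
      ((s + u).choose s * s.factorial * u.factorial : ℤ) * (v.factorial : ℤ)) * h2
  rw [Finset.sum_congr rfl hL, Finset.sum_congr rfl hR, Finset.sum_sigma', Finset.sum_sigma']
  refine Finset.sum_nbij' (fun x => ⟨(x.1.1 + x.2.1, x.2.2), (x.1.1, x.2.1)⟩)
    (fun x => ⟨(x.2.1, x.2.2 + x.1.2), (x.2.2, x.1.2)⟩) ?_ ?_ ?_ ?_ ?_
  · rintro ⟨⟨s, t⟩, ⟨u, v⟩⟩ h
    simp only [Finset.mem_sigma, Finset.HasAntidiagonal.mem_antidiagonal] at h ⊢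
    obtain ⟨h1, h2⟩ := h
    constructor
    · omega
    · trivial
  · rintro ⟨⟨s, t⟩, ⟨u, v⟩⟩ h
    simp only [Finset.mem_sigma, Finset.HasAntidiagonal.mem_antidiagonal] at h ⊢
    obtain ⟨h1, h2⟩ := h
    constructor
    · omega
    · trivial
  · rintro ⟨⟨s, t⟩, ⟨u, v⟩⟩ h
    simp only [Finset.mem_sigma, Finset.HasAntidiagonal.mem_antidiagonal] at h ⊢
    obtain ⟨-, rfl⟩ := h
    rfl
  · rintro ⟨⟨s, t⟩, ⟨u, v⟩⟩ h
    simp only [Finset.mem_sigma, Finset.HasAntidiagonal.mem_antidiagonal] at h ⊢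
    obtain ⟨-, rfl⟩ := h
    rfl
  · rintro ⟨⟨s, t⟩, ⟨u, v⟩⟩ h
    rfl

theorem finsum_antidiagonal_congr (L R : ℕ × ℕ → ℤ) (f : ℕ → A) (B : ℕ)
    (hf : ∀ T, B ≤ T → f T = 0)
    (h : ∀ T, ∑ x ∈ Finset.HasAntidiagonal.antidiagonal T, L x = ∑ x ∈ Finset.HasAntidiagonal.antidiagonal T, R x) :
    ∑ᶠ x : ℕ × ℕ, L x • f (x.1 + x.2) = ∑ᶠ x : ℕ × ℕ, R x • f (x.1 + x.2) := by
  have key : ∀ L : ℕ × ℕ → ℤ, ∑ᶠ x : ℕ × ℕ, L x • f (x.1 + x.2) =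
      ∑ T ∈ Finset.range B, (∑ x ∈ Finset.HasAntidiagonal.antidiagonal T, L x) • f T := by
    intro L
    rw [finsum_eq_sum_of_support_subset (s := (Finset.range B).biUnion Finset.HasAntidiagonal.antidiagonal),
      Finset.sum_biUnion]
    · refine Finset.sum_congr rfl fun T _ => ?_
      rw [Finset.sum_smul]
      refine Finset.sum_congr rfl fun x hx => ?_
      rw [Finset.HasAntidiagonal.mem_antidiagonal.1 hx]
    · intro T _ T' _ hT
      rw [Function.onFun, Finset.disjoint_left]
      intro x hx hx'
      exact hT ((Finset.HasAntidiagonal.mem_antidiagonal.1 hx).symm.trans (Finset.HasAntidiagonal.mem_antidiagonal.1 hx'))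
    · intro x hx
      simp only [Finset.coe_biUnion, Set.mem_iUnion, Finset.mem_coe, Finset.HasAntidiagonal.mem_antidiagonal,
        Finset.mem_range]
      refine ⟨x.1 + x.2, ?_, rfl⟩
      by_contra hB
      exact hx (by simp [hf _ (not_lt.1 hB)])
  rw [key L, key R]
  exact Finset.sum_congr rfl fun T _ => by rw [h T]

/-- The triple product contribution; `p = ((i₁, j₁), (i₂, j₂))`. -/
def tri (a b c : PDO A) (I J : ℤ) (p : (ℤ × ℤ) × (ℤ × ℤ)) (T : ℕ) : A :=
  a.coeff p.1.1 p.1.2 * b.coeff p.2.1 p.2.2 *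
    c.coeff (I + T - p.1.1 - p.2.1) (J + T - p.1.2 - p.2.2)

theorem tri_finite (a b c : PDO A) (I J : ℤ) (W : ((ℤ × ℤ) × (ℤ × ℤ)) × (ℕ × ℕ) → ℤ) :
    (Function.support fun y : ((ℤ × ℤ) × (ℤ × ℤ)) × (ℕ × ℕ) =>
      W y • tri a b c I J y.1 (y.2.1 + y.2.2)).Finite := by
  obtain ⟨r, s, h⟩ := a.bdd
  obtain ⟨r', s', h'⟩ := b.bdd
  obtain ⟨r'', s'', h''⟩ := c.bdd
  refine ((((Set.finite_Icc (I - r' - r'') r).prod (Set.finite_Icc (J - s' - s'') s)).prod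
    ((Set.finite_Icc (I - r - r'') r').prod (Set.finite_Icc (J - s - s'') s'))).prod
    ((Set.finite_Iic (r + r' + r'' - I).toNat).prod
      (Set.finite_Iic (r + r' + r'' - I).toNat))).subset ?_
  rintro ⟨⟨⟨i, j⟩, ⟨i', j'⟩⟩, ⟨u, v⟩⟩ hx
  have ha : a.coeff i j ≠ 0 := fun h0 => hx (by simp [tri, h0])
  have hb : b.coeff i' j' ≠ 0 := fun h0 => hx (by simp [tri, h0])
  have hc : c.coeff (I + (u + v : ℕ) - i - i') (J + (u + v : ℕ) - j - j') ≠ 0 :=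
    fun h0 => hx (by simp only [tri, h0]; simp)
  have h1 := h _ _ ha
  have h2 := h' _ _ hb
  have h3 := h'' _ _ hc
  simp only [Set.mem_prod, Set.mem_Icc, Set.mem_Iic]
  push_cast at h3
  omega

/-- Change of summation variables on the left side of associativity. -/
def eqL : ((ℤ × ℤ) × (ℤ × ℤ)) × (ℕ × ℕ) ≃ (ℤ × ℤ × ℕ) × (ℤ × ℤ × ℕ) where
  toFun y := ((y.1.1.1 + y.1.2.1 - y.2.1, y.1.1.2 + y.1.2.2 - y.2.1, y.2.2),
    (y.1.1.1, y.1.1.2, y.2.1))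
  invFun x := (((x.2.1, x.2.2.1), (x.1.1 - x.2.1 + x.2.2.2, x.1.2.1 - x.2.2.1 + x.2.2.2)),
    (x.2.2.2, x.1.2.2))
  left_inv := by
    rintro ⟨⟨⟨i, j⟩, ⟨i', j'⟩⟩, ⟨u, v⟩⟩
    simp only [Prod.mk.injEq, and_true, true_and]
    omega
  right_inv := by
    rintro ⟨⟨i, j, t⟩, ⟨i', j', s⟩⟩
    simp only [Prod.mk.injEq, and_true]
    omega

/-- Change of summation variables on the right side of associativity. -/
def eqR : ((ℤ × ℤ) × (ℤ × ℤ)) × (ℕ × ℕ) ≃ (ℤ × ℤ × ℕ) × (ℤ × ℤ × ℕ) where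
  toFun y := ((y.1.1.1, y.1.1.2, y.2.1), (y.1.2.1, y.1.2.2, y.2.2))
  invFun x := (((x.1.1, x.1.2.1), (x.2.1, x.2.2.1)), (x.1.2.2, x.2.2.2))
  left_inv := fun _ => rfl
  right_inv := fun _ => rfl

theorem mul_assoc_left (a b c : PDO A) (I J : ℤ) :
    (a * b * c).coeff I J = ∑ᶠ p : (ℤ × ℤ) × (ℤ × ℤ), ∑ᶠ x : ℕ × ℕ,
      (wt p.1.2 p.2.1 x.1 * wt (p.1.2 + p.2.2 - x.1) (I + (x.1 + x.2 : ℕ) - p.1.1 - p.2.1) x.2) •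
        tri a b c I J p (x.1 + x.2) := by
  set W : ((ℤ × ℤ) × (ℤ × ℤ)) × (ℕ × ℕ) → ℤ := fun y => wt y.1.1.2 y.1.2.1 y.2.1 *
    wt (y.1.1.2 + y.1.2.2 - y.2.1) (I + (y.2.1 + y.2.2 : ℕ) - y.1.1.1 - y.1.2.1) y.2.2 with hW
  set G : (ℤ × ℤ × ℕ) × (ℤ × ℤ × ℕ) → A := fun q =>
    wt q.1.2.1 (I - q.1.1 + q.1.2.2) q.1.2.2 • (mulTerm a b q.1.1 q.1.2.1 q.2 *
      c.coeff (I - q.1.1 + q.1.2.2) (J - q.1.2.1 + q.1.2.2)) with hG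
  have hGW : ∀ y, W y • tri a b c I J y.1 (y.2.1 + y.2.2) = G (eqL y) := by
    rintro ⟨⟨⟨i, j⟩, ⟨i', j'⟩⟩, ⟨u, v⟩⟩
    simp only [hW, hG, eqL, mulTerm, tri, Equiv.coe_fn_mk, smul_mul_assoc, smul_smul]
    have e1 : i + i' - (u : ℤ) - i + u = i' := by ring
    have e2 : j + j' - (u : ℤ) - j + u = j' := by ring
    have e3 : I + ((u + v : ℕ) : ℤ) - i - i' = I - (i + i' - u) + v := by push_cast; ring
    have e4 : J + ((u + v : ℕ) : ℤ) - j - j' = J - (j + j' - u) + v := by push_cast; ring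
    rw [e1, e2, e3, e4, mul_comm]
  have hfin := tri_finite a b c I J W
  have hfinG : (Function.support G).Finite := by
    have : Function.support G = eqL '' (Function.support fun y =>
        W y • tri a b c I J y.1 (y.2.1 + y.2.2)) := by
      ext q
      constructor
      · intro hq
        refine ⟨eqL.symm q, ?_, eqL.apply_symm_apply q⟩
        simpa [hGW] using hq
      · rintro ⟨y, hy, rfl⟩
        simpa [hGW] using hy
    rw [this]
    exact hfin.image _
  calc (a * b * c).coeff I J = ∑ᶠ x : ℤ × ℤ × ℕ, ∑ᶠ y : ℤ × ℤ × ℕ, G (x, y) := by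
        rw [coeff_mul]
        refine finsum_congr fun x => ?_
        rw [mulTerm, coeff_mul, finsum_mul' _ _ (mulTerm_finite a b _ _), smul_finsum']
        · refine (mulTerm_finite a b x.1 x.2.1).subset ?_
          intro y hy h0
          exact hy (by simp only [h0, zero_mul])
    _ = ∑ᶠ q, G q := (finsum_curry G hfinG).symm
    _ = ∑ᶠ y, W y • tri a b c I J y.1 (y.2.1 + y.2.2) := by
        rw [← finsum_comp_equiv eqL]
        exact finsum_congr fun y => (hGW y).symm
    _ = _ := finsum_curry _ hfin

theorem mul_assoc_right (a b c : PDO A) (I J : ℤ) :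
    (a * (b * c)).coeff I J = ∑ᶠ p : (ℤ × ℤ) × (ℤ × ℤ), ∑ᶠ x : ℕ × ℕ,
      (wt p.1.2 (p.2.1 + (I + (x.1 + x.2 : ℕ) - p.1.1 - p.2.1) - x.2) x.1 *
        wt p.2.2 (I + (x.1 + x.2 : ℕ) - p.1.1 - p.2.1) x.2) •
        tri a b c I J p (x.1 + x.2) := by
  set W : ((ℤ × ℤ) × (ℤ × ℤ)) × (ℕ × ℕ) → ℤ := fun y =>
    wt y.1.1.2 (y.1.2.1 + (I + (y.2.1 + y.2.2 : ℕ) - y.1.1.1 - y.1.2.1) - y.2.2) y.2.1 *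
    wt y.1.2.2 (I + (y.2.1 + y.2.2 : ℕ) - y.1.1.1 - y.1.2.1) y.2.2 with hW
  set G : (ℤ × ℤ × ℕ) × (ℤ × ℤ × ℕ) → A := fun q =>
    wt q.1.2.1 (I - q.1.1 + q.1.2.2) q.1.2.2 • (a.coeff q.1.1 q.1.2.1 *
      mulTerm b c (I - q.1.1 + q.1.2.2) (J - q.1.2.1 + q.1.2.2) q.2) with hG
  have hGW : ∀ y, W y • tri a b c I J y.1 (y.2.1 + y.2.2) = G (eqR y) := by
    rintro ⟨⟨⟨i, j⟩, ⟨i', j'⟩⟩, ⟨u, v⟩⟩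
    simp only [hW, hG, eqR, mulTerm, tri, Equiv.coe_fn_mk, mul_smul_comm, smul_smul]
    have e1 : i' + (I + ((u + v : ℕ) : ℤ) - i - i') - v = I - i + u := by push_cast; ring
    have e3 : I + ((u + v : ℕ) : ℤ) - i - i' = I - i + u - i' + v := by push_cast; ring
    have e4 : J + ((u + v : ℕ) : ℤ) - j - j' = J - j + u - j' + v := by push_cast; ring
    rw [e1, e3, e4, mul_assoc]
  have hfin := tri_finite a b c I J W
  have hfinG : (Function.support G).Finite := by
    have : Function.support G = eqR '' (Function.support fun y =>
        W y • tri a b c I J y.1 (y.2.1 + y.2.2)) := by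
      ext q
      constructor
      · intro hq
        refine ⟨eqR.symm q, ?_, eqR.apply_symm_apply q⟩
        simpa [hGW] using hq
      · rintro ⟨y, hy, rfl⟩
        simpa [hGW] using hy
    rw [this]
    exact hfin.image _
  calc (a * (b * c)).coeff I J = ∑ᶠ x : ℤ × ℤ × ℕ, ∑ᶠ y : ℤ × ℤ × ℕ, G (x, y) := by
        rw [coeff_mul]
        refine finsum_congr fun x => ?_
        rw [mulTerm, coeff_mul, mul_finsum' _ _ (mulTerm_finite b c _ _), smul_finsum']
        · refine (mulTerm_finite b c (I - x.1 + x.2.2) (J - x.2.1 + x.2.2)).subset ?_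
          intro y hy h0
          exact hy (by simp only [h0, mul_zero])
    _ = ∑ᶠ q, G q := (finsum_curry G hfinG).symm
    _ = ∑ᶠ y, W y • tri a b c I J y.1 (y.2.1 + y.2.2) := by
        rw [← finsum_comp_equiv eqR]
        exact finsum_congr fun y => (hGW y).symm
    _ = _ := finsum_curry _ hfin

protected theorem mul_assoc' (a b c : PDO A) : a * b * c = a * (b * c) := by
  refine ext' fun I J => ?_
  rw [mul_assoc_left, mul_assoc_right]
  refine finsum_congr fun p => ?_
  obtain ⟨r, s, hc⟩ := c.bdd
  have hf : ∀ T : ℕ, (r + p.1.1 + p.2.1 - I).toNat + 1 ≤ T → tri a b c I J p T = 0 := by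
    intro T hT
    have : c.coeff (I + T - p.1.1 - p.2.1) (J + T - p.1.2 - p.2.2) = 0 := by
      by_contra h0
      have := (hc _ _ h0).1
      omega
    simp [tri, this]
  refine finsum_antidiagonal_congr
    (fun x => wt p.1.2 p.2.1 x.1 *
      wt (p.1.2 + p.2.2 - x.1) (I + (x.1 + x.2 : ℕ) - p.1.1 - p.2.1) x.2)
    (fun x => wt p.1.2 (p.2.1 + (I + (x.1 + x.2 : ℕ) - p.1.1 - p.2.1) - x.2) x.1 *
        wt p.2.2 (I + (x.1 + x.2 : ℕ) - p.1.1 - p.2.1) x.2)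
    (tri a b c I J p) _ hf fun T => ?_
  have := wt_assoc p.1.2 p.2.2 p.2.1 (I + (T : ℤ) - p.1.1 - p.2.1) T
  refine Eq.trans (Finset.sum_congr rfl fun x hx => ?_)
    (this.trans (Finset.sum_congr rfl fun x hx => ?_))
  · simp only [Finset.HasAntidiagonal.mem_antidiagonal.1 hx]
  · simp only [Finset.HasAntidiagonal.mem_antidiagonal.1 hx]

noncomputable instance : Ring (PDO A) :=
  { (inferInstance : AddCommGroup (PDO A)), (inferInstance : Mul (PDO A)),
    (inferInstance : One (PDO A)) with
    left_distrib := PDO.mul_add'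
    right_distrib := PDO.add_mul'
    zero_mul := fun a => by
      have h : (0 : PDO A) * a + 0 * a = 0 * a + 0 := by
        rw [← PDO.add_mul', add_zero, add_zero]
      exact add_left_cancel h
    mul_zero := fun a => by
      have h : a * (0 : PDO A) + a * 0 = a * 0 + 0 := by
        rw [← PDO.mul_add', add_zero, add_zero]
      exact add_left_cancel h
    mul_assoc := PDO.mul_assoc'
    one_mul := PDO.one_mul'
    mul_one := PDO.mul_one' }

end PDO

namespace PDO

variable {A : Type*} [Ring A]

/-- A constant `c ∈ A`. -/
def C (c : A) : PDO A := monomial 0 0 c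

/-- The variable `z`. -/
def Z : PDO A := monomial 1 0 1

/-- The derivation `∂_z`. -/
def D : PDO A := monomial 0 1 1

/-- `(z - c)⁻¹ = ∑_{r ≥ 0} c^r z^(-r-1)` for `c ∈ A`. -/
def invSub (c : A) : PDO A :=
  ⟨fun i j => if j = 0 ∧ i < 0 then c ^ (-i - 1).toNat else 0, -1, 0, fun i j h => by
    by_contra hc
    exact h (if_neg (fun hh => hc ⟨by omega, hh.1.le⟩))⟩

theorem coeff_invSub (c : A) (i j : ℤ) :
    (invSub c).coeff i j = if j = 0 ∧ i < 0 then c ^ (-i - 1).toNat else 0 := rfl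

theorem coeff_monomial_mul (i : ℤ) (c : A) (b : PDO A) (I J : ℤ) :
    (monomial i 0 c * b).coeff I J = c * b.coeff (I - i) J := by
  rw [coeff_mul, finsum_eq_single _ (i, (0 : ℤ), (0 : ℕ))]
  · simp [mulTerm, coeff_monomial, wt_zero]
  · rintro ⟨i', j, t⟩ hx
    simp only [mulTerm, coeff_monomial]
    split_ifs with h
    · obtain ⟨rfl, rfl⟩ := h
      have ht : t ≠ 0 := by rintro rfl; exact hx rfl
      simp [wt_zero_left _ ht]
    · simp

theorem coeff_mul_monomial (i : ℤ) (c : A) (a : PDO A) (ha : ∀ i j, j ≠ 0 → a.coeff i j = 0)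
    (I J : ℤ) : (a * monomial i 0 c).coeff I J = a.coeff (I - i) J * c := by
  rw [coeff_mul, finsum_eq_single _ (I - i, J, (0 : ℕ))]
  · simp [mulTerm, coeff_monomial, wt_zero]
  · rintro ⟨i', j, t⟩ hx
    simp only [mulTerm, coeff_monomial]
    by_cases hj : j = 0
    · subst hj
      by_cases ht : t = 0
      · subst ht
        rw [if_neg]
        · simp
        · rintro ⟨h1, h2⟩
          apply hx
          simp only [Nat.cast_zero, add_zero] at h1 h2
          simp only [Prod.mk.injEq, and_true]
          omega
      · simp [wt_zero_left _ ht]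
    · simp [ha _ _ hj]

/-- `invSub c` is the inverse of `z - c`. -/
theorem sub_mul_invSub (c : A) : (Z - C c) * invSub c = 1 := by
  refine ext' fun I J => ?_
  have h : ((Z - C c) * invSub c).coeff I J + (C c * invSub c).coeff I J =
      (Z * invSub c).coeff I J := by
    rw [← coeff_add, ← add_mul, sub_add_cancel]
  rw [C, Z, coeff_monomial_mul, coeff_monomial_mul, coeff_invSub, coeff_invSub] at h
  rw [coeff_one]
  refine (eq_sub_of_add_eq h).trans ?_
  by_cases hJ : J = 0
  · rcases lt_trichotomy I 0 with hI | hI | hI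
    · have e : (-(I - 1) - 1).toNat = (-(I - 0) - 1).toNat + 1 := by omega
      rw [if_pos ⟨hJ, by omega⟩, if_pos ⟨hJ, by omega⟩, if_neg (by omega), e, pow_succ']
      simp
    · subst hI; simp [hJ]
    · rw [if_neg (by omega), if_neg (by omega), if_neg (by omega)]; simp
  · simp [hJ]

theorem invSub_mul_sub (c : A) : invSub c * (Z - C c) = 1 := by
  refine ext' fun I J => ?_
  have h : (invSub c * (Z - C c)).coeff I J + (invSub c * C c).coeff I J =
      (invSub c * Z).coeff I J := by
    rw [← coeff_add, ← mul_add, sub_add_cancel]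
  have h0 : ∀ i j : ℤ, j ≠ 0 → (invSub c).coeff i j = 0 := fun i j hj => by
    rw [coeff_invSub, if_neg (fun hh => hj hh.1)]
  rw [C, Z, coeff_mul_monomial _ _ _ h0, coeff_mul_monomial _ _ _ h0, coeff_invSub,
    coeff_invSub] at h
  rw [coeff_one]
  refine (eq_sub_of_add_eq h).trans ?_
  by_cases hJ : J = 0
  · rcases lt_trichotomy I 0 with hI | hI | hI
    · have e : (-(I - 1) - 1).toNat = (-(I - 0) - 1).toNat + 1 := by omega
      rw [if_pos ⟨hJ, by omega⟩, if_pos ⟨hJ, by omega⟩, if_neg (by omega), e, pow_succ]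
      simp
    · subst hI; simp [hJ]
    · rw [if_neg (by omega), if_neg (by omega), if_neg (by omega)]; simp
  · simp [hJ]

end PDO

/-! ### The Fock space and the Weyl superalgebra -/

/-- `(-1)^x` for `x ∈ ℤ/2`. -/
noncomputable def sgn (x : ZMod 2) : ℂ := if x = 0 then 1 else -1

theorem zmod_two_cases : ∀ x : ZMod 2, x = 0 ∨ x = 1 := by decide

theorem sgn_zero : sgn 0 = 1 := if_pos rfl

theorem sgn_one : sgn 1 = -1 := if_neg (by decide)

theorem sgn_add (x y : ZMod 2) : sgn (x + y) = sgn x * sgn y := by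
  have h : (1 + 1 : ZMod 2) = 0 := by decide
  rcases zmod_two_cases x with rfl | rfl <;> rcases zmod_two_cases y with rfl | rfl <;>
    simp [sgn_zero, sgn_one, h]

theorem sgn_sq (x : ZMod 2) : sgn x * sgn x = 1 := by
  unfold sgn; split_ifs <;> norm_num

theorem sgn_mul_self (x : ZMod 2) : sgn (x * x) = sgn x := by
  rcases zmod_two_cases x with rfl | rfl <;> simp

theorem pderiv_comm {σ : Type*} (i j : σ) (f : MvPolynomial σ ℂ) :
    MvPolynomial.pderiv i (MvPolynomial.pderiv j f) =
      MvPolynomial.pderiv j (MvPolynomial.pderiv i f) := by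
  classical
  have h : ⁅MvPolynomial.pderiv (R := ℂ) i, MvPolynomial.pderiv (R := ℂ) j⁆ = 0 := by
    refine MvPolynomial.derivation_ext fun k => ?_
    simp only [Derivation.commutator_apply, MvPolynomial.pderiv_X, Pi.single_apply]
    split_ifs <;> simp
  have h2 := congrArg (fun D => D f) h
  simpa [Derivation.commutator_apply, sub_eq_zero] using h2

/-- The antiderivation `∂/∂η_j` of the exterior algebra on the generators `η_j`. -/
noncomputable def extDer {σ : Type*} (j : σ) : Module.End ℂ (ExteriorAlgebra ℂ (σ →₀ ℂ)) :=
  CliffordAlgebra.contractLeft (Q := (0 : QuadraticForm ℂ (σ →₀ ℂ))) (Finsupp.lapply j)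

/-- Left multiplication by the generator `η_j` of the exterior algebra. -/
noncomputable def extMul {σ : Type*} (j : σ) : Module.End ℂ (ExteriorAlgebra ℂ (σ →₀ ℂ)) :=
  LinearMap.mulLeft ℂ (ExteriorAlgebra.ι ℂ (Finsupp.single j 1))

/-- The derivative `∂/∂X_i` of the polynomial algebra. -/
noncomputable def polyDer {σ : Type*} (i : σ) : Module.End ℂ (MvPolynomial σ ℂ) :=
  (MvPolynomial.pderiv i).toLinearMap

/-- Multiplication by the variable `X_i` of the polynomial algebra. -/
noncomputable def polyMul {σ : Type*} (i : σ) : Module.End ℂ (MvPolynomial σ ℂ) :=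
  LinearMap.mulLeft ℂ (MvPolynomial.X i)

theorem polyMul_comm {σ : Type*} (i j : σ) : polyMul i * polyMul j = polyMul j * polyMul i :=
  LinearMap.ext fun x => mul_left_comm (MvPolynomial.X i) (MvPolynomial.X j) x

theorem polyDer_comm {σ : Type*} (i j : σ) : polyDer i * polyDer j = polyDer j * polyDer i :=
  LinearMap.ext fun x => pderiv_comm i j x

open scoped Classical in
theorem polyDer_polyMul {σ : Type*} (i j : σ) :
    polyDer i * polyMul j - polyMul j * polyDer i = if i = j then 1 else 0 := by
  refine LinearMap.ext fun x => ?_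
  change MvPolynomial.pderiv i (MvPolynomial.X j * x) -
    MvPolynomial.X j * MvPolynomial.pderiv i x = _
  rw [MvPolynomial.pderiv_mul, MvPolynomial.pderiv_X, add_sub_cancel_right]
  by_cases h : i = j
  · subst h; simp
  · simp [h, Ne.symm h]

theorem extMul_anticomm {σ : Type*} (i j : σ) :
    extMul i * extMul j = (-1 : ℂ) • (extMul j * extMul i) := by
  refine LinearMap.ext fun x => Eq.trans ?_ (neg_one_smul ℂ ((extMul j * extMul i) x)).symm
  change ExteriorAlgebra.ι ℂ _ * (ExteriorAlgebra.ι ℂ _ * x) =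
    -(ExteriorAlgebra.ι ℂ _ * (ExteriorAlgebra.ι ℂ _ * x))
  rw [← mul_assoc, ← mul_assoc, ← neg_mul,
    eq_neg_of_add_eq_zero_left (ExteriorAlgebra.ι_add_mul_swap (R := ℂ) _ _)]

theorem extDer_anticomm {σ : Type*} (i j : σ) :
    extDer i * extDer j = (-1 : ℂ) • (extDer j * extDer i) := by
  refine LinearMap.ext fun x => Eq.trans ?_ (neg_one_smul ℂ ((extDer j * extDer i) x)).symm
  exact CliffordAlgebra.contractLeft_comm _ _ x

open scoped Classical in
theorem extDer_extMul {σ : Type*} (i j : σ) :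
    extDer i * extMul j = (-1 : ℂ) • (extMul j * extDer i) + if i = j then 1 else 0 := by
  refine LinearMap.ext fun x => ?_
  refine (CliffordAlgebra.contractLeft_ι_mul _ _ x).trans ?_
  refine (sub_eq_neg_add _ _).trans ?_
  refine congrArg₂ (· + ·) (neg_one_smul ℂ ((extMul j * extDer i) x)).symm ?_
  rw [Finsupp.lapply_apply, Finsupp.single_apply]
  by_cases h : i = j
  · subst h; simp
  · simp [h, Ne.symm h]

theorem tensor_comm {V W : Type*} [AddCommGroup V] [Module ℂ V] [AddCommGroup W] [Module ℂ W]
    (f : Module.End ℂ V) (g : Module.End ℂ W) :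
    (LinearMap.rTensor W f : Module.End ℂ (TensorProduct ℂ V W)) * LinearMap.lTensor V g =
      LinearMap.lTensor V g * LinearMap.rTensor W f := by
  rw [Module.End.mul_eq_comp, Module.End.mul_eq_comp, LinearMap.rTensor_comp_lTensor,
    LinearMap.lTensor_comp_rTensor]

section Fock

variable {N : ℕ} (d : ℕ) (par : Fin N → ZMod 2)

/-- The polynomial superalgebra over `ℂ` in variables `v^a_r`, where `a` runs over `Fin d`, `r` over
`Fin N`, and `v^a_r` has parity `par r`: the polynomial algebra in the even variables tensored with
the exterior algebra in the odd variables. -/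
abbrev FockTensor : Type :=
  TensorProduct ℂ (MvPolynomial {x : Fin d × Fin N // par x.2 = 0} ℂ)
    (ExteriorAlgebra ℂ ({x : Fin d × Fin N // par x.2 ≠ 0} →₀ ℂ))

/-- The Fock space: `FockTensor` with its structure of vector space over `ℂ`. -/
def Fock : Type := FockTensor d par

noncomputable instance : AddCommGroup (Fock d par) :=
  inferInstanceAs (AddCommGroup (FockTensor d par))

noncomputable instance : Module ℂ (Fock d par) :=
  inferInstanceAs (Module ℂ (FockTensor d par))

variable {d}

/-- Left multiplication by the variable `v^a_r`. -/
noncomputable def mulVarT (a : Fin d) (r : Fin N) : Module.End ℂ (FockTensor d par) :=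
  if h : par r = 0 then LinearMap.rTensor _ (polyMul ⟨(a, r), h⟩)
  else LinearMap.lTensor _ (extMul ⟨(a, r), h⟩)

/-- The left derivative with respect to the variable `v^a_r`. -/
noncomputable def derVarT (a : Fin d) (r : Fin N) : Module.End ℂ (FockTensor d par) :=
  if h : par r = 0 then LinearMap.rTensor _ (polyDer ⟨(a, r), h⟩)
  else LinearMap.lTensor _ (extDer ⟨(a, r), h⟩)

theorem mulVarT_mulVarT (a b : Fin d) (r s : Fin N) :
    mulVarT par a r * mulVarT par b s =
      sgn (par r * par s) • (mulVarT par b s * mulVarT par a r) := by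
  unfold mulVarT
  rcases zmod_two_cases (par r) with hr | hr <;> rcases zmod_two_cases (par s) with hs | hs <;>
    simp only [hr, hs, dif_pos, dif_neg, one_ne_zero, not_false_iff, mul_zero, mul_one,
      sgn_zero, sgn_one, one_smul]
  · rw [← LinearMap.rTensor_mul, ← LinearMap.rTensor_mul, polyMul_comm]
  · exact tensor_comm _ _
  · exact (tensor_comm _ _).symm
  · rw [← LinearMap.lTensor_mul, ← LinearMap.lTensor_mul, extMul_anticomm, LinearMap.lTensor_smul]

theorem derVarT_derVarT (a b : Fin d) (r s : Fin N) :
    derVarT par a r * derVarT par b s =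
      sgn (par r * par s) • (derVarT par b s * derVarT par a r) := by
  unfold derVarT
  rcases zmod_two_cases (par r) with hr | hr <;> rcases zmod_two_cases (par s) with hs | hs <;>
    simp only [hr, hs, dif_pos, dif_neg, one_ne_zero, not_false_iff, mul_zero, mul_one,
      sgn_zero, sgn_one, one_smul]
  · rw [← LinearMap.rTensor_mul, ← LinearMap.rTensor_mul, polyDer_comm]
  · exact tensor_comm _ _
  · exact (tensor_comm _ _).symm
  · rw [← LinearMap.lTensor_mul, ← LinearMap.lTensor_mul, extDer_anticomm, LinearMap.lTensor_smul]

theorem derVarT_mulVarT (a b : Fin d) (r s : Fin N) :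
    derVarT par a r * mulVarT par b s = sgn (par r * par s) • (mulVarT par b s * derVarT par a r) +
      if a = b ∧ r = s then 1 else 0 := by
  unfold derVarT mulVarT
  rcases zmod_two_cases (par r) with hr | hr <;> rcases zmod_two_cases (par s) with hs | hs <;>
    simp only [hr, hs, dif_pos, dif_neg, one_ne_zero, not_false_iff, mul_zero, mul_one,
      sgn_zero, sgn_one, one_smul]
  · rw [← LinearMap.rTensor_mul, ← LinearMap.rTensor_mul,
      eq_add_of_sub_eq' (polyDer_polyMul _ _), LinearMap.rTensor_add]
    congr 1
    by_cases h : a = b ∧ r = s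
    · rw [if_pos h, if_pos (by simp [h.1, h.2])]
      exact LinearMap.rTensor_id _ _
    · rw [if_neg h, if_neg (fun hh => h (by simpa using hh))]
      exact LinearMap.rTensor_zero _
  · rw [if_neg, add_zero]
    · exact tensor_comm _ _
    · rintro ⟨-, rfl⟩
      simp [hr] at hs
  · rw [if_neg, add_zero]
    · exact (tensor_comm _ _).symm
    · rintro ⟨-, rfl⟩
      simp [hr] at hs
  · rw [← LinearMap.lTensor_mul, ← LinearMap.lTensor_mul, extDer_extMul,
      LinearMap.lTensor_add, LinearMap.lTensor_smul]
    congr 1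
    by_cases h : a = b ∧ r = s
    · rw [if_pos h, if_pos (by simp [h.1, h.2])]
      exact LinearMap.lTensor_id _ _
    · rw [if_neg h, if_neg (fun hh => h (by simpa using hh))]
      exact LinearMap.lTensor_zero _

/-- Left multiplication by `v^a_r` as an operator on the Fock space. -/
noncomputable def mulVar (a : Fin d) (r : Fin N) : Module.End ℂ (Fock d par) := mulVarT par a r

/-- The left derivative with respect to `v^a_r` as an operator on the Fock space. -/
noncomputable def derVar (a : Fin d) (r : Fin N) : Module.End ℂ (Fock d par) := derVarT par a r

theorem mulVar_mulVar (a b : Fin d) (r s : Fin N) :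
    mulVar par a r * mulVar par b s =
      sgn (par r * par s) • (mulVar par b s * mulVar par a r) := mulVarT_mulVarT par a b r s

theorem derVar_derVar (a b : Fin d) (r s : Fin N) :
    derVar par a r * derVar par b s =
      sgn (par r * par s) • (derVar par b s * derVar par a r) := derVarT_derVarT par a b r s

theorem derVar_mulVar (a b : Fin d) (r s : Fin N) :
    derVar par a r * mulVar par b s = sgn (par r * par s) • (mulVar par b s * derVar par a r) +
      if a = b ∧ r = s then 1 else 0 := derVarT_mulVarT par a b r s

/-- The Weyl superalgebra: the algebra of operators on the polynomial superalgebra generated by the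
(multiplications by the) variables and the derivatives. -/
noncomputable def Weyl (d : ℕ) {N : ℕ} (par : Fin N → ZMod 2) :
    Subalgebra ℂ (Module.End ℂ (Fock d par)) :=
  Algebra.adjoin ℂ {T | ∃ (a : Fin d) (r : Fin N), T = mulVar par a r ∨ T = derVar par a r}

/-- The variable `v^a_r` as an element of the Weyl superalgebra. -/
noncomputable def V (a : Fin d) (r : Fin N) : Weyl d par :=
  ⟨mulVar par a r, Algebra.subset_adjoin ⟨a, r, Or.inl rfl⟩⟩

/-- The derivative `∂/∂v^a_r` as an element of the Weyl superalgebra. -/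
noncomputable def P (a : Fin d) (r : Fin N) : Weyl d par :=
  ⟨derVar par a r, Algebra.subset_adjoin ⟨a, r, Or.inr rfl⟩⟩

theorem V_V (a b : Fin d) (r s : Fin N) :
    V par a r * V par b s = sgn (par r * par s) • (V par b s * V par a r) :=
  Subtype.ext (mulVar_mulVar par a b r s)

theorem P_P (a b : Fin d) (r s : Fin N) :
    P par a r * P par b s = sgn (par r * par s) • (P par b s * P par a r) :=
  Subtype.ext (derVar_derVar par a b r s)

theorem P_V (a b : Fin d) (r s : Fin N) :
    P par a r * V par b s = sgn (par r * par s) • (V par b s * P par a r) +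
      if a = b ∧ r = s then 1 else 0 := by
  refine Subtype.ext ((derVar_mulVar par a b r s).trans ?_)
  split_ifs <;> rfl

end Fock

/-! ### Enveloping algebras of direct sums of Takiff superalgebras -/

section Env

variable {N ℓ : ℕ} (par : Fin N → ZMod 2) (g : Fin ℓ → ℕ)

/-- The defining relations of the universal enveloping algebra of the direct sum over `a : Fin ℓ` of
the Takiff superalgebras `gl ⊗ ℂ[t]/t^(g a)`. Here `gl` has homogeneous basis `E^i_j` of parity
`par i + par j`, and the generator `(i, j, a, k)` stands for the element `E^i_j ⊗ t^k` of the
`a`-th summand. -/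
inductive EnvRel : FreeAlgebra ℂ (Fin N × Fin N × Fin ℓ × ℕ) →
    FreeAlgebra ℂ (Fin N × Fin N × Fin ℓ × ℕ) → Prop
  | trunc (i j : Fin N) (a : Fin ℓ) (k : ℕ) (h : g a ≤ k) :
      EnvRel (FreeAlgebra.ι ℂ (i, j, a, k)) 0
  | bracket (i j r s : Fin N) (a b : Fin ℓ) (k l : ℕ) :
      EnvRel
        (FreeAlgebra.ι ℂ (i, j, a, k) * FreeAlgebra.ι ℂ (r, s, b, l) -
          sgn ((par i + par j) * (par r + par s)) •
            (FreeAlgebra.ι ℂ (r, s, b, l) * FreeAlgebra.ι ℂ (i, j, a, k)))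
        (if a = b then
          (if j = r then FreeAlgebra.ι ℂ (i, s, a, k + l) else 0) -
            sgn ((par i + par j) * (par r + par s)) •
              (if i = s then FreeAlgebra.ι ℂ (r, j, a, k + l) else 0)
        else 0)

/-- The universal enveloping (super)algebra of `⨁_a gl ⊗ ℂ[t]/t^(g a)`. -/
abbrev Env : Type := RingQuot (EnvRel par g)

/-- The element `E^i_j ⊗ t^k` of the `a`-th Takiff superalgebra. -/
noncomputable def Env.E (i j : Fin N) (a : Fin ℓ) (k : ℕ) : Env par g :=
  RingQuot.mkAlgHom ℂ (EnvRel par g) (FreeAlgebra.ι ℂ (i, j, a, k))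

/-- The universal property of the enveloping algebra. -/
noncomputable def Env.lift {B : Type*} [Ring B] [Algebra ℂ B] (f : Fin N → Fin N → Fin ℓ → ℕ → B)
    (h₁ : ∀ i j a k, g a ≤ k → f i j a k = 0)
    (h₂ : ∀ i j r s a b k l,
      f i j a k * f r s b l - sgn ((par i + par j) * (par r + par s)) • (f r s b l * f i j a k) =
        if a = b then (if j = r then f i s a (k + l) else 0) -
            sgn ((par i + par j) * (par r + par s)) • (if i = s then f r j a (k + l) else 0)
        else 0) : Env par g →ₐ[ℂ] B :=
  RingQuot.liftAlgHom ℂ ⟨FreeAlgebra.lift ℂ fun x => f x.1 x.2.1 x.2.2.1 x.2.2.2, by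
    intro x y hxy
    cases hxy with
    | trunc i j a k h => simpa using h₁ i j a k h
    | bracket i j r s a b k l =>
      have := h₂ i j r s a b k l
      split_ifs at this ⊢ <;> simpa using this⟩

theorem Env.lift_E {B : Type*} [Ring B] [Algebra ℂ B] (f : Fin N → Fin N → Fin ℓ → ℕ → B)
    (h₁) (h₂) (i j : Fin N) (a : Fin ℓ) (k : ℕ) :
    Env.lift par g f h₁ h₂ (Env.E par g i j a k) = f i j a k := by
  simp [Env.lift, Env.E]

end Env

/-! ### Column determinants, Berezinians, Gaudin algebras -/

section Gaudin

/-- The column determinant. -/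
def cdet {k : ℕ} {R : Type*} [Ring R] (M : Matrix (Fin k) (Fin k) R) : R :=
  ∑ σ : Equiv.Perm (Fin k), ((Equiv.Perm.sign σ : ℤˣ) : ℤ) •
    (List.ofFn fun j => M (σ j) j).prod

/-- The leading submatrix with rows and columns up to and including `i`. -/
def leading {k : ℕ} {R : Type*} (M : Matrix (Fin k) (Fin k) R) (i : Fin k) :
    Matrix (Fin ((i : ℕ) + 1)) (Fin ((i : ℕ) + 1)) R :=
  M.submatrix (Fin.castLE i.isLt) (Fin.castLE i.isLt)

/-- The lower right entry of the inverse of the leading submatrix `leading M i`. -/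
noncomputable def cornerInv {k : ℕ} {R : Type*} [Ring R] (M : Matrix (Fin k) (Fin k) R)
    (i : Fin k) : R :=
  (Ring.inverse (leading M i)) (Fin.last i) (Fin.last i)

/-- The principal quasiminor `d_i(M)`: the inverse of the `(i,i)` entry of the inverse of the
leading submatrix. -/
noncomputable def quasiminor {k : ℕ} {R : Type*} [Ring R] (M : Matrix (Fin k) (Fin k) R)
    (i : Fin k) : R :=
  Ring.inverse (cornerInv M i)

/-- All principal quasiminors are well defined: every leading submatrix is invertible, and the lower
right entry of its inverse is invertible. -/
def SufficientlyInvertible {k : ℕ} {R : Type*} [Ring R] (M : Matrix (Fin k) (Fin k) R) : Prop :=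
  ∀ i, IsUnit (leading M i) ∧ IsUnit (cornerInv M i)

/-- The Berezinian `d_1(M)^{±1} ⋯ d_k(M)^{±1}`, with exponent `(-1)^{par i}` in the `i`-th place. -/
noncomputable def ber {k : ℕ} {R : Type*} [Ring R] (par : Fin k → ZMod 2)
    (M : Matrix (Fin k) (Fin k) R) : R :=
  (List.ofFn fun i => if par i = 0 then quasiminor M i else Ring.inverse (quasiminor M i)).prod

variable {N ℓ : ℕ} (par : Fin N → ZMod 2) (g : Fin ℓ → ℕ)

/-- The series `μ(E^i_j) - ∑_a ∑_{k < g a} (E^i_j ⊗ t^k) / (z - z_a)^(k+1)`, where the functional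
`μ` on `gl` is given by the matrix of its values. -/
noncomputable def Psi (μ : Matrix (Fin N) (Fin N) ℂ) (z : Fin ℓ → ℂ) (i j : Fin N) :
    PDO (Env par g) :=
  PDO.C (algebraMap ℂ (Env par g) (μ i j)) -
    ∑ a : Fin ℓ, ∑ k ∈ Finset.range (g a),
      PDO.C (Env.E par g i j a k) * PDO.invSub (algebraMap ℂ (Env par g) (z a)) ^ (k + 1)

/-- The matrix `[δ_{ij} ∂_z + (-1)^{par i} Psi(E^i_j)]`. -/
noncomputable def lax (μ : Matrix (Fin N) (Fin N) ℂ) (z : Fin ℓ → ℂ) :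
    Matrix (Fin N) (Fin N) (PDO (Env par g)) := fun i j =>
  (if i = j then PDO.D else 0) +
    PDO.C (algebraMap ℂ (Env par g) (sgn (par i))) * Psi par g μ z i j

/-- The Gaudin algebra of `gl_d` with singularities of orders `g a` at `z a`: it is generated by the
coefficients of the series `a_i(z)`, `0 ≤ i < d`, in
`cdet (lax) = ∂_z^d + ∑_{i < d} a_i(z) ∂_z^i`. -/
noncomputable def gaudinGL (d : ℕ) {ℓ : ℕ} (g : Fin ℓ → ℕ) (μ : Matrix (Fin d) (Fin d) ℂ)
    (z : Fin ℓ → ℂ) : Subalgebra ℂ (Env (fun _ : Fin d => 0) g) :=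
  Algebra.adjoin ℂ {c | ∃ (i : Fin d) (r : ℤ),
    c = (cdet (lax (fun _ : Fin d => 0) g μ z)).coeff r ((i : ℕ) : ℤ)}

/-- The Gaudin algebra of the general linear Lie superalgebra with singularities of orders `g a` at
`z a`: it is generated by the coefficients of the series `b_i(z)`, `i ∈ ℤ`, in
`Ber (lax) = ∑_i b_i(z) ∂_z^i`. -/
noncomputable def gaudinSuper (μ : Matrix (Fin N) (Fin N) ℂ) (z : Fin ℓ → ℂ) :
    Subalgebra ℂ (Env par g) :=
  Algebra.adjoin ℂ {c | ∃ i r : ℤ, c = (ber par (lax par g μ z)).coeff r i}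

/-- The Jordan matrix with blocks of sizes given by the composition `c` and eigenvalues `x`. -/
def jordan {k : ℕ} (c : Composition k) (x : Fin c.length → ℂ) : Matrix (Fin k) (Fin k) ℂ :=
  fun r s => if r = s then x (c.index r)
    else if (s : ℕ) = r + 1 ∧ c.index r = c.index s then 1 else 0

end Gaudin

/-! ### The two actions -/

section Actions

/-- `r` and `r'` lie in the `i`-th block of the composition `c`, and `r' = r + k`. -/
def IsShift {k : ℕ} (c : Composition k) (i : Fin c.length) (l : ℕ) (r r' : Fin k) : Prop :=
  c.index r = i ∧ c.index r' = i ∧ (r' : ℕ) = r + l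

instance {k : ℕ} (c : Composition k) (i : Fin c.length) (l : ℕ) (r r' : Fin k) :
    Decidable (IsShift c i l r r') := inferInstanceAs (Decidable (_ ∧ _ ∧ _))

theorem index_lt_iff {k : ℕ} (c : Composition k) (i h : ℕ) (hi : c.sizeUpTo i = h) (r : Fin k) :
    (r : ℕ) < h ↔ (c.index r : ℕ) < i := by
  subst hi
  constructor
  · intro hr
    by_contra hh
    have := c.monotone_sizeUpTo (not_lt.1 hh)
    have := c.sizeUpTo_index_le r
    omega
  · intro hr
    have h1 := c.monotone_sizeUpTo (Nat.succ_le_of_lt hr)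
    have h2 := c.lt_sizeUpTo_index_succ r
    exact lt_of_lt_of_le h2 h1

theorem index_mono {k : ℕ} (c : Composition k) {r s : Fin k} (h : r ≤ s) :
    c.index r ≤ c.index s := by
  by_contra hh
  have h1 := (index_lt_iff c (c.index r) _ rfl s).2 (not_le.1 hh)
  have h2 := c.sizeUpTo_index_le r
  have h3 : (r : ℕ) ≤ s := h
  omega

theorem IsShift.zero {k : ℕ} (c : Composition k) (i : Fin c.length) (l : ℕ)
    (hl : c.blocksFun i ≤ l) (r r' : Fin k) : ¬ IsShift c i l r r' := by
  rintro ⟨h1, h2, h3⟩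
  have a1 := c.sizeUpTo_index_le r
  have a2 := c.lt_sizeUpTo_index_succ r'
  have a3 := c.sizeUpTo_succ' i
  rw [h1] at a1
  rw [h2] at a2
  simp only [Fin.val_succ] at a2
  omega

/-- The `0/1` shift matrix on block `i`. -/
noncomputable def shiftC {k : ℕ} (c : Composition k) (i : Fin c.length) (l : ℕ) (r r' : Fin k) :
    ℂ := if IsShift c i l r r' then 1 else 0

theorem shiftC_mul {k : ℕ} (c : Composition k) (i j : Fin c.length) (l l' : ℕ) (r r' : Fin k) :
    ∑ s, shiftC c i l r s * shiftC c j l' s r' = if i = j then shiftC c i (l + l') r r' else 0 := by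
  by_cases hij : i = j
  · subst hij
    rw [if_pos rfl]
    by_cases h : IsShift c i (l + l') r r'
    · have hlt : (r : ℕ) + l < k := by have := h.2.2; have := r'.isLt; omega
      rw [Finset.sum_eq_single ⟨r + l, hlt⟩]
      · have hs : c.index ⟨r + l, hlt⟩ = i := by
          apply le_antisymm
          · rw [← h.2.1]
            exact index_mono c (by rw [Fin.le_def]; have := h.2.2; simp only; omega)
          · rw [← h.1]
            exact index_mono c (by rw [Fin.le_def]; simp only; omega)
        have h1 : IsShift c i l r ⟨r + l, hlt⟩ := ⟨h.1, hs, rfl⟩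
        have h2 : IsShift c i l' ⟨r + l, hlt⟩ r' :=
          ⟨hs, h.2.1, by have := h.2.2; simp only; omega⟩
        simp [shiftC, h, h1, h2]
      · intro s _ hs
        have : ¬ IsShift c i l r s := fun hh => hs (Fin.ext hh.2.2)
        simp [shiftC, this]
      · simp
    · simp only [shiftC, if_neg h]
      refine Finset.sum_eq_zero fun s _ => ?_
      by_cases h1 : IsShift c i l r s
      · have h2 : ¬ IsShift c i l' s r' := fun hh =>
          h ⟨h1.1, hh.2.1, by have := hh.2.2; have := h1.2.2; omega⟩
        simp [h2]
      · simp [h1]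
  · rw [if_neg hij]
    refine Finset.sum_eq_zero fun s _ => ?_
    by_cases h1 : IsShift c i l r s
    · have h2 : ¬ IsShift c j l' s r' := fun hh => hij (h1.2.1.symm.trans hh.1)
      simp [shiftC, h2]
    · simp [shiftC, h1]

theorem comm4 {B : Type*} [Ring B] [Algebra ℂ B] {a b c e : B} {e₁ e₂ e₃ e₄ c₁ c₂ s : ℂ}
    (hbc : b * c = e₁ • (c * b) + c₁ • (1 : B)) (hac : a * c = e₂ • (c * a))
    (hbe : b * e = e₃ • (e * b)) (hea : e * a = e₄ • (a * e) + c₂ • (1 : B))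
    (hs : s * e₄ = e₁ * e₂ * e₃) :
    a * b * (c * e) - s • (c * e * (a * b)) = c₁ • (a * e) - (s * c₂) • (c * b) := by
  have h1 : a * b * (c * e) = (e₁ * e₂ * e₃) • (c * a * (e * b)) + c₁ • (a * e) := by
    calc a * b * (c * e) = a * (b * c) * e := by simp only [mul_assoc]
      _ = e₁ • ((a * c) * (b * e)) + c₁ • (a * e) := by
        rw [hbc]; simp only [mul_add, add_mul, mul_smul_comm, smul_mul_assoc, mul_one, mul_assoc]
      _ = _ := by
        rw [hac, hbe]; simp only [mul_smul_comm, smul_mul_assoc, smul_smul]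
        congr 2; ring
  have h2 : c * e * (a * b) = e₄ • (c * a * (e * b)) + c₂ • (c * b) := by
    calc c * e * (a * b) = c * (e * a) * b := by simp only [mul_assoc]
      _ = _ := by
        rw [hea]; simp only [mul_add, add_mul, mul_smul_comm, smul_mul_assoc, mul_one, mul_assoc]
  rw [h1, h2, smul_add, smul_smul, smul_smul, hs]
  abel

variable {N d : ℕ} (par : Fin N → ZMod 2) (h : ℕ)

/-- `∂/∂v^a_r` for `r < h`, and `v^a_r` for `r ≥ h`. -/
noncomputable def Lop (a : Fin d) (r : Fin N) : Weyl d par :=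
  if (r : ℕ) < h then P par a r else V par a r

/-- `(-1)^{par r + 1} v^a_r` for `r < h`, and `∂/∂v^a_r` for `r ≥ h`. -/
noncomputable def Rop (a : Fin d) (r : Fin N) : Weyl d par :=
  if (r : ℕ) < h then (-sgn (par r)) • V par a r else P par a r

theorem V_P (a b : Fin d) (r s : Fin N) :
    V par a r * P par b s = sgn (par r * par s) • (P par b s * V par a r) -
      if a = b ∧ r = s then sgn (par r) • (1 : Weyl d par) else 0 := by
  rw [P_V, smul_add, smul_smul, mul_comm (par s), sgn_sq, one_smul]
  by_cases hh : a = b ∧ r = s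
  · obtain ⟨rfl, rfl⟩ := hh
    simp [sgn_mul_self]
  · have h' : ¬ (b = a ∧ s = r) := fun x => hh ⟨x.1.symm, x.2.symm⟩
    simp [hh, h']

theorem L_L (a b : Fin d) (r s : Fin N) :
    Lop par h a r * Lop par h b s = sgn (par r * par s) • (Lop par h b s * Lop par h a r) := by
  unfold Lop
  split_ifs with h1 h2 h2
  · exact P_P par a b r s
  · rw [P_V, if_neg, add_zero]
    rintro ⟨-, rfl⟩; exact h2 h1
  · rw [V_P, if_neg, sub_zero]
    rintro ⟨-, rfl⟩; exact h1 h2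
  · exact V_V par a b r s

theorem R_R (a b : Fin d) (r s : Fin N) :
    Rop par h a r * Rop par h b s = sgn (par r * par s) • (Rop par h b s * Rop par h a r) := by
  unfold Rop
  split_ifs with h1 h2 h2
  · simp only [smul_mul_assoc, mul_smul_comm, smul_smul]
    rw [V_V, smul_smul]
    congr 1; ring
  · simp only [smul_mul_assoc, mul_smul_comm, smul_smul]
    rw [V_P, if_neg, sub_zero, smul_smul]
    · congr 1; ring
    · rintro ⟨-, rfl⟩; exact h2 h1
  · simp only [smul_mul_assoc, mul_smul_comm, smul_smul]
    rw [P_V, if_neg, add_zero, smul_smul]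
    · congr 1; ring
    · rintro ⟨-, rfl⟩; exact h1 h2
  · exact P_P par a b r s

theorem R_L (a b : Fin d) (r s : Fin N) :
    Rop par h a r * Lop par h b s = sgn (par r * par s) • (Lop par h b s * Rop par h a r) +
      (if a = b ∧ r = s then (1 : ℂ) else 0) • (1 : Weyl d par) := by
  unfold Rop Lop
  by_cases h1 : (r : ℕ) < h <;> by_cases h2 : (s : ℕ) < h <;>
    simp only [h1, h2, if_true, if_false, smul_mul_assoc, mul_smul_comm]
  · rw [V_P, smul_sub, smul_smul, smul_smul]
    by_cases hh : a = b ∧ r = s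
    · rw [if_pos hh, if_pos hh, smul_smul, neg_mul (sgn (par r)) (sgn (par r)), sgn_sq, neg_smul,
        sub_neg_eq_add]
      congr 2; ring
    · rw [if_neg hh, if_neg hh, smul_zero, zero_smul, sub_zero, add_zero]
      congr 1; ring
  · have hh : ¬ (a = b ∧ r = s) := by rintro ⟨-, rfl⟩; exact h2 h1
    rw [if_neg hh, zero_smul, add_zero, V_V, smul_smul, smul_smul]
    congr 1; ring
  · have hh : ¬ (a = b ∧ r = s) := by rintro ⟨-, rfl⟩; exact h1 h2
    rw [if_neg hh, zero_smul, add_zero]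
    exact P_P par a b r s
  · rw [P_V]
    congr 1
    split_ifs <;> simp

theorem L_R (a b : Fin d) (r s : Fin N) :
    Lop par h a r * Rop par h b s = sgn (par r * par s) • (Rop par h b s * Lop par h a r) +
      (if a = b ∧ r = s then -sgn (par r) else 0) • (1 : Weyl d par) := by
  rw [R_L, smul_add, smul_smul, mul_comm (par s), sgn_sq, one_smul, add_assoc]
  by_cases hh : a = b ∧ r = s
  · obtain ⟨rfl, rfl⟩ := hh
    simp [sgn_mul_self]
  · have h' : ¬ (b = a ∧ s = r) := fun x => hh ⟨x.1.symm, x.2.symm⟩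
    simp [hh, h']

theorem bracket_sum {B ι κ : Type*} [Ring B] [Algebra ℂ B] [Fintype ι] [Fintype κ]
    (u : ι → ℂ) (v : κ → ℂ) (F : ι → B) (G : κ → B) (s : ℂ) (K : ι → κ → B)
    (hK : ∀ x y, u x ≠ 0 → v y ≠ 0 → F x * G y - s • (G y * F x) = K x y) :
    (∑ x, u x • F x) * (∑ y, v y • G y) - s • ((∑ y, v y • G y) * (∑ x, u x • F x)) =
      ∑ x, ∑ y, (u x * v y) • K x y := by
  have h1 : (∑ y, v y • G y) * (∑ x, u x • F x) =
      ∑ x, ∑ y, (u x * v y) • (G y * F x) := by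
    rw [Finset.sum_mul_sum, Finset.sum_comm]
    refine Finset.sum_congr rfl fun x _ => Finset.sum_congr rfl fun y _ => ?_
    rw [smul_mul_smul_comm, mul_comm]
  rw [h1, Finset.sum_mul_sum, Finset.smul_sum, ← Finset.sum_sub_distrib]
  refine Finset.sum_congr rfl fun x _ => ?_
  rw [Finset.smul_sum, ← Finset.sum_sub_distrib]
  refine Finset.sum_congr rfl fun y _ => ?_
  by_cases hx : u x = 0
  · simp [hx]
  by_cases hy : v y = 0
  · simp [hy]
  rw [← hK x y hx hy, smul_mul_smul_comm, smul_sub, smul_comm s]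

theorem shiftC_contract {k : ℕ} {B : Type*} [AddCommGroup B] [Module ℂ B] (c : Composition k)
    (i j : Fin c.length) (l l' : ℕ) (H : Fin k → Fin k → B) :
    ∑ x : Fin k × Fin k, ∑ y : Fin k × Fin k, (shiftC c i l x.1 x.2 * shiftC c j l' y.1 y.2) •
      (if x.2 = y.1 then H x.1 y.2 else 0) =
    if i = j then ∑ p : Fin k × Fin k, shiftC c i (l + l') p.1 p.2 • H p.1 p.2 else 0 := by
  have h1 : ∀ r r' : Fin k, (∑ s, shiftC c i l r s * shiftC c j l' s r') • H r r' =
      if i = j then shiftC c i (l + l') r r' • H r r' else 0 := by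
    intro r r'
    rw [shiftC_mul]
    split_ifs <;> simp
  have h2 : (if i = j then ∑ p : Fin k × Fin k, shiftC c i (l + l') p.1 p.2 • H p.1 p.2 else 0) =
      ∑ r, ∑ r', if i = j then shiftC c i (l + l') r r' • H r r' else 0 := by
    rw [Fintype.sum_prod_type]
    split_ifs <;> simp
  rw [h2, Fintype.sum_prod_type]
  refine Finset.sum_congr rfl fun r _ => ?_
  simp only [Fintype.sum_prod_type, smul_ite, smul_zero, ← h1, Finset.sum_smul]
  rw [Finset.sum_comm (s := Finset.univ (α := Fin k)) (t := Finset.univ (α := Fin k))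
    (f := fun r' s => (shiftC c i l r s * shiftC c j l' s r') • H r r')]
  refine Finset.sum_congr rfl fun m _ => ?_
  rw [Finset.sum_comm]
  refine Finset.sum_congr rfl fun t _ => ?_
  simp

theorem sum_shift {k : ℕ} {B : Type*} [AddCommGroup B] [Module ℂ B] (c : Composition k)
    (i : Fin c.length) (l : ℕ) (H : Fin k → Fin k → B) :
    (∑ r, ∑ r', if IsShift c i l r r' then H r r' else 0) =
      ∑ p : Fin k × Fin k, shiftC c i l p.1 p.2 • H p.1 p.2 := by
  rw [Fintype.sum_prod_type]
  refine Finset.sum_congr rfl fun r _ => Finset.sum_congr rfl fun r' _ => ?_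
  unfold shiftC
  split_ifs <;> simp

/-- The image of `E^i_j ⊗ t^k` (in the `a`-th Takiff superalgebra): the sum over the pairs
`α, α' = α + k` in the `a`-th block of the products
`(∂/∂v^{α'}_i or v^{α'}_i) * ((-1)^{par j + 1} v^α_j or ∂/∂v^α_j)`. -/
noncomputable def superImage (c : Composition d) (i j : Fin N) (a : Fin c.length) (k : ℕ) :
    Weyl d par :=
  ∑ α, ∑ α', if IsShift c a k α α' then
    (if (i : ℕ) < h then P par α' i else V par α' i) *
      (if (j : ℕ) < h then (-sgn (par j)) • V par α j else P par α j)
  else 0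

/-- The image of `e_{ab} ⊗ t^k` (in the `i`-th Takiff algebra): the sum over the pairs
`r, r' = r + k` in the `i`-th block of `- v^b_r ∂/∂v^a_{r'}` if `r < h`, respectively of
`(-1)^{par r} ∂/∂v^b_r v^a_{r'}` if `r ≥ h`. -/
noncomputable def glImage (c : Composition N) (a b : Fin d) (i : Fin c.length) (k : ℕ) :
    Weyl d par :=
  ∑ r, ∑ r', if IsShift c i k r r' then
    (if (r : ℕ) < h then -(V par b r * P par a r') else sgn (par r) • (P par b r * V par a r'))
  else 0

theorem superImage_eq (c : Composition d) (i j : Fin N) (a : Fin c.length) (k : ℕ) :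
    superImage par h c i j a k = ∑ p : Fin d × Fin d, shiftC c a k p.1 p.2 •
      (Lop par h p.2 i * Rop par h p.1 j) :=
  sum_shift c a k fun α α' => Lop par h α' i * Rop par h α j

theorem superImage_zero (c : Composition d) (i j : Fin N) (a : Fin c.length) (k : ℕ)
    (hk : c.blocksFun a ≤ k) : superImage par h c i j a k = 0 :=
  Finset.sum_eq_zero fun _ _ => Finset.sum_eq_zero fun _ _ => if_neg (IsShift.zero c a k hk _ _)

theorem superImage_bracket (c : Composition d) (i j r s : Fin N) (a b : Fin c.length) (k l : ℕ) :
    superImage par h c i j a k * superImage par h c r s b l -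
        sgn ((par i + par j) * (par r + par s)) •
          (superImage par h c r s b l * superImage par h c i j a k) =
      if a = b then (if j = r then superImage par h c i s a (k + l) else 0) -
        sgn ((par i + par j) * (par r + par s)) •
          (if i = s then superImage par h c r j a (k + l) else 0)
      else 0 := by
  set S := sgn ((par i + par j) * (par r + par s)) with hS
  simp only [superImage_eq]
  rw [bracket_sum (K := fun x y => (if y.2 = x.1 then (if j = r then Lop par h x.2 i *
      Rop par h y.1 s else 0) else 0) - S • (if x.2 = y.1 then (if i = s then
        Lop par h y.2 r * Rop par h x.1 j else 0) else 0))]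
  · simp only [smul_sub, Finset.sum_sub_distrib, smul_comm _ S, ← Finset.smul_sum]
    rw [Finset.sum_comm]
    simp only [mul_comm (shiftC c a k _ _) (shiftC c b l _ _)]
    rw [shiftC_contract c b a l k (fun p q => if j = r then Lop par h q i * Rop par h p s else 0)]
    simp only [mul_comm (shiftC c b l _ _) (shiftC c a k _ _)]
    rw [shiftC_contract c a b k l (fun p q => if i = s then Lop par h q r * Rop par h p j else 0)]
    by_cases hab : a = b
    · subst hab
      rw [if_pos rfl, if_pos rfl, if_pos rfl, add_comm l k]
      congr 2 <;> split_ifs <;> simp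
    · rw [if_neg hab, if_neg hab, if_neg (Ne.symm hab)]; simp
  · intro x y _ _
    rw [comm4 (R_L par h x.1 y.2 j r) (L_L par h x.2 y.2 i r) (R_R par h x.1 y.1 j s)
      (R_L par h y.1 x.2 s i) (s := S)]
    · congr 1
      · by_cases h1 : y.2 = x.1
        · by_cases h2 : j = r <;> simp [h1, h2]
        · simp [h1, Ne.symm h1]
      · by_cases h1 : x.2 = y.1
        · by_cases h2 : i = s
          · simp [h1, h2]
          · simp [h2, Ne.symm h2]
        · simp [h1, Ne.symm h1]
    · rw [hS, mul_comm (par s) (par i)]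
      simp only [add_mul, mul_add, sgn_add]
      linear_combination (sgn (par j * par r) * sgn (par i * par r) * sgn (par j * par s)) *
        sgn_sq (par i * par s)

theorem glImage_zero (c : Composition N) (a b : Fin d) (i : Fin c.length) (k : ℕ)
    (hk : c.blocksFun i ≤ k) : glImage par h c a b i k = 0 :=
  Finset.sum_eq_zero fun _ _ => Finset.sum_eq_zero fun _ _ => if_neg (IsShift.zero c i k hk _ _)

theorem glImage_eq (c : Composition N)
    (hc : ∀ r r', c.index r = c.index r' → ((r : ℕ) < h ↔ (r' : ℕ) < h))
    (a b : Fin d) (i : Fin c.length) (k : ℕ) :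
    glImage par h c a b i k = ∑ p : Fin N × Fin N, shiftC c i k p.1 p.2 •
      (sgn (par p.1) • (Rop par h b p.1 * Lop par h a p.2)) := by
  rw [← sum_shift c i k fun r r' => sgn (par r) • (Rop par h b r * Lop par h a r')]
  refine Finset.sum_congr rfl fun r _ => Finset.sum_congr rfl fun r' _ => ?_
  by_cases hs : IsShift c i k r r'
  · rw [if_pos hs, if_pos hs]
    have hrr := hc r r' (hs.1.trans hs.2.1.symm)
    unfold Rop Lop
    by_cases hr : (r : ℕ) < h
    · rw [if_pos hr, if_pos hr, if_pos (hrr.1 hr), smul_mul_assoc, smul_smul, mul_neg, sgn_sq,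
        neg_smul, one_smul]
    · rw [if_neg hr, if_neg hr, if_neg (fun x => hr (hrr.2 x))]
  · rw [if_neg hs, if_neg hs]

theorem glImage_bracket (c : Composition N)
    (hc : ∀ r r', c.index r = c.index r' → ((r : ℕ) < h ↔ (r' : ℕ) < h))
    (hp : ∀ r r', c.index r = c.index r' → par r = par r')
    (a b e f : Fin d) (i j : Fin c.length) (k l : ℕ) :
    glImage par h c a b i k * glImage par h c e f j l -
        sgn ((0 + 0) * (0 + 0)) • (glImage par h c e f j l * glImage par h c a b i k) =
      if i = j then (if b = e then glImage par h c a f i (k + l) else 0) -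
        sgn ((0 + 0) * (0 + 0)) • (if a = f then glImage par h c e b i (k + l) else 0)
      else 0 := by
  have h0 : sgn ((0 + 0) * (0 + 0)) = 1 := by simp [sgn_zero]
  rw [h0]
  simp only [glImage_eq par h c hc]
  rw [bracket_sum (K := fun x y =>
    (if y.2 = x.1 then (if b = e then sgn (par y.1) • (Rop par h f y.1 * Lop par h a x.2)
      else 0) else 0) -
    (if x.2 = y.1 then (if a = f then sgn (par x.1) • (Rop par h b x.1 * Lop par h e y.2)
      else 0) else 0))]
  · simp only [smul_sub, Finset.sum_sub_distrib]
    rw [Finset.sum_comm]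
    simp only [mul_comm (shiftC c i k _ _) (shiftC c j l _ _)]
    rw [shiftC_contract c j i l k (fun p q => if b = e then sgn (par p) •
      (Rop par h f p * Lop par h a q) else 0)]
    simp only [mul_comm (shiftC c j l _ _) (shiftC c i k _ _)]
    rw [shiftC_contract c i j k l (fun p q => if a = f then sgn (par p) •
      (Rop par h b p * Lop par h e q) else 0)]
    by_cases hij : i = j
    · subst hij
      rw [if_pos rfl, if_pos rfl, if_pos rfl, add_comm l k, one_smul]
      congr 1 <;> split_ifs <;> simp
    · rw [if_neg hij, if_neg hij, if_neg (Ne.symm hij)]; simp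
  · intro x y hx hy
    have ex : par x.2 = par x.1 := by
      have : IsShift c i k x.1 x.2 := by by_contra hh; exact hx (if_neg hh)
      exact hp _ _ (this.2.1.trans this.1.symm)
    have ey : par y.2 = par y.1 := by
      have : IsShift c j l y.1 y.2 := by by_contra hh; exact hy (if_neg hh)
      exact hp _ _ (this.2.1.trans this.1.symm)
    have key := comm4 (L_R par h a f x.2 y.1) (R_R par h b f x.1 y.1) (L_L par h a e x.2 y.2)
      (L_R par h e b y.2 x.1) (s := 1) (by
        rw [ex, ey, mul_comm (par y.1) (par x.1)]
        linear_combination (-sgn (par x.1 * par y.1)) * sgn_sq (par x.1 * par y.1))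
    rw [one_smul] at key
    rw [one_smul, smul_mul_smul_comm, smul_mul_smul_comm, mul_comm (sgn (par y.1)), ← smul_sub,
      key, one_mul, smul_sub, smul_smul, smul_smul, sub_eq_neg_add, sub_eq_add_neg]
    congr 1
    · by_cases h1 : y.2 = x.1
      · by_cases h2 : b = e
        · have : par x.1 = par y.1 := by rw [← h1, ey]
          simp only [h1, h2, and_self, if_true, this]
          rw [← neg_smul]
          congr 1
          linear_combination (sgn (par y.1)) * sgn_sq (par y.1)
        · simp [h2, Ne.symm h2]
      · simp [h1]
    · by_cases h1 : x.2 = y.1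
      · by_cases h2 : a = f
        · have : par y.1 = par x.1 := by rw [← h1, ex]
          simp only [h1, h2, and_self, if_true, this]
          rw [← neg_smul]
          congr 1
          linear_combination (-sgn (par x.1)) * sgn_sq (par x.1)
        · simp [h2]
      · simp [h1]

end Actions

/-! ### The duality data -/

section Duality

/-- The parity on `{1, …, p+q+m+n}` (here `Fin (p+q+m+n)`): even on the first `p` elements, odd on
the next `q`, even on the next `m`, odd on the last `n`. -/
def parity (p q m n : ℕ) (r : Fin (p + q + m + n)) : ZMod 2 :=
  if (r : ℕ) < p then 0 else if (r : ℕ) < p + q then 1 else if (r : ℕ) < p + q + m then 0 else 1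

variable {p q m n : ℕ} (γp : Composition p) (γq : Composition q) (γm : Composition m)
  (γn : Composition n)

/-- The concatenation of compositions of `p`, `q`, `m`, `n` (sequences of positive integers with
sums `p`, `q`, `m`, `n`). -/
def blocks : Composition (p + q + m + n) := ((γp.append γq).append γm).append γn

theorem blocks_index (r r' : Fin (p + q + m + n))
    (hr : (blocks γp γq γm γn).index r = (blocks γp γq γm γn).index r') :
    ((r : ℕ) < p ↔ (r' : ℕ) < p) ∧ ((r : ℕ) < p + q ↔ (r' : ℕ) < p + q) ∧
      ((r : ℕ) < p + q + m ↔ (r' : ℕ) < p + q + m) := by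
  have hb : (blocks γp γq γm γn).blocks =
      γp.blocks ++ (γq.blocks ++ (γm.blocks ++ γn.blocks)) := by
    simp [blocks, Composition.append]
  have h1 : (blocks γp γq γm γn).sizeUpTo γp.blocks.length = p := by
    rw [Composition.sizeUpTo, hb]; simp
  have h2 : (blocks γp γq γm γn).sizeUpTo (γp.blocks.length + γq.blocks.length) = p + q := by
    rw [Composition.sizeUpTo, hb]
    simp [List.take_append, List.take_of_length_le]
  have h3 : (blocks γp γq γm γn).sizeUpTo
      (γp.blocks.length + γq.blocks.length + γm.blocks.length) = p + q + m := by
    rw [Composition.sizeUpTo, hb]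
    simp [List.take_append, List.take_of_length_le, add_assoc]
  refine ⟨?_, ?_, ?_⟩
  · rw [index_lt_iff _ _ _ h1, index_lt_iff _ _ _ h1, hr]
  · rw [index_lt_iff _ _ _ h2, index_lt_iff _ _ _ h2, hr]
  · rw [index_lt_iff _ _ _ h3, index_lt_iff _ _ _ h3, hr]

/-- The homomorphism from the enveloping algebra of `⨁_i gl_d ⊗ ℂ[t]/t^(γ_i)` to the Weyl
superalgebra. The variables are `v^a_r = y^a_r` for `r < p + q` and `v^a_{p+q+i} = x^a_i`. -/
noncomputable def glHom (d : ℕ) :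
    Env (fun _ : Fin d => 0) (blocks γp γq γm γn).blocksFun →ₐ[ℂ] Weyl d (parity p q m n) :=
  Env.lift _ _ (glImage (parity p q m n) (p + q) (blocks γp γq γm γn))
    (glImage_zero _ _ _)
    (glImage_bracket _ _ _ (fun r r' hr => (blocks_index γp γq γm γn r r' hr).2.1)
      (fun r r' hr => by
        obtain ⟨h1, h2, h3⟩ := blocks_index γp γq γm γn r r' hr
        simp only [parity, h1, h2, h3]))

/-- The homomorphism from the enveloping algebra of `⨁_a gl ⊗ ℂ[t]/t^(ξ_a)`, with
`gl = gl_{p+m|q+n}`, to the Weyl superalgebra. -/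
noncomputable def superHom (p q m n : ℕ) {d : ℕ} (ξ : Composition d) :
    Env (parity p q m n) ξ.blocksFun →ₐ[ℂ] Weyl d (parity p q m n) :=
  Env.lift _ _ (superImage (parity p q m n) (p + q) ξ) (superImage_zero _ _ _)
    (superImage_bracket _ _ _)

theorem glHom_E (d : ℕ) (a b : Fin d) (i : Fin (blocks γp γq γm γn).length) (k : ℕ) :
    glHom γp γq γm γn d (Env.E _ _ a b i k) =
      glImage (parity p q m n) (p + q) (blocks γp γq γm γn) a b i k :=
  Env.lift_E _ _ _ _ _ _ _ _ _

theorem superHom_E (p q m n : ℕ) {d : ℕ} (ξ : Composition d) (i j : Fin (p + q + m + n))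
    (a : Fin ξ.length) (k : ℕ) :
    superHom p q m n ξ (Env.E _ _ i j a k) =
      superImage (parity p q m n) (p + q) ξ i j a k :=
  Env.lift_E _ _ _ _ _ _ _ _ _

end Duality

end GaudinDuality

open GaudinDuality

/-!
Both Lax matrices are mapped to matrices over the ring of pseudo-differential operators with
coefficients in the Weyl superalgebra (`map_lax_gl`, `map_lax_super`). There, with conjugate
families `L` and `R` of variables and derivatives, and with the resolvents `K(z) = (z - J)⁻¹` of
the two Jordan matrices, they read
`δ_{ab} ∂ - (J_ξ)_{ab} - ∑ (-1)^{|r|} R_{br} L_{ar'} K_γ(z)_{rr'}` and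
`δ_{ij} ∂ - (J_γ)_{ij} - ∑ (-1)^{|i|} L_{α'i} R_{αj} K_ξ(z)_{αα'}`. The theorem holds because the
column determinant of the first matrix and the Berezinian of the second one agree up to invertible
factors with scalar coefficients, after the exchange of `z` and `∂` in normally ordered series.
Such factors and the exchange do not affect the subalgebras that contain all the coefficients
(`cdet_glLax_mem_iff`), and a subalgebra is determined by the subalgebras that contain it
(`gaudin_map_eq`).

*The column determinant.* Moving `R` to the right of `L` adds a diagonal term that is the
logarithmic derivative of a product of powers of the `z - z_i`, so conjugation by this product
removes it (`glLax_conj`). The remaining matrix is of the form `∂ - J - ∑ X_{ar} Y_{br}`, where the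
commutators of the oscillators `X`, `Y` and of `∂` match in such a way that all the contractions in
the column determinant cancel: the column determinant is equal to its normally ordered version
(`IsOscillator.cdet_eq_insertion`). The reason is the following vacuum expectation argument: in
anticommuting variables the columns of the difference between a matrix and its normally ordered
version anticommute with those of the latter, and can be moved to the vacuum, which they kill
(`ev_cdet_add`). A normally ordered determinant has a transparent image under the exchange of `z`
and `∂`; the image is the normally ordered determinant, for the opposite order of the factors, of
the matrix `z - J_ξᵗ - ∑ L_{br} ρ_{ar}` with `ρ = R K_γ(∂)` (`IsOscillator.cdet_transfer`,
`swap_cdet`). Another conjugation moves `L` to the right and leads to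
`z - J_ξᵗ - ∑ ρ_{ar} (-1)^{|r|} L_{br}` (`dualLax_conj`).

*The Berezinian.* The super Lax matrix and the matrix just obtained are the two Schur complements
of a matrix with the diagonal blocks `z - J_ξᵗ` and `∂ - J_γ`. Its rows and columns satisfy the
super Manin relations when the indices `r` are adjoined one by one (`IsOscillator.isSuperManin`; as
`J_γ` is upper triangular, the leading partial sums over `r` can be considered separately). Schur
complements inherit these relations (`IsSuperManin.schur`), and taking them in two different orders
shows how the column determinant changes when one even or odd index is adjoined: it is multiplied
by the corresponding quasi-minor of the super Lax matrix, or by its inverse, up to a factor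
`∂ - z_i` (`IsSuperManin.cdet_exchange`). The product of these steps telescopes to
`det(z - J_ξᵗ) · Ber = ∏ (∂ - z_i)^{±1} · cdet(z - J_ξᵗ - ∑ ρ_{ar} (-1)^{|r|} L_{br})`
(`cdet_mul_ber`).

*Invertibility.* A pseudo-differential operator `∂ + r`, where `r` has no positive exponents, is
invertible by a geometric series (`exists_inv_one_sub`), and Schur complements of a matrix with
entries `δ_{ij} ∂ + r_{ij}` have entries of the same form. Gaussian elimination therefore inverts
the leading submatrices, and shows that the corner entries of the inverses are units
(`IsNear.sufficientlyInvertible`).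
-/

namespace GaudinDuality

/-! ### Pseudo-differential operators: coefficients, base change, inverses -/

namespace PDO

variable {A B : Type*} [Ring A] [Ring B]

theorem coeff_neg (a : PDO A) (i j : ℤ) : (-a).coeff i j = -a.coeff i j := rfl

theorem coeff_sub (a b : PDO A) (i j : ℤ) : (a - b).coeff i j = a.coeff i j - b.coeff i j := rfl

theorem coeff_mul_monomial_right (j : ℤ) (c : A) (a : PDO A) (I J : ℤ) :
    (a * monomial 0 j c).coeff I J = a.coeff I (J - j) * c := by
  rw [coeff_mul, finsum_eq_single _ (I, J - j, (0 : ℕ))]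
  · simp [mulTerm, coeff_monomial, wt_zero]
  · rintro ⟨i', j', t⟩ hx
    simp only [mulTerm, coeff_monomial]
    split_ifs with h
    · by_cases ht : t = 0
      · subst ht
        refine absurd ?_ hx
        simp only [Nat.cast_zero, add_zero] at h
        simp only [Prod.mk.injEq, and_true]
        omega
      · simp [h.1, wt_zero_right _ ht]
    · simp

theorem coeff_D_mul (b : PDO A) (I J : ℤ) :
    (D * b).coeff I J = b.coeff I (J - 1) + (I + 1) • b.coeff (I + 1) J := by
  rw [coeff_mul, finsum_eq_sum_of_support_subset
    (s := {((0 : ℤ), (1 : ℤ), (0 : ℕ)), ((0 : ℤ), (1 : ℤ), (1 : ℕ))})]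
  · rw [Finset.sum_pair (by simp)]
    simp [mulTerm, D, coeff_monomial, wt]
  · rintro ⟨i, j, t⟩ hx
    have h : i = 0 ∧ j = 1 := by
      by_contra h
      exact hx (by simp [mulTerm, D, coeff_monomial, h])
    obtain ⟨rfl, rfl⟩ := h
    have ht : t < 2 := by
      by_contra ht
      refine hx ?_
      have h1 : Ring.choose (1 : ℤ) t = 0 := by
        have := Ring.choose_natCast (R := ℤ) 1 t
        rw [Nat.choose_eq_zero_of_lt (by omega)] at this
        simpa using this
      simp [mulTerm, wt, h1]
    interval_cases t <;> simp

theorem D_mul_Z : (D : PDO A) * Z = Z * D + 1 := by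
  refine ext' fun I J => ?_
  rw [coeff_D_mul, coeff_add, Z, coeff_monomial_mul, D, coeff_one]
  simp only [coeff_monomial]
  by_cases hI : I = 0
  · subst hI
    simp
  · by_cases hI' : I = 1
    · subst hI'
      simp [sub_eq_zero]
    · rw [if_neg (by omega), if_neg (by omega), if_neg (by omega), if_neg (by omega)]
      simp

theorem C_mul_coeff (a : A) (b : PDO A) (I J : ℤ) : (C a * b).coeff I J = a * b.coeff I J := by
  rw [C, coeff_monomial_mul, sub_zero]

theorem mul_C_coeff (a : A) (b : PDO A) (I J : ℤ) : (b * C a).coeff I J = b.coeff I J * a := by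
  rw [C, coeff_mul_monomial_right, sub_zero]

theorem coeff_C (a : A) (I J : ℤ) : (C a).coeff I J = if I = 0 ∧ J = 0 then a else 0 := rfl

theorem Z_mul_coeff (b : PDO A) (I J : ℤ) : (Z * b).coeff I J = b.coeff (I - 1) J := by
  rw [Z, coeff_monomial_mul, one_mul]

theorem mul_D_coeff (b : PDO A) (I J : ℤ) : (b * D).coeff I J = b.coeff I (J - 1) := by
  rw [D, coeff_mul_monomial_right, mul_one]

theorem Z_mul_C (a : A) : Z * C a = C a * Z := by
  refine ext' fun I J => ?_
  rw [Z_mul_coeff, C_mul_coeff, coeff_C, Z, coeff_monomial]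
  by_cases h : I = 1 ∧ J = 0
  · simp [h]
  · rw [if_neg (by omega), if_neg h, mul_zero]

theorem D_mul_C (a : A) : D * C a = C a * D := by
  refine ext' fun I J => ?_
  rw [coeff_D_mul, C_mul_coeff, coeff_C, coeff_C, D, coeff_monomial]
  have : (I + 1) • (if I + 1 = 0 ∧ J = 0 then a else 0) = 0 := by
    split_ifs with h
    · rw [h.1, zero_smul]
    · exact smul_zero _
  rw [this, add_zero]
  by_cases h : I = 0 ∧ J = 1
  · simp [h]
  · rw [if_neg (by omega), if_neg h, mul_zero]

/-- The inclusion of the coefficient ring as a ring homomorphism. -/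
def CHom : A →+* PDO A where
  toFun := C
  map_one' := rfl
  map_zero' := ext' fun I J => by rw [coeff_C, coeff_zero, ite_self]
  map_add' a b := ext' fun I J => by
    simp only [coeff_add, coeff_C]
    split_ifs <;> simp
  map_mul' a b := ext' fun I J => by
    rw [C_mul_coeff, coeff_C, coeff_C]
    split_ifs <;> simp

theorem CHom_apply (a : A) : CHom a = C a := rfl

theorem C_add (a b : A) : C (a + b) = C a + C b := map_add CHom a b
theorem C_mul (a b : A) : C (a * b) = C a * C b := map_mul CHom a b
theorem C_zero : C (0 : A) = 0 := map_zero CHom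
theorem C_sum {ι : Type*} (s : Finset ι) (f : ι → A) : C (∑ x ∈ s, f x) = ∑ x ∈ s, C (f x) :=
  map_sum CHom f s

noncomputable instance instAlgebra [Algebra ℂ A] : Algebra ℂ (PDO A) :=
  RingHom.toAlgebra' (CHom.comp (algebraMap ℂ A)) fun c x => ext' fun I J => by
    rw [RingHom.comp_apply, CHom_apply, C_mul_coeff, mul_C_coeff, Algebra.commutes]

theorem algebraMap_eq [Algebra ℂ A] (c : ℂ) : algebraMap ℂ (PDO A) c = C (algebraMap ℂ A c) := rfl

theorem C_smul [Algebra ℂ A] (c : ℂ) (a : A) : C (c • a) = c • C a := by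
  rw [Algebra.smul_def, Algebra.smul_def, algebraMap_eq, C_mul]

/-- The operator obtained by applying `f` to the coefficients. -/
def mapFun (f : A →+* B) (a : PDO A) : PDO B :=
  ⟨fun i j => f (a.coeff i j), by
    obtain ⟨r, s, h⟩ := a.bdd
    exact ⟨r, s, fun i j hij => h i j fun h0 => hij ((congrArg f h0).trans (map_zero f))⟩⟩

theorem coeff_mapFun (f : A →+* B) (a : PDO A) (i j : ℤ) :
    (mapFun f a).coeff i j = f (a.coeff i j) := rfl

/-- The homomorphism of rings of pseudo-differential operators induced by a homomorphism of
coefficient rings. -/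
noncomputable def map (f : A →+* B) : PDO A →+* PDO B where
  toFun := mapFun f
  map_one' := ext' fun I J => by
    rw [coeff_mapFun, coeff_one, coeff_one]
    split_ifs <;> simp
  map_zero' := ext' fun I J => map_zero f
  map_add' a b := ext' fun I J => map_add f _ _
  map_mul' a b := ext' fun I J => by
    rw [coeff_mapFun, coeff_mul, coeff_mul]
    refine (AddMonoidHom.map_finsum (f : A →+ B) (mulTerm_finite a b I J)).trans
      (finsum_congr fun x => ?_)
    simp only [mulTerm, AddMonoidHom.coe_coe, map_zsmul, map_mul, coeff_mapFun]

theorem map_coeff (f : A →+* B) (a : PDO A) (i j : ℤ) : (map f a).coeff i j = f (a.coeff i j) :=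
  rfl

theorem map_C (f : A →+* B) (a : A) : map f (C a) = C (f a) := ext' fun I J => by
  rw [map_coeff, coeff_C, coeff_C]; split_ifs <;> simp

theorem map_D (f : A →+* B) : map f D = D := ext' fun I J => by
  rw [map_coeff, D, D, coeff_monomial, coeff_monomial]; split_ifs <;> simp

theorem map_invSub (f : A →+* B) (c : A) : map f (invSub c) = invSub (f c) := ext' fun I J => by
  rw [map_coeff, coeff_invSub, coeff_invSub]; split_ifs <;> simp

theorem coeff_mul_mem (S : AddSubgroup A) (a b : PDO A) (I J : ℤ)
    (h : ∀ i j i' j', a.coeff i j * b.coeff i' j' ∈ S) : (a * b).coeff I J ∈ S := by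
  rw [coeff_mul]
  refine finsum_induction (· ∈ S) S.zero_mem (fun _ _ => S.add_mem) fun x => ?_
  exact S.zsmul_mem (h _ _ _ _) _

/-- A nonzero coefficient of a product arises from nonzero coefficients of the factors. -/
theorem exists_of_coeff_mul_ne_zero {a b : PDO A} {I J : ℤ} (h : (a * b).coeff I J ≠ 0) :
    ∃ (i j : ℤ) (t : ℕ), a.coeff i j ≠ 0 ∧ b.coeff (I - i + t) (J - j + t) ≠ 0 ∧
      wt j (I - i + t) t ≠ 0 := by
  rw [coeff_mul] at h
  obtain ⟨⟨i, j, t⟩, hx⟩ : ∃ x, mulTerm a b I J x ≠ 0 := by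
    by_contra! h0
    exact h (by simp [h0])
  exact ⟨i, j, t, fun h0 => hx (by simp [mulTerm, h0]), fun h0 => hx (by simp [mulTerm, h0]),
    fun h0 => hx (by simp [mulTerm, h0])⟩

section Over

variable [Algebra ℂ A] (S : Subalgebra ℂ A)

/-- The operators all of whose coefficients lie in the subalgebra `S`. -/
def coeffsIn : Subring (PDO A) where
  carrier := {a | ∀ i j, a.coeff i j ∈ S}
  mul_mem' := fun {a b} ha hb I J =>
    coeff_mul_mem (S.toSubring.toAddSubgroup) a b I J fun _ _ _ _ => S.mul_mem (ha _ _) (hb _ _)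
  one_mem' := fun i j => by
    rw [coeff_one]; split_ifs
    exacts [S.one_mem, S.zero_mem]
  add_mem' := fun ha hb i j => S.add_mem (ha i j) (hb i j)
  zero_mem' := fun _ _ => S.zero_mem
  neg_mem' := fun ha i j => S.neg_mem (ha i j)

variable {S}

theorem monomial_mem_coeffsIn (i j : ℤ) {c : A} (hc : c ∈ S) :
    monomial i j c ∈ coeffsIn S := fun i' j' => by
  rw [coeff_monomial]; split_ifs
  exacts [hc, S.zero_mem]

theorem Z_mem_coeffsIn : (Z : PDO A) ∈ coeffsIn S := monomial_mem_coeffsIn _ _ S.one_mem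

theorem D_mem_coeffsIn : (D : PDO A) ∈ coeffsIn S := monomial_mem_coeffsIn _ _ S.one_mem

theorem algebraMap_mem_coeffsIn (c : ℂ) : algebraMap ℂ (PDO A) c ∈ coeffsIn S :=
  monomial_mem_coeffsIn _ _ (S.algebraMap_mem c)

variable (S)

/-- The operators over `S` supported on the exponents `i, j ≤ 0` with `i + j ≤ -n`. -/
def level (n : ℕ) : AddSubgroup (PDO A) where
  carrier := {a | a ∈ coeffsIn S ∧ ∀ i j, a.coeff i j ≠ 0 → i ≤ 0 ∧ j ≤ 0 ∧ i + j ≤ -n}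
  zero_mem' := ⟨(coeffsIn S).zero_mem, fun i j h => absurd rfl h⟩
  add_mem' := by
    rintro a b ⟨ha, ha'⟩ ⟨hb, hb'⟩
    refine ⟨(coeffsIn S).add_mem ha hb, fun i j h => ?_⟩
    by_cases h0 : a.coeff i j = 0
    · exact hb' i j fun h1 => h (by rw [coeff_add, h0, h1, add_zero])
    · exact ha' i j h0
  neg_mem' := by
    rintro a ⟨ha, ha'⟩
    exact ⟨(coeffsIn S).neg_mem ha, fun i j h =>
      ha' i j fun h0 => h (by rw [coeff_neg, h0, neg_zero])⟩

variable {S}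

theorem mul_mem_level {a b : PDO A} {m n : ℕ} (ha : a ∈ level S m) (hb : b ∈ level S n) :
    a * b ∈ level S (m + n) := by
  refine ⟨(coeffsIn S).mul_mem ha.1 hb.1, fun I J h => ?_⟩
  obtain ⟨i, j, t, h1, h2, -⟩ := exists_of_coeff_mul_ne_zero h
  have := ha.2 _ _ h1
  have := hb.2 _ _ h2
  push_cast
  omega

theorem level_anti {m n : ℕ} (h : m ≤ n) {a : PDO A} (ha : a ∈ level S n) : a ∈ level S m :=
  ⟨ha.1, fun i j hij => by have := ha.2 i j hij; omega⟩

theorem one_mem_level : (1 : PDO A) ∈ level S 0 :=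
  ⟨(coeffsIn S).one_mem, fun i j h => by
    rw [coeff_one] at h
    split_ifs at h with h0
    · simp [h0]
    · exact absurd rfl h⟩

theorem pow_mem_level {a : PDO A} (ha : a ∈ level S 1) (n : ℕ) : a ^ n ∈ level S n := by
  induction n with
  | zero => rw [pow_zero]; exact one_mem_level
  | succ n ih => rw [pow_succ]; exact mul_mem_level ih ha

theorem eq_zero_of_mem_level {a : PDO A} (h : ∀ n, a ∈ level S n) : a = 0 := ext' fun i j => by
  by_contra h0
  have := (h ((-(i + j)).toNat + 1)).2 i j h0
  push_cast at this
  omega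

/-- Operators supported in the region `i + j ≤ -1`, `i, j ≤ 0` are topologically nilpotent: the
geometric series converges. -/
theorem exists_inv_one_sub {a : PDO A} (ha : a ∈ level S 1) :
    ∃ u ∈ level S 0, (1 - a) * u = 1 ∧ u * (1 - a) = 1 := by
  have hp := fun k => pow_mem_level ha k
  have hsum : ∀ m, ∑ k ∈ Finset.range m, a ^ k ∈ level S 0 := fun m =>
    (level S 0).sum_mem fun k _ => level_anti (Nat.zero_le _) (hp k)
  have hc : ∀ m i j, (∑ k ∈ Finset.range m, a ^ k).coeff i j =
      ∑ k ∈ Finset.range m, (a ^ k).coeff i j := by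
    intro m i j
    induction m with
    | zero => rfl
    | succ m ih => rw [Finset.sum_range_succ, Finset.sum_range_succ, coeff_add, ih]
  let u : PDO A := ⟨fun i j => (∑ k ∈ Finset.range ((-(i + j)).toNat + 1), a ^ k).coeff i j,
    0, 0, fun i j h => ⟨((hsum _).2 i j h).1, ((hsum _).2 i j h).2.1⟩⟩
  have hu : ∀ i j, u.coeff i j = (∑ k ∈ Finset.range ((-(i + j)).toNat + 1), a ^ k).coeff i j :=
    fun _ _ => rfl
  have hu0 : u ∈ level S 0 :=
    ⟨fun i j => (hsum _).1 i j, fun i j h => (hsum _).2 i j h⟩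
  have hstab : ∀ (m n : ℕ) (i j : ℤ), m ≤ n → -(m : ℤ) < i + j →
      (∑ k ∈ Finset.range n, a ^ k).coeff i j = (∑ k ∈ Finset.range m, a ^ k).coeff i j := by
    intro m n i j hmn hij
    rw [hc, hc]
    refine (Finset.sum_subset (Finset.range_mono hmn) fun k _ hk => ?_).symm
    by_contra h0
    have := (hp k).2 i j h0
    rw [Finset.mem_range] at hk
    omega
  have hdiff : ∀ m, u - ∑ k ∈ Finset.range m, a ^ k ∈ level S m := by
    intro m
    refine ⟨(coeffsIn S).sub_mem hu0.1 (hsum m).1, fun i j h => ?_⟩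
    have h2 := ((level S 0).sub_mem hu0 (hsum m)).2 i j h
    refine ⟨h2.1, h2.2.1, ?_⟩
    by_contra hlt
    refine h ?_
    rw [coeff_sub, hu, sub_eq_zero]
    rcases le_total m ((-(i + j)).toNat + 1) with hm | hm
    · exact hstab _ _ i j hm (by omega)
    · exact (hstab _ _ i j hm (by omega)).symm
  have h1 : (1 - a) ∈ level S 0 := (level S 0).sub_mem one_mem_level (level_anti (Nat.zero_le _) ha)
  refine ⟨u, hu0, ?_, ?_⟩
  · rw [← sub_eq_zero]
    refine eq_zero_of_mem_level (S := S) fun m => ?_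
    have e : (1 - a) * u - 1 = (1 - a) * (u - ∑ k ∈ Finset.range m, a ^ k) - a ^ m := by
      rw [mul_sub, mul_neg_geom_sum]; abel
    rw [e]
    refine (level S m).sub_mem ?_ (hp m)
    simpa using mul_mem_level h1 (hdiff m)
  · rw [← sub_eq_zero]
    refine eq_zero_of_mem_level (S := S) fun m => ?_
    have e : u * (1 - a) - 1 = (u - ∑ k ∈ Finset.range m, a ^ k) * (1 - a) - a ^ m := by
      rw [sub_mul, geom_sum_mul_neg]; abel
    rw [e]
    refine (level S m).sub_mem ?_ (hp m)
    simpa using mul_mem_level (hdiff m) h1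

variable (S)

/-- The subring of operators over `S` without positive exponents. -/
def nonpos : Subring (PDO A) where
  __ := level S 0
  mul_mem' := fun ha hb => mul_mem_level (m := 0) (n := 0) ha hb
  one_mem' := one_mem_level

variable {S}

theorem nonpos_le_coeffsIn : nonpos S ≤ coeffsIn S := fun _ h => h.1

theorem monomial_mem_nonpos {i j : ℤ} (hi : i ≤ 0) (hj : j ≤ 0) {c : A} (hc : c ∈ S) :
    monomial i j c ∈ nonpos S :=
  ⟨monomial_mem_coeffsIn i j hc, fun i' j' h => by
    rw [coeff_monomial] at h
    split_ifs at h with h0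
    · simp only [Nat.cast_zero]; omega
    · exact absurd rfl h⟩

theorem C_mem_nonpos {c : A} (hc : c ∈ S) : C c ∈ nonpos S := monomial_mem_nonpos le_rfl le_rfl hc

theorem algebraMap_mem_nonpos (c : ℂ) : algebraMap ℂ (PDO A) c ∈ nonpos S :=
  C_mem_nonpos (S.algebraMap_mem c)

/-- If `t` has an inverse supported in `i + j ≤ -1`, all its perturbations by operators without
positive exponents are units. -/
theorem exists_inv_add {t t' : PDO A} (h1 : t * t' = 1) (h2 : t' * t = 1) (ht : t' ∈ level S 1)
    {r : PDO A} (hr : r ∈ nonpos S) : ∃ u ∈ nonpos S, (t + r) * u = 1 ∧ u * (t + r) = 1 := by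
  have hm : -(t' * r) ∈ level S 1 := (level S 1).neg_mem (mul_mem_level ht hr)
  obtain ⟨u, hu, hu1, hu2⟩ := exists_inv_one_sub hm
  have e : t + r = t * (1 - -(t' * r)) := by
    rw [sub_neg_eq_add, mul_add, mul_one, ← mul_assoc, h1, one_mul]
  refine ⟨u * t', level_anti (Nat.zero_le _) (mul_mem_level hu ht), ?_, ?_⟩
  · rw [e, mul_assoc, ← mul_assoc _ u, hu1, one_mul, h1]
  · rw [e, mul_assoc, ← mul_assoc t', h2, one_mul, hu2]

theorem exists_inv_Z_add {r : PDO A} (hr : r ∈ nonpos S) :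
    ∃ u ∈ nonpos S, (Z + r) * u = 1 ∧ u * (Z + r) = 1 := by
  refine exists_inv_add (t' := monomial (-1) 0 1) ?_ ?_ ?_ hr
  · refine ext' fun I J => ?_
    rw [Z_mul_coeff, coeff_monomial, coeff_one]
    exact if_congr (by omega) rfl rfl
  · refine ext' fun I J => ?_
    rw [coeff_monomial_mul, Z, coeff_monomial, coeff_one, one_mul]
    exact if_congr (by omega) rfl rfl
  · refine ⟨monomial_mem_coeffsIn _ _ S.one_mem, fun i j h => ?_⟩
    rw [coeff_monomial] at h
    split_ifs at h with h0
    · push_cast; omega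
    · exact absurd rfl h

theorem exists_inv_D_add {r : PDO A} (hr : r ∈ nonpos S) :
    ∃ u ∈ nonpos S, (D + r) * u = 1 ∧ u * (D + r) = 1 := by
  refine exists_inv_add (t' := monomial 0 (-1) 1) ?_ ?_ ?_ hr
  · refine ext' fun I J => ?_
    rw [coeff_mul_monomial_right, D, coeff_monomial, coeff_one, mul_one]
    exact if_congr (by omega) rfl rfl
  · refine ext' fun I J => ?_
    rw [mul_D_coeff, coeff_monomial, coeff_one]
    exact if_congr (by omega) rfl rfl
  · refine ⟨monomial_mem_coeffsIn _ _ S.one_mem, fun i j h => ?_⟩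
    rw [coeff_monomial] at h
    split_ifs at h with h0
    · push_cast; omega
    · exact absurd rfl h

theorem invSub_mem_nonpos (c : ℂ) : invSub (algebraMap ℂ A c) ∈ nonpos S := by
  refine ⟨fun i j => ?_, fun i j h => ?_⟩
  · rw [coeff_invSub]
    split_ifs
    exacts [S.pow_mem (S.algebraMap_mem c) _, S.zero_mem]
  · rw [coeff_invSub] at h
    split_ifs at h with h0
    · simp only [Nat.cast_zero]; omega
    · exact absurd rfl h

end Over

/-- The exchange of `z` and `∂` in normally ordered series: `c z^i ∂^j ↦ c z^j ∂^i`. It is not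
multiplicative, but turns right multiplication by `∂` into left multiplication by `z`, and vice
versa. -/
def swap : PDO A ≃+ PDO A where
  toFun a := ⟨fun i j => a.coeff j i, by
    obtain ⟨r, s, h⟩ := a.bdd
    exact ⟨s, r, fun i j hij => (h j i hij).symm⟩⟩
  invFun a := ⟨fun i j => a.coeff j i, by
    obtain ⟨r, s, h⟩ := a.bdd
    exact ⟨s, r, fun i j hij => (h j i hij).symm⟩⟩
  left_inv _ := rfl
  right_inv _ := rfl
  map_add' _ _ := rfl

theorem coeff_swap (a : PDO A) (i j : ℤ) : (swap a).coeff i j = a.coeff j i := rfl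

theorem swap_mul_D (a : PDO A) : swap (a * D) = Z * swap a := ext' fun i j => by
  rw [coeff_swap, mul_D_coeff, Z_mul_coeff, coeff_swap]

theorem swap_Z_mul (a : PDO A) : swap (Z * a) = swap a * D := ext' fun i j => by
  rw [coeff_swap, Z_mul_coeff, mul_D_coeff, coeff_swap]

theorem swap_C_mul (c : A) (a : PDO A) : swap (C c * a) = C c * swap a := ext' fun i j => by
  rw [coeff_swap, C_mul_coeff, C_mul_coeff, coeff_swap]

theorem swap_mul_C (c : A) (a : PDO A) : swap (a * C c) = swap a * C c := ext' fun i j => by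
  rw [coeff_swap, mul_C_coeff, mul_C_coeff, coeff_swap]

theorem swap_one : swap (1 : PDO A) = 1 := ext' fun i j => by
  rw [coeff_swap, coeff_one, coeff_one]
  exact if_congr and_comm rfl rfl

theorem swap_mem_coeffsIn [Algebra ℂ A] {S : Subalgebra ℂ A} {a : PDO A} :
    swap a ∈ coeffsIn S ↔ a ∈ coeffsIn S :=
  ⟨fun h i j => h j i, fun h i j => h j i⟩

end PDO

/-! ### Column determinants and anticommuting variables -/

open scoped TensorProduct

section Grassmann

variable (S : Type*) [Ring S] (d : ℕ)

/-- The Grassmann algebra on `d` generators with coefficients in the ring `S`, which commutes with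
the generators. -/
def Grassmann : Type _ := ExteriorAlgebra ℤ (Fin d → ℤ) ⊗[ℤ] S

noncomputable instance : Ring (Grassmann S d) :=
  inferInstanceAs (Ring (ExteriorAlgebra ℤ (Fin d → ℤ) ⊗[ℤ] S))

namespace Grassmann

variable {S d}

/-- The product of an element of the exterior algebra and a coefficient. -/
noncomputable def mk (x : ExteriorAlgebra ℤ (Fin d → ℤ)) (s : S) : Grassmann S d := x ⊗ₜ[ℤ] s

theorem mk_mul_mk (x y : ExteriorAlgebra ℤ (Fin d → ℤ)) (s t : S) :
    mk x s * mk y t = mk (x * y) (s * t) := Algebra.TensorProduct.tmul_mul_tmul x y s t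

theorem mk_add (x y : ExteriorAlgebra ℤ (Fin d → ℤ)) (s : S) :
    mk (x + y) s = mk x s + mk y s := TensorProduct.add_tmul x y s

theorem mk_zero (s : S) : (mk 0 s : Grassmann S d) = 0 := TensorProduct.zero_tmul _ s

/-- The coefficient ring as a subring of the Grassmann algebra. -/
noncomputable def scalar : S →+* Grassmann S d :=
  (Algebra.TensorProduct.includeRight :
    S →ₐ[ℤ] ExteriorAlgebra ℤ (Fin d → ℤ) ⊗[ℤ] S).toRingHom

/-- The anticommuting generators. -/
noncomputable def gen (a : Fin d) : Grassmann S d := mk (ExteriorAlgebra.ι ℤ (Pi.single a 1)) 1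

theorem scalar_apply (s : S) : (scalar s : Grassmann S d) = mk 1 s := rfl

theorem gen_comm (a : Fin d) (s : S) : gen a * scalar s = scalar s * gen a := by
  rw [gen, scalar_apply, mk_mul_mk, mk_mul_mk, mul_one, one_mul, mul_one, one_mul]

theorem gen_sq (a : Fin d) : (gen a * gen a : Grassmann S d) = 0 := by
  rw [gen, mk_mul_mk, ExteriorAlgebra.ι_sq_zero, mk_zero]

theorem gen_anticomm (a b : Fin d) : (gen a * gen b : Grassmann S d) = -(gen b * gen a) := by
  rw [eq_neg_iff_add_eq_zero, gen, gen, mk_mul_mk, mk_mul_mk, ← mk_add,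
    ExteriorAlgebra.ι_add_mul_swap, mk_zero]

/-- The coefficient of the product of all the generators. -/
noncomputable def top : Grassmann S d →+ S :=
  ((TensorProduct.lid ℤ S).toLinearMap ∘ₗ LinearMap.rTensor S
    (ExteriorAlgebra.liftAlternating (Pi.single d Matrix.detRowAlternating))).toAddMonoidHom

theorem top_mk (x : ExteriorAlgebra ℤ (Fin d → ℤ)) (s : S) : top (mk x s) =
    ExteriorAlgebra.liftAlternating (Pi.single d Matrix.detRowAlternating) x • s :=
  (congrArg (TensorProduct.lid ℤ S) (LinearMap.rTensor_tmul S _ s x)).trans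
    (TensorProduct.lid_tmul _ _)

theorem top_mul_scalar (x : Grassmann S d) (s : S) : top (x * scalar s) = top x * s := by
  refine TensorProduct.induction_on (motive := fun x : Grassmann S d =>
    top (x * scalar s) = top x * s) x ?_ ?_ ?_
  · exact ((congrArg top (zero_mul (scalar s : Grassmann S d))).trans (map_zero top)).trans
      ((congrArg (· * s) (map_zero top)).trans (zero_mul s)).symm
  · intro x y
    change top (mk x y * scalar s) = top (mk x y) * s
    rw [scalar_apply, mk_mul_mk, mul_one, top_mk, top_mk, smul_mul_assoc]
  · intro x y hx hy
    refine ((congrArg top (add_mul x y (scalar s : Grassmann S d))).trans (map_add top _ _)).trans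
      ((congrArg₂ (· + ·) hx hy).trans ?_)
    exact (add_mul _ _ _).symm.trans (congrArg (· * s) (map_add top x y).symm)

theorem list_prod_mk (l : List (ExteriorAlgebra ℤ (Fin d → ℤ))) :
    (l.map fun x => (mk x (1 : S))).prod = mk l.prod 1 := by
  induction l with
  | nil => rfl
  | cons x l ih => rw [List.map_cons, List.prod_cons, List.prod_cons, ih, mk_mul_mk, mul_one]

theorem top_prod_gen (f : Fin d → Fin d) :
    top (List.ofFn fun j => (gen (f j) : Grassmann S d)).prod =
      ((Matrix.det (Matrix.of fun j a => if f j = a then (1 : ℤ) else 0) : ℤ) : S) := by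
  have h : (List.ofFn fun j => (gen (f j) : Grassmann S d)) =
      (List.ofFn fun j => ExteriorAlgebra.ι ℤ (Pi.single (f j) (1 : ℤ))).map fun x => mk x 1 := by
    rw [List.map_ofFn]; rfl
  rw [h, list_prod_mk, top_mk, ← ExteriorAlgebra.ιMulti_apply,
    ExteriorAlgebra.liftAlternating_apply_ιMulti, Pi.single_eq_same, zsmul_one]
  congr 1
  change Matrix.det _ = _
  congr 1
  ext j a
  simp [Pi.single_apply, eq_comm]

end Grassmann

end Grassmann

theorem prod_ofFn_sum {α R : Type*} [Fintype α] [Semiring R] {n : ℕ} (g : Fin n → α → R) :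
    (List.ofFn fun j => ∑ a, g j a).prod =
      ∑ f : Fin n → α, (List.ofFn fun j => g j (f j)).prod := by
  induction n with
  | zero => simp
  | succ n ih =>
    rw [List.ofFn_succ, List.prod_cons, ih, Finset.sum_mul_sum,
      ← (Fin.consEquiv fun _ => α).sum_comp, Fintype.sum_prod_type]
    refine Finset.sum_congr rfl fun a _ => Finset.sum_congr rfl fun f _ => ?_
    simp [Fin.consEquiv, List.ofFn_succ]

theorem prod_ofFn_mul {R : Type*} [Semiring R] {n : ℕ} (u v : Fin n → R)
    (h : ∀ i j, u i * v j = v j * u i) :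
    (List.ofFn fun j => u j * v j).prod = (List.ofFn u).prod * (List.ofFn v).prod := by
  induction n with
  | zero => simp
  | succ n ih =>
    have hc : Commute (v 0) (List.ofFn fun j : Fin n => u j.succ).prod := by
      refine Commute.list_prod_right _ _ fun x hx => ?_
      obtain ⟨i, rfl⟩ := (List.mem_ofFn' _ _).1 hx
      exact (h _ _).symm
    rw [List.ofFn_succ, List.ofFn_succ, List.ofFn_succ, List.prod_cons, List.prod_cons,
      List.prod_cons, ih (fun j => u j.succ) (fun j => v j.succ) fun i j => h _ _]
    simp only [mul_assoc]
    rw [← mul_assoc (v 0), hc.eq, mul_assoc]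

section Cdet

open Grassmann

variable {S : Type*} [Ring S] {d : ℕ}

theorem map_cdet {T : Type*} [Ring T] (f : S →+* T) (M : Matrix (Fin d) (Fin d) S) :
    cdet (M.map f) = f (cdet M) := by
  simp only [cdet, map_sum, map_zsmul, map_list_prod, List.map_ofFn, Matrix.map_apply]
  rfl

/-- The `j`-th column of a matrix as a linear form in the generators. -/
noncomputable def colForm (M : Matrix (Fin d) (Fin d) S) (j : Fin d) : Grassmann S d :=
  ∑ a, gen a * scalar (M a j)

theorem colForm_mul_colForm (M K : Matrix (Fin d) (Fin d) S) (b c : Fin d) :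
    colForm M b * colForm K c = ∑ a, ∑ a', gen a * gen a' * scalar (M a b * K a' c) := by
  rw [colForm, colForm, Finset.sum_mul_sum]
  refine Finset.sum_congr rfl fun a _ => Finset.sum_congr rfl fun a' _ => ?_
  rw [map_mul, mul_assoc, ← mul_assoc (scalar _), ← gen_comm]
  simp only [mul_assoc]

theorem sum_gen_eq_zero (f : Fin d → Fin d → S) (hf : ∀ a a', f a a' = f a' a) :
    ∑ a, ∑ a', gen a * gen a' * scalar (f a a') = (0 : Grassmann S d) := by
  rw [← Finset.sum_product']
  refine Finset.sum_involution (fun x _ => (x.2, x.1)) ?_ ?_ (fun _ _ => Finset.mem_univ _)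
    (fun _ _ => rfl)
  · rintro ⟨a, a'⟩ -
    simp only
    rw [hf a' a, gen_anticomm a a', neg_mul, neg_add_cancel]
  · rintro ⟨a, a'⟩ - h0 h1
    refine h0 ?_
    obtain rfl : a' = a := congrArg Prod.fst h1
    simp only
    rw [gen_sq, zero_mul]

/-- The column determinant is the top coefficient of the product of the columns, seen as linear
forms in anticommuting variables. -/
theorem cdet_eq_top (M : Matrix (Fin d) (Fin d) S) :
    cdet M = top (List.ofFn (colForm M)).prod := by
  have h0 : (List.ofFn (colForm M)).prod = _ :=
    prod_ofFn_sum fun j a => (gen a * scalar (M a j) : Grassmann S d)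
  rw [h0, map_sum]
  have h1 : ∀ f : Fin d → Fin d,
      top (List.ofFn fun j => (gen (f j) * scalar (M (f j) j) : Grassmann S d)).prod =
      ∑ σ : Equiv.Perm (Fin d), if ⇑σ = f then
        ((Equiv.Perm.sign σ : ℤˣ) : ℤ) • (List.ofFn fun j => M (f j) j).prod else 0 := by
    intro f
    rw [prod_ofFn_mul (fun j => gen (f j)) (fun j => scalar (M (f j) j)) fun i j => gen_comm _ _]
    have : (List.ofFn fun j => (scalar (M (f j) j) : Grassmann S d)).prod =
        scalar (List.ofFn fun j => M (f j) j).prod := by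
      rw [map_list_prod, List.map_ofFn]; rfl
    rw [this, top_mul_scalar, top_prod_gen, ← Matrix.det_transpose, Matrix.det_apply]
    push_cast
    rw [Finset.sum_mul]
    refine Finset.sum_congr rfl fun σ _ => ?_
    simp only [Matrix.transpose_apply, Matrix.of_apply, Finset.prod_ite_zero]
    by_cases hσ : ⇑σ = f
    · rw [if_pos hσ, if_pos fun j _ => by rw [hσ]]
      simp [Units.smul_def, zsmul_eq_mul]
    · rw [if_neg hσ, if_neg fun h => hσ (funext fun j => (h j (Finset.mem_univ j)).symm)]
      simp
  simp only [h1]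
  rw [Finset.sum_comm]
  refine Finset.sum_congr rfl fun σ _ => ?_
  rw [Finset.sum_ite_eq, if_pos (Finset.mem_univ _)]

/-- Vacuum expectation of a column determinant. Let `ev` be an additive map whose kernel is a left
ideal, and suppose that `ev` kills the entries of `K`, and that the commutators
`[K_{ab}, M_{a'c}]` are symmetric in `a` and `a'`. In anticommuting variables the columns of `K`
then anticommute with those of `M`, so they can be moved to the right, where they are killed. -/
theorem ev_cdet_add {G : Type*} [AddGroup G] (ev : S →+ G) (hev : ∀ s t, ev t = 0 → ev (s * t) = 0)
    (M K : Matrix (Fin d) (Fin d) S) (hK : ∀ a b, ev (K a b) = 0)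
    (hcomm : ∀ a a' b c, K a b * M a' c - M a' c * K a b = K a' b * M a c - M a c * K a' b) :
    ev (cdet (M + K)) = ev (cdet M) := by
  -- the left ideal generated by the kernel of `ev`
  let I : AddSubgroup (Grassmann S d) :=
    AddSubgroup.closure {y | ∃ x t, ev t = 0 ∧ y = x * scalar t}
  have hI : ∀ x, ∀ y ∈ I, x * y ∈ I := by
    intro x y hy
    induction hy using AddSubgroup.closure_induction with
    | mem y hy =>
      obtain ⟨z, t, ht, rfl⟩ := hy
      exact AddSubgroup.subset_closure ⟨x * z, t, ht, (mul_assoc _ _ _).symm⟩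
    | zero => rw [mul_zero]; exact I.zero_mem
    | add y z _ _ hy hz => rw [mul_add]; exact I.add_mem hy hz
    | neg y _ hy => rw [mul_neg]; exact I.neg_mem hy
  have htop : ∀ y ∈ I, ev (top y) = 0 := by
    intro y hy
    induction hy using AddSubgroup.closure_induction with
    | mem y hy =>
      obtain ⟨z, t, ht, rfl⟩ := hy
      rw [top_mul_scalar]
      exact hev _ _ ht
    | zero => rw [map_zero, map_zero]
    | add y z _ _ hy hz => rw [map_add, map_add, hy, hz, add_zero]
    | neg y _ hy => rw [map_neg, map_neg, hy, neg_zero]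
  have hKI : ∀ b, colForm K b ∈ I := fun b =>
    I.sum_mem fun a _ => AddSubgroup.subset_closure ⟨_, _, hK a b, rfl⟩
  have hanti : ∀ b c, colForm K b * colForm M c = -(colForm M c * colForm K b) := by
    intro b c
    have e : colForm M c * colForm K b =
        -∑ a, ∑ a', gen a * gen a' * scalar (M a' c * K a b) := by
      rw [colForm_mul_colForm, Finset.sum_comm, ← Finset.sum_neg_distrib]
      refine Finset.sum_congr rfl fun a _ => ?_
      rw [← Finset.sum_neg_distrib]
      exact Finset.sum_congr rfl fun a' _ => by rw [gen_anticomm a' a, neg_mul]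
    rw [e, neg_neg, ← sub_eq_zero, colForm_mul_colForm, ← Finset.sum_sub_distrib]
    simp only [← Finset.sum_sub_distrib, ← mul_sub, ← map_sub]
    exact sum_gen_eq_zero _ fun a a' => hcomm a a' b c
  have hcol : ∀ b, colForm (M + K) b = colForm M b + colForm K b := fun b => by
    simp only [colForm, Matrix.add_apply, map_add, mul_add, Finset.sum_add_distrib]
  have hmove : ∀ (l : List (Fin d)) (b : Fin d), colForm K b * (l.map (colForm M)).prod ∈ I := by
    intro l b
    induction l with
    | nil => simpa using hKI b
    | cons c l ih =>
      rw [List.map_cons, List.prod_cons, ← mul_assoc, hanti, neg_mul, mul_assoc]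
      exact I.neg_mem (hI _ _ ih)
  have hlist : ∀ l : List (Fin d), (l.map (colForm (M + K))).prod -
      (l.map (colForm M)).prod ∈ I := by
    intro l
    induction l with
    | nil => simp [I.zero_mem]
    | cons c l ih =>
      have e : (List.map (colForm (M + K)) (c :: l)).prod -
          (List.map (colForm M) (c :: l)).prod = (colForm M c + colForm K c) *
            ((l.map (colForm (M + K))).prod - (l.map (colForm M)).prod) +
          colForm K c * (l.map (colForm M)).prod := by
        rw [List.map_cons, List.map_cons, List.prod_cons, List.prod_cons, hcol]
        noncomm_ring
      rw [e]
      exact I.add_mem (hI _ _ ih) (hmove _ _)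
  have := htop _ (hlist (List.finRange d))
  rw [map_sub, map_sub, sub_eq_zero] at this
  rw [cdet_eq_top, cdet_eq_top, List.ofFn_eq_map, List.ofFn_eq_map]
  exact this

/-- For commuting entries the column determinant is invariant under transposition and simultaneous
permutations of rows and columns. -/
theorem cdet_transpose_submatrix (M : Matrix (Fin d) (Fin d) S)
    (h : ∀ a b a' b', M a b * M a' b' = M a' b' * M a b) (e : Equiv.Perm (Fin d)) :
    cdet (M.submatrix e e).transpose = cdet M := by
  let T := Subring.closure (Set.range fun x : Fin d × Fin d => M x.1 x.2)
  have hc : ∀ x ∈ Set.range (fun x : Fin d × Fin d => M x.1 x.2),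
      ∀ y ∈ Set.range (fun x : Fin d × Fin d => M x.1 x.2), x * y = y * x := by
    rintro _ ⟨x, rfl⟩ _ ⟨y, rfl⟩
    exact h _ _ _ _
  have hT : IsMulCommutative T := Subring.isMulCommutative_closure hc
  let _ : CommRing T := { (inferInstance : Ring T) with mul_comm := hT.is_comm.comm }
  let M' : Matrix (Fin d) (Fin d) T :=
    Matrix.of fun a b => ⟨M a b, Subring.subset_closure ⟨(a, b), rfl⟩⟩
  have key : ∀ N : Matrix (Fin d) (Fin d) T, cdet (N.map T.subtype) = (N.det : S) := by
    intro N
    have e1 : N.det = cdet N := by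
      rw [Matrix.det_apply, cdet]
      refine Finset.sum_congr rfl fun σ _ => ?_
      rw [List.prod_ofFn]; rfl
    rw [e1]
    exact map_cdet T.subtype N
  refine (key (M'.submatrix e e).transpose).trans (Eq.trans ?_ (key M').symm)
  congr 1
  refine (Matrix.det_transpose (M'.submatrix e e)).trans ?_
  exact Matrix.det_submatrix_equiv_self e M'

end Cdet

/-! ### Manin matrices and their Schur complements -/

section Manin

variable {R : Type*} [Ring R]

/-- The invariance of the Manin relations under a Schur complement, for two rows (with first
entries `p`, `p'`, where `P = p a⁻¹`, `P' = p' a⁻¹`) and two columns (with first entries `q`,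
`q'`). The second row and the second column may both be odd, in which case `s = -1`. -/
theorem schur_relation {a p p' P P' q q' m x y c : R} {s : ℤ} (hs : s = 1 ∨ s = -1)
    (ha : ∀ r, a * r = 0 → r = 0) (ha' : ∀ r, r * a = 0 → r = 0)
    (hP : a * P = p) (hP' : P * a = p) (hY : a * P' = p') (hY' : P' * a = p')
    (h0 : p * p' = p' * p)
    (h1 : a * m - m * a = p * q - q * p) (h2 : a * y - y * a = p' * q - q * p')
    (h3 : p * y - y * p = p' * m - m * p') (h4 : a * x - x * a = p * q' - q' * p)
    (h5 : a * c - c * a = p' * q' - s • (q' * p')) (h6 : p * c - c * p = p' * x - s • (x * p'))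
    (h7 : q * x - x * q = m * q' - q' * m) (h8 : q * c - c * q = y * q' - s • (q' * y))
    (h9 : m * c - c * m = y * x - s • (x * y)) :
    (m - P * q) * (c - P' * q') - (c - P' * q') * (m - P * q) =
      (y - P' * q) * (x - P * q') - s • ((x - P * q') * (y - P' * q)) := by
  have hPY : P * P' = P' * P := by
    rw [← sub_eq_zero]
    refine ha _ (ha' _ ?_)
    have e : a * (P * P' - P' * P) * a = (a * P) * (P' * a) - (a * P') * (P * a) := by noncomm_ring
    rw [e, hP, hP', hY, hY', h0, sub_self]
  have hj : P * (y - P' * q) - P' * (m - P * q) = (y - P' * q) * P - (m - P * q) * P' := by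
    rw [← sub_eq_zero]
    refine ha _ ?_
    subst hP hY
    linear_combination (norm := noncomm_ring) h3 - h2 * P + h1 * P' - a * hPY * q - q * a * hPY
  have hl : (c - P' * q') * P - s • ((x - P * q') * P') =
      P * (c - P' * q') - P' * (x - P * q') := by
    rw [← sub_eq_zero]
    refine ha _ ?_
    subst hP hY
    rcases hs with rfl | rfl <;> simp only [one_smul, neg_smul, sub_neg_eq_add] at *
    · linear_combination (norm := noncomm_ring) h5 * P - h6 - h4 * P' + q' * a * hPY + a * hPY * q'
    · linear_combination (norm := noncomm_ring) h5 * P - h6 + h4 * P' - q' * a * hPY + a * hPY * q'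
  rcases hs with rfl | rfl <;> simp only [one_smul, neg_smul, sub_neg_eq_add] at *
  · linear_combination (norm := noncomm_ring) h9 + P' * h7 - P * h8 - hj * q' + hl * q -
      hPY * (q * q' + q' * q)
  · linear_combination (norm := noncomm_ring) h9 + P' * h7 - P * h8 - hj * q' + hl * q -
      hPY * (q * q' + q' * q)

/-- Here `Y = y a⁻¹` for the odd entry `y` below `a`, whose square vanishes. -/
theorem schur_sq {a Y : R} (ha : ∀ r, a * r = 0 → r = 0) (ha' : ∀ r, r * a = 0 → r = 0)
    (hY : Y * a = a * Y) (h : a * Y * (a * Y) = 0) : Y * Y = 0 := by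
  refine ha _ (ha' _ ?_)
  linear_combination (norm := noncomm_ring) h + a * Y * hY

theorem schur_odd_comm {a Y y q : R} (ha : ∀ r, a * r = 0 → r = 0) (hYY : Y * Y = 0)
    (hy : a * y - y * a = a * Y * q - q * (a * Y)) (h0 : a * Y * y = -(y * (a * Y))) :
    Y * (y - Y * q) = -((y - Y * q) * Y) := by
  rw [eq_neg_iff_add_eq_zero]
  refine ha _ ?_
  linear_combination (norm := noncomm_ring) hy * Y + h0 - a * hYY * q - q * a * hYY

/-- The invariance of the relations in an odd row under a Schur complement: anticommutation. -/
theorem schur_relation_odd {a Y y y' q q' : R} (ha : ∀ r, a * r = 0 → r = 0) (hYY : Y * Y = 0)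
    (hy : a * y - y * a = a * Y * q - q * (a * Y))
    (hy' : a * y' - y' * a = a * Y * q' - q' * (a * Y))
    (h0 : a * Y * y = -(y * (a * Y))) (h0' : a * Y * y' = -(y' * (a * Y)))
    (h1 : y * y' = -(y' * y)) (h3 : q * y' - y * q' = y' * q - q' * y) :
    (y - Y * q) * (y' - Y * q') = -((y' - Y * q') * (y - Y * q)) := by
  have hj := schur_odd_comm ha hYY hy h0
  have hl := schur_odd_comm ha hYY hy' h0'
  linear_combination (norm := noncomm_ring) h1 - hj * q' - hl * q - Y * h3 -
    hYY * (q * q' + q' * q)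

/-- The invariance of the relations in an odd row under a Schur complement: commutation with the
last entry. -/
theorem schur_relation_odd_last {a Y y q c x : R} (ha : ∀ r, a * r = 0 → r = 0) (hYY : Y * Y = 0)
    (hy : a * y - y * a = a * Y * q - q * (a * Y)) (h0 : a * Y * y = -(y * (a * Y)))
    (hc : a * c - c * a = a * Y * x + x * (a * Y)) (hc' : a * Y * c = c * (a * Y))
    (h1 : y * c = c * y) (h3 : q * c - c * q = y * x + x * y) :
    (y - Y * q) * (c - Y * x) = (c - Y * x) * (y - Y * q) := by
  have hj := schur_odd_comm ha hYY hy h0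
  have hl : (c - Y * x) * Y = Y * (c - Y * x) := by
    rw [← sub_eq_zero]
    refine ha _ ?_
    linear_combination (norm := noncomm_ring) hc * Y - hc' + a * hYY * x + x * a * hYY
  linear_combination (norm := noncomm_ring) h1 - hj * x + hl * q - Y * h3 -
    hYY * (q * x + x * q)

/-- The Manin relations `[M_{ab}, M_{kl}] = [M_{kb}, M_{al}]` for a square matrix. For `b = l` they
say that `2 [M_{ab}, M_{kb}] = 0`, so that the entries of a column commute if `2` is not a zero
divisor. -/
def IsManin {n : ℕ} (M : Matrix (Fin n) (Fin n) R) : Prop :=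
  ∀ a k b l, M a b * M k l - M k b * M a l = M k l * M a b - M a l * M k b

/-- The relations of a super Manin matrix whose rows and columns are indexed by `n` even indices
followed by one more index, even if `s = 1` and odd if `s = -1`. The matrix consists of the blocks
`M`, `x` (last column), `y` (last row) and `c` (last entry). -/
structure IsSuperManin {n : ℕ} (s : ℤ) (M : Matrix (Fin n) (Fin n) R) (x y : Fin n → R) (c : R) :
    Prop where
  MM : IsManin M
  Mx : ∀ a k b, M a b * x k - M k b * x a = x k * M a b - x a * M k b
  My : ∀ a b l, M a b * y l - y b * M a l = y l * M a b - M a l * y b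
  Mc : ∀ a b, M a b * c - c * M a b = y b * x a - s • (x a * y b)
  xx : s = 1 → ∀ a k, x a * x k = x k * x a
  xc : s = 1 → ∀ a, x a * c = c * x a
  yy : s = -1 → ∀ b l, y b * y l = -(y l * y b)
  yc : s = -1 → ∀ b, y b * c = c * y b

/-- The Schur complement of the upper left entry, whose inverse is `u`. -/
def pivot {n : ℕ} (M : Matrix (Fin (n + 1)) (Fin (n + 1)) R) (u : R) : Matrix (Fin n) (Fin n) R :=
  Matrix.of fun i j => M i.succ j.succ - M i.succ 0 * u * M 0 j.succ

theorem pivot_apply {n : ℕ} (M : Matrix (Fin (n + 1)) (Fin (n + 1)) R) (u : R) (i j : Fin n) :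
    pivot M u i j = M i.succ j.succ - M i.succ 0 * u * M 0 j.succ := rfl

theorem eq_of_sub_eq_sub_swap (h2 : ∀ r : R, r + r = 0 → r = 0) {r t : R} (h : r - t = t - r) :
    r = t := by
  rw [← sub_eq_zero]
  refine h2 _ ?_
  nth_rewrite 1 [h]
  abel

theorem IsManin.comm (h2 : ∀ r : R, r + r = 0 → r = 0) {n : ℕ}
    {M : Matrix (Fin n) (Fin n) R} (hM : IsManin M) (a k b : Fin n) :
    M a b * M k b = M k b * M a b :=
  eq_of_sub_eq_sub_swap h2 (hM a k b b)

theorem IsSuperManin.comm (h2 : ∀ r : R, r + r = 0 → r = 0) {n : ℕ} {s : ℤ}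
    {M : Matrix (Fin n) (Fin n) R} {x y : Fin n → R} {c : R}
    (hM : IsSuperManin s M x y c) (a b : Fin n) : M a b * y b = y b * M a b :=
  eq_of_sub_eq_sub_swap h2 (hM.My a b b)

theorem IsManin.schur (h2 : ∀ r : R, r + r = 0 → r = 0) {n : ℕ}
    {M : Matrix (Fin (n + 1)) (Fin (n + 1)) R} (hM : IsManin M) {u : R}
    (h1 : M 0 0 * u = 1) (h1' : u * M 0 0 = 1) : IsManin (pivot M u) := by
  intro i k j l
  have := schur_relation (s := 1) (a := M 0 0) (p := M i.succ 0) (p' := M k.succ 0)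
    (P := M i.succ 0 * u) (P' := M k.succ 0 * u) (q := M 0 j.succ) (q' := M 0 l.succ)
    (m := M i.succ j.succ) (x := M i.succ l.succ) (y := M k.succ j.succ) (c := M k.succ l.succ)
    (Or.inl rfl) (fun r hr => by rw [← one_mul r, ← h1', mul_assoc, hr, mul_zero])
    (fun r hr => by rw [← mul_one r, ← h1, ← mul_assoc, hr, zero_mul])
    (by rw [← mul_assoc, hM.comm h2, mul_assoc, h1, mul_one]) (by rw [mul_assoc, h1', mul_one])
    (by rw [← mul_assoc, hM.comm h2, mul_assoc, h1, mul_one]) (by rw [mul_assoc, h1', mul_one])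
    (hM.comm h2 _ _ _)
    (by linear_combination (norm := noncomm_ring) hM 0 i.succ 0 j.succ)
    (by linear_combination (norm := noncomm_ring) hM 0 k.succ 0 j.succ)
    (by linear_combination (norm := noncomm_ring) hM i.succ k.succ 0 j.succ)
    (by linear_combination (norm := noncomm_ring) hM 0 i.succ 0 l.succ)
    (by linear_combination (norm := noncomm_ring) hM 0 k.succ 0 l.succ)
    (by linear_combination (norm := noncomm_ring) hM i.succ k.succ 0 l.succ)
    (by linear_combination (norm := noncomm_ring) hM 0 i.succ j.succ l.succ)
    (by linear_combination (norm := noncomm_ring) hM 0 k.succ j.succ l.succ)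
    (by linear_combination (norm := noncomm_ring) hM i.succ k.succ j.succ l.succ)
  simp only [pivot_apply]
  rw [one_smul] at this
  linear_combination (norm := noncomm_ring) this

theorem IsSuperManin.schur (h2 : ∀ r : R, r + r = 0 → r = 0) {n : ℕ} {s : ℤ}
    {M : Matrix (Fin (n + 1)) (Fin (n + 1)) R}
    {x y : Fin (n + 1) → R} {c : R} (hs : s = 1 ∨ s = -1) (hM : IsSuperManin s M x y c) {u : R}
    (h1 : M 0 0 * u = 1) (h1' : u * M 0 0 = 1) :
    IsSuperManin s (pivot M u) (fun i => x i.succ - M i.succ 0 * u * x 0)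
      (fun j => y j.succ - y 0 * u * M 0 j.succ) (c - y 0 * u * x 0) := by
  have ha : ∀ r, M 0 0 * r = 0 → r = 0 := fun r hr => by
    rw [← one_mul r, ← h1', mul_assoc, hr, mul_zero]
  have ha' : ∀ r, r * M 0 0 = 0 → r = 0 := fun r hr => by
    rw [← mul_one r, ← h1, ← mul_assoc, hr, zero_mul]
  have hP : ∀ i, M 0 0 * (M i 0 * u) = M i 0 := fun i => by
    rw [← mul_assoc, hM.MM.comm h2, mul_assoc, h1, mul_one]
  have hP' : ∀ i, M i 0 * u * M 0 0 = M i 0 := fun i => by rw [mul_assoc, h1', mul_one]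
  have hY : M 0 0 * (y 0 * u) = y 0 := by
    rw [← mul_assoc, hM.comm h2, mul_assoc, h1, mul_one]
  have hY' : y 0 * u * M 0 0 = y 0 := by rw [mul_assoc, h1', mul_one]
  have hMx : ∀ i k j, M i j * x k - x k * M i j = M k j * x i - x i * M k j := fun i k j => by
    linear_combination (norm := noncomm_ring) hM.Mx i k j
  have hMx' : ∀ i k j, (pivot M u i j) * (x k.succ - M k.succ 0 * u * x 0) -
      (x k.succ - M k.succ 0 * u * x 0) * pivot M u i j =
      pivot M u k j * (x i.succ - M i.succ 0 * u * x 0) -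
        (x i.succ - M i.succ 0 * u * x 0) * pivot M u k j := by
    intro i k j
    have := schur_relation (s := 1) (q := M 0 j.succ) (q' := x 0)
      (m := M i.succ j.succ) (x := x i.succ) (y := M k.succ j.succ) (c := x k.succ)
      (Or.inl rfl) ha ha' (hP i.succ) (hP' _) (hP k.succ) (hP' _) (hM.MM.comm h2 _ _ _)
      (by linear_combination (norm := noncomm_ring) hM.MM 0 i.succ 0 j.succ)
      (by linear_combination (norm := noncomm_ring) hM.MM 0 k.succ 0 j.succ)
      (by linear_combination (norm := noncomm_ring) hM.MM i.succ k.succ 0 j.succ)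
      (hMx _ _ _) (by rw [one_smul]; exact hMx _ _ _) (by rw [one_smul]; exact hMx _ _ _)
      (hMx _ _ _) (by rw [one_smul]; exact hMx _ _ _) (by rw [one_smul]; exact hMx _ _ _)
    rw [one_smul] at this
    simpa only [pivot_apply] using this
  have hMy : ∀ i j l, M i j * y l - y l * M i j = y j * M i l - M i l * y j := fun i j l => by
    linear_combination (norm := noncomm_ring) hM.My i j l
  refine ⟨hM.MM.schur h2 h1 h1', fun i k j => ?_, fun i j l => ?_, fun i j => ?_,
    fun h i k => ?_, fun h i => ?_, fun h j l => ?_, fun h j => ?_⟩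
  · linear_combination (norm := noncomm_ring) hMx' i k j
  · have := schur_relation (s := 1) (q := M 0 j.succ) (q' := M 0 l.succ)
      (m := M i.succ j.succ) (x := M i.succ l.succ) (y := y j.succ) (c := y l.succ)
      (Or.inl rfl) ha ha' (hP i.succ) (hP' _) hY hY' (hM.comm h2 _ _)
      (by linear_combination (norm := noncomm_ring) hM.MM 0 i.succ 0 j.succ)
      (hMy _ _ _) (hMy _ _ _)
      (by linear_combination (norm := noncomm_ring) hM.MM 0 i.succ 0 l.succ)
      (by rw [one_smul]; exact hMy _ _ _) (by rw [one_smul]; exact hMy _ _ _)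
      (by linear_combination (norm := noncomm_ring) hM.MM 0 i.succ j.succ l.succ)
      (by rw [one_smul]; exact hMy _ _ _) (by rw [one_smul]; exact hMy _ _ _)
    rw [one_smul] at this
    simp only [pivot_apply]
    linear_combination (norm := noncomm_ring) this
  · have := schur_relation (q := M 0 j.succ) (q' := x 0)
      (m := M i.succ j.succ) (x := x i.succ) (y := y j.succ) (c := c)
      hs ha ha' (hP i.succ) (hP' _) hY hY' (hM.comm h2 _ _)
      (by linear_combination (norm := noncomm_ring) hM.MM 0 i.succ 0 j.succ)
      (hMy _ _ _) (hMy _ _ _) (hMx _ _ _) (hM.Mc _ _) (hM.Mc _ _) (hMx _ _ _) (hM.Mc _ _)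
      (hM.Mc _ _)
    simpa only [pivot_apply] using this
  · subst h
    refine eq_of_sub_eq_sub_swap h2 ?_
    exact (schur_relation (s := 1) (q := x 0) (q' := x 0)
      (m := x i.succ) (x := x i.succ) (y := x k.succ) (c := x k.succ)
      (Or.inl rfl) ha ha' (hP i.succ) (hP' _) (hP k.succ) (hP' _) (hM.MM.comm h2 _ _ _)
      (hMx _ _ _) (hMx _ _ _) (hMx _ _ _) (hMx _ _ _) (by rw [one_smul]; exact hMx _ _ _)
      (by rw [one_smul]; exact hMx _ _ _) (by simp only [hM.xx rfl 0])
      (by simp only [hM.xx rfl 0, one_smul]) (by simp only [hM.xx rfl k.succ, one_smul])).trans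
      (by rw [one_smul])
  · subst h
    have hMc : ∀ a b, M a b * c - c * M a b = y b * x a - x a * y b := fun a b => by
      have := hM.Mc a b
      rwa [one_smul] at this
    refine eq_of_sub_eq_sub_swap h2 ?_
    exact (schur_relation (s := 1) (q := x 0) (q' := x 0)
      (m := x i.succ) (x := x i.succ) (y := c) (c := c)
      (Or.inl rfl) ha ha' (hP i.succ) (hP' _) hY hY' (hM.comm h2 _ _)
      (hMx _ _ _) (hMc _ _) (hMc _ _) (hMx _ _ _) (hM.Mc _ _) (hM.Mc _ _)
      (by simp only [hM.xx rfl 0]) (by simp only [hM.xc rfl, one_smul])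
      (by simp only [hM.xc rfl, one_smul])).trans (by rw [one_smul])
  · have hYY := schur_sq ha ha' (hY'.trans hY.symm) (by
      rw [hY]; exact h2 _ (by nth_rewrite 1 [hM.yy h]; exact neg_add_cancel _))
    refine schur_relation_odd ha hYY ?_ ?_ ?_ ?_ (hM.yy h _ _) ?_
    · rw [hY]; exact hMy _ _ _
    · rw [hY]; exact hMy _ _ _
    · rw [hY]; exact hM.yy h _ _
    · rw [hY]; exact hM.yy h _ _
    · linear_combination (norm := noncomm_ring) hM.My 0 j.succ l.succ
  · have hYY := schur_sq ha ha' (hY'.trans hY.symm) (by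
      rw [hY]; exact h2 _ (by nth_rewrite 1 [hM.yy h]; exact neg_add_cancel _))
    have hMc : ∀ a b, M a b * c - c * M a b = y b * x a + x a * y b := fun a b => by
      have := hM.Mc a b
      rwa [h, neg_one_smul, sub_neg_eq_add] at this
    refine schur_relation_odd_last ha hYY ?_ ?_ ?_ ?_ (hM.yc h _) (hMc _ _)
    · rw [hY]; exact hMy _ _ _
    · rw [hY]; exact hM.yy h _ _
    · rw [hY]; exact hMc _ _
    · rw [hY]; exact hM.yc h _

end Manin

/-! ### Column determinants of Manin matrices -/

section ManinDet

open Grassmann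

variable {R : Type*} [Ring R]

theorem cdet_succ_of_row {n : ℕ} (M : Matrix (Fin (n + 1)) (Fin (n + 1)) R)
    (h : ∀ j : Fin n, M 0 j.succ = 0) :
    cdet M = M 0 0 * cdet (M.submatrix Fin.succ Fin.succ) := by
  rw [cdet, ← Equiv.Perm.decomposeFin.symm.sum_comp, Fintype.sum_prod_type,
    Finset.sum_eq_single 0 ?_ (by simp), cdet, Finset.mul_sum]
  · refine Finset.sum_congr rfl fun τ _ => ?_
    rw [Equiv.Perm.decomposeFin.symm_sign, if_pos rfl, one_mul, List.ofFn_succ, List.prod_cons,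
      mul_smul_comm]
    simp [Matrix.submatrix_apply]
  · intro p _ hp
    refine Finset.sum_eq_zero fun τ _ => ?_
    rw [List.prod_eq_zero, smul_zero]
    set σ := Equiv.Perm.decomposeFin.symm (p, τ) with hσ
    have h0 : σ 0 = p := Equiv.Perm.decomposeFin_symm_apply_zero p τ
    obtain ⟨j, hj⟩ := σ.surjective 0
    have hj0 : j ≠ 0 := by
      rintro rfl
      exact hp (h0.symm.trans hj)
    obtain ⟨i, rfl⟩ := Fin.exists_succ_eq.2 hj0
    rw [List.mem_ofFn']
    exact ⟨i.succ, (congrArg (fun k => M k i.succ) hj).trans (h i)⟩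

theorem colForm_anticomm {n : ℕ} {M : Matrix (Fin n) (Fin n) R} (hM : IsManin M) (b l : Fin n) :
    colForm M b * colForm M l = -(colForm M l * colForm M b) := by
  rw [eq_neg_iff_add_eq_zero, colForm_mul_colForm, colForm_mul_colForm, ← Finset.sum_add_distrib]
  simp only [← Finset.sum_add_distrib, ← mul_add, ← map_add]
  refine sum_gen_eq_zero _ fun a k => ?_
  linear_combination (norm := noncomm_ring) hM a k b l

theorem colForm_sq (h2 : ∀ r : R, r + r = 0 → r = 0) {n : ℕ} {M : Matrix (Fin n) (Fin n) R}
    (hM : IsManin M) (b : Fin n) : colForm M b * colForm M b = 0 := by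
  rw [colForm_mul_colForm]
  exact sum_gen_eq_zero _ fun a k => hM.comm h2 a k b

/-- The column determinant of a Manin matrix is the product of the upper left entry and the
column determinant of its Schur complement: subtracting multiples of the first column from the
others does not change the product of the columns as linear forms in anticommuting variables. -/
theorem IsManin.cdet_succ (h2 : ∀ r : R, r + r = 0 → r = 0) {n : ℕ}
    {M : Matrix (Fin (n + 1)) (Fin (n + 1)) R} (hM : IsManin M) {u : R} (h1 : M 0 0 * u = 1) :
    cdet M = M 0 0 * cdet (pivot M u) := by
  let N : Matrix (Fin (n + 1)) (Fin (n + 1)) R := Matrix.of fun a =>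
    Fin.cons (M a 0) fun j => M a j.succ - M a 0 * (u * M 0 j.succ)
  have hN0 : ∀ a, N a 0 = M a 0 := fun a => rfl
  have hNs : ∀ a (j : Fin n), N a j.succ = M a j.succ - M a 0 * (u * M 0 j.succ) := fun a j => rfl
  have hc0 : colForm N 0 = colForm M 0 := rfl
  have hcs : ∀ j : Fin n, colForm N j.succ =
      colForm M j.succ - colForm M 0 * scalar (u * M 0 j.succ) := by
    intro j
    simp only [colForm, hNs, map_sub, mul_sub, Finset.sum_sub_distrib, map_mul (scalar) (M _ 0),
      ← mul_assoc (gen _), ← Finset.sum_mul]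
  have hvan : ∀ l : List (Fin n),
      colForm M 0 * (l.map fun j => colForm M j.succ).prod * colForm M 0 = 0 := by
    intro l
    induction l with
    | nil => simpa using colForm_sq h2 hM 0
    | cons c l ih =>
      rw [List.map_cons, List.prod_cons, ← mul_assoc, colForm_anticomm hM 0 c.succ, neg_mul,
        neg_mul, mul_assoc, mul_assoc, ← mul_assoc (colForm M 0), ih, mul_zero, neg_zero]
  have hlist : ∀ l l' : List (Fin n),
      colForm M 0 * (l'.map fun j => colForm M j.succ).prod *
        (l.map fun j => colForm N j.succ).prod =
      colForm M 0 * (l'.map fun j => colForm M j.succ).prod *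
        (l.map fun j => colForm M j.succ).prod := by
    intro l
    induction l with
    | nil => intro l'; rfl
    | cons c l ih =>
      intro l'
      have := ih (l' ++ [c])
      rw [List.map_append, List.prod_append, List.map_singleton, List.prod_singleton] at this
      rw [List.map_cons, List.prod_cons, List.map_cons, List.prod_cons, hcs, sub_mul, mul_sub]
      linear_combination (norm := noncomm_ring) this - hvan l' * scalar (u * M 0 c.succ) *
        (l.map fun j => colForm N j.succ).prod
  have hMN : cdet M = cdet N := by
    rw [cdet_eq_top, cdet_eq_top, List.ofFn_succ, List.ofFn_succ, List.prod_cons, List.prod_cons,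
      List.ofFn_eq_map, List.ofFn_eq_map, hc0]
    have := hlist (List.finRange n) []
    rw [List.map_nil, List.prod_nil, mul_one] at this
    rw [this]
  rw [hMN, cdet_succ_of_row N fun j => by rw [hNs, ← mul_assoc, h1, one_mul, sub_self], hN0]
  congr 2
  ext i j
  rw [Matrix.submatrix_apply, hNs, pivot_apply, mul_assoc]

/-- The matrix differs from the scalar matrix `t` by a matrix with entries in the subring `T`. -/
def IsNear (T : Subring R) (t : R) {n : ℕ} (M : Matrix (Fin n) (Fin n) R) : Prop :=
  ∀ a b, M a b - (if a = b then t else 0) ∈ T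

/-- All perturbations of `t` by elements of the subring `T` are invertible, with inverse in `T`. -/
def HasInverses (T : Subring R) (t : R) : Prop :=
  ∀ r ∈ T, ∃ u ∈ T, (t + r) * u = 1 ∧ u * (t + r) = 1

variable {T : Subring R} {t t' : R}

theorem HasInverses.exists_inv (ht : HasInverses T t) {m : R} (hm : m - t ∈ T) :
    ∃ u ∈ T, m * u = 1 ∧ u * m = 1 := by
  have := ht _ hm
  rwa [add_sub_cancel] at this

theorem HasInverses.inv_mem (ht : HasInverses T t) {m g : R} (hm : m - t ∈ T) (h : m * g = 1) :
    g ∈ T := by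
  obtain ⟨u, hu, -, hu2⟩ := ht.exists_inv hm
  rwa [← left_inv_eq_right_inv hu2 h]

theorem IsNear.zero {n : ℕ} {M : Matrix (Fin (n + 1)) (Fin (n + 1)) R} (hM : IsNear T t M) :
    M 0 0 - t ∈ T := by simpa using hM 0 0

theorem IsNear.row {n : ℕ} {M : Matrix (Fin (n + 1)) (Fin (n + 1)) R} (hM : IsNear T t M)
    (j : Fin n) : M 0 j.succ ∈ T := by simpa [(Fin.succ_ne_zero j).symm] using hM 0 j.succ

theorem IsNear.col {n : ℕ} {M : Matrix (Fin (n + 1)) (Fin (n + 1)) R} (hM : IsNear T t M)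
    (i : Fin n) : M i.succ 0 ∈ T := by simpa using hM i.succ 0

theorem IsNear.pivot {n : ℕ} {M : Matrix (Fin (n + 1)) (Fin (n + 1)) R} (hM : IsNear T t M) {u : R}
    (hu : u ∈ T) : IsNear T t (pivot M u) := fun i j => by
  have h1 := hM i.succ j.succ
  rw [pivot_apply, sub_right_comm]
  simp only [Fin.succ_inj] at h1
  exact T.sub_mem h1 (T.mul_mem (T.mul_mem (hM.col i) hu) (hM.row j))

theorem IsNear.submatrix {m n : ℕ} {M : Matrix (Fin n) (Fin n) R} (hM : IsNear T t M)
    (f : Fin m → Fin n) (hf : Function.Injective f) : IsNear T t (M.submatrix f f) := fun i j => by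
  simpa [hf.eq_iff] using hM (f i) (f j)

/-- The column determinant of a Manin matrix that is close to a scalar matrix is invertible. -/
theorem IsManin.exists_inv_cdet (h2 : ∀ r : R, r + r = 0 → r = 0) (ht : HasInverses T t) {n : ℕ}
    {M : Matrix (Fin n) (Fin n) R} (hM : IsManin M) (hn : IsNear T t M) :
    ∃ G ∈ T, cdet M * G = 1 ∧ G * cdet M = 1 := by
  induction n with
  | zero => exact ⟨1, T.one_mem, by simp [cdet], by simp [cdet]⟩
  | succ n ih =>
    obtain ⟨u, hu, hu1, hu2⟩ := ht.exists_inv hn.zero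
    obtain ⟨G, hG, hG1, hG2⟩ := ih (hM.schur h2 hu1 hu2) (hn.pivot hu)
    rw [hM.cdet_succ h2 hu1]
    refine ⟨G * u, T.mul_mem hG hu, ?_, ?_⟩
    · rw [mul_assoc, ← mul_assoc _ G, hG1, one_mul, hu1]
    · rw [mul_assoc, ← mul_assoc u, hu2, one_mul, hG2]

/-- The two orders of taking Schur complements, first of `a` and then of the last entry `c`, or the
other way around, lead to the same result. -/
theorem schur_schur {a u c g c' g' a' u' x₀ y₀ : R} (hu : a * u = 1)
    (hua : u * a = 1) (hg : g * c = 1)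
    (hc : c' = c - y₀ * u * x₀) (hg' : c' * g' = 1) (hg'' : g' * c' = 1)
    (ha : a' = a - x₀ * g * y₀) (hu' : a' * u' = 1) (hu'' : u' * a' = 1)
    (hg1 : c * g = 1) (m p q x y : R) :
    m - x * g * y - (p - x * g * y₀) * u' * (q - x₀ * g * y) =
      m - p * u * q - (x - p * u * x₀) * g' * (y - y₀ * u * q) := by
  have i1 : u' * x₀ * g = u * x₀ * g' := by
    have e : x₀ * g * c' = a' * (u * x₀) := by
      rw [hc, ha]
      linear_combination (norm := noncomm_ring) x₀ * hg - hu * x₀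
    calc u' * x₀ * g = u' * (x₀ * g * c') * g' := by
          linear_combination (norm := noncomm_ring) -(u' * x₀ * g * hg')
      _ = _ := by rw [e, ← mul_assoc u', hu'', one_mul]
  have i2 : g * y₀ * u' = g' * y₀ * u := by
    have e : c' * (g * y₀) = y₀ * u * a' := by
      rw [hc, ha]
      linear_combination (norm := noncomm_ring) hg1 * y₀ - y₀ * hua
    calc g * y₀ * u' = g' * (c' * (g * y₀)) * u' := by rw [← mul_assoc, hg'', one_mul]
      _ = g' * (y₀ * u * (a' * u')) := by rw [e]; noncomm_ring
      _ = _ := by rw [hu', mul_one, mul_assoc]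
  have i3 : u' = u + u * x₀ * g' * y₀ * u := by
    rw [← i1]
    have : u' * a' * u = u := by rw [hu'', one_mul]
    rw [ha] at this
    linear_combination (norm := noncomm_ring) this - u' * hu
  have i4 : g' = g + g * y₀ * u' * x₀ * g := by
    rw [i2]
    have : g' * c' * g = g := by rw [hg'', one_mul]
    rw [hc] at this
    linear_combination (norm := noncomm_ring) this - g' * hg1
  linear_combination (norm := noncomm_ring) x * i4 * y - p * i3 * q + p * i1 * y + x * i2 * q

/-- The effect of exchanging the order of `n` even indices and one further index on the Berezinian
of a super Manin matrix. The element `v` is the last entry of the inverse of the matrix; it enters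
through the last column `(h, v)` of that inverse. -/
theorem IsSuperManin.cdet_exchange (h2 : ∀ r : R, r + r = 0 → r = 0) (ht : HasInverses T t)
    (ht' : HasInverses T t') {s : ℤ} (hs : s = 1 ∨ s = -1) {n : ℕ}
    {M N : Matrix (Fin n) (Fin n) R} {x y : Fin n → R} {c g v : R} {h : Fin n → R}
    (hM : IsSuperManin s M x y c) (hMn : IsNear T t M) (hx : ∀ a, x a ∈ T) (hy : ∀ b, y b ∈ T)
    (hc : c - t' ∈ T) (hg : c * g = 1) (hg' : g * c = 1) (hN : IsManin N)
    (hNM : ∀ a b, N a b = M a b - x a * g * y b) (hv : ∀ a, ∑ b, M a b * h b + x a * v = 0)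
    (hv' : ∑ b, y b * h b + c * v = 1) :
    (s = 1 → cdet M = c * cdet N * v) ∧ (s = -1 → cdet M * v = g * cdet N) := by
  induction n generalizing c g with
  | zero =>
    have hcv : c * v = 1 := by simpa using hv'
    have hvg : v = g := (left_inv_eq_right_inv hg' hcv).symm
    refine ⟨fun _ => by simp [cdet, hcv], fun _ => by simp [cdet, hvg]⟩
  | succ n ih =>
    have hgT := ht'.inv_mem hc hg
    obtain ⟨u, hu, hu1, hu2⟩ := ht.exists_inv hMn.zero
    have hNn : IsNear T t N := fun a b => by
      rw [hNM, sub_right_comm]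
      exact T.sub_mem (hMn a b) (T.mul_mem (T.mul_mem (hx a) hgT) (hy b))
    obtain ⟨u', -, hu1', hu2'⟩ := ht.exists_inv hNn.zero
    have hc' : c - y 0 * u * x 0 - t' ∈ T := by
      rw [sub_right_comm]
      exact T.sub_mem hc (T.mul_mem (T.mul_mem (hy 0) hu) (hx 0))
    obtain ⟨g', -, hgg, hgg'⟩ := ht'.exists_inv hc'
    have hh0 : h 0 = -(u * (∑ j : Fin n, M 0 j.succ * h j.succ + x 0 * v)) := by
      have := hv 0
      rw [Fin.sum_univ_succ] at this
      linear_combination (norm := noncomm_ring) u * this - hu2 * h 0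
    have key := ih (c := c - y 0 * u * x 0) (g := g') (N := pivot N u')
      (h := fun b => h b.succ) (hM.schur h2 hs hu1 hu2)
      (hMn.pivot hu) (fun a => T.sub_mem (hx _) (T.mul_mem (T.mul_mem (hMn.col _) hu) (hx _)))
      (fun b => T.sub_mem (hy _) (T.mul_mem (T.mul_mem (hy _) hu) (hMn.row _)))
      hc' hgg hgg' (hN.schur h2 hu1' hu2') ?_ ?_ ?_
    · have hay := hM.comm h2 0 0
      have hMc := hM.Mc 0 0
      rw [hM.MM.cdet_succ h2 hu1, hN.cdet_succ h2 hu1']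
      constructor
      · intro h
        have e : M 0 0 * (c - y 0 * u * x 0) = c * N 0 0 := by
          have hxc := hM.xc h 0
          subst h
          rw [one_smul] at hMc
          rw [hNM]
          linear_combination (norm := noncomm_ring) hMc - hay * u * x 0 - y 0 * hu1 * x 0 -
            hxc * g * y 0 + x 0 * hg * y 0
        rw [key.1 h, ← mul_assoc, ← mul_assoc, e]
        simp only [mul_assoc]
      · intro h
        have e : N 0 0 * (c - y 0 * u * x 0) = c * M 0 0 := by
          have hyc := hM.yc h 0
          have hyy : y 0 * y 0 = 0 := h2 _ (by nth_rewrite 1 [hM.yy h]; exact neg_add_cancel _)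
          rw [h, neg_one_smul, sub_neg_eq_add] at hMc
          rw [hNM]
          linear_combination (norm := noncomm_ring) hMc - hay * u * x 0 - y 0 * hu1 * x 0 -
            x 0 * g * hyc - x 0 * hg' * y 0 + x 0 * g * hyy * u * x 0
        have e' : M 0 0 * g' = g * N 0 0 := by
          calc M 0 0 * g' = g * (c * M 0 0) * g' := by rw [← mul_assoc, hg', one_mul]
            _ = g * N 0 0 * ((c - y 0 * u * x 0) * g') := by rw [← e]; simp only [mul_assoc]
            _ = _ := by rw [hgg, mul_one]
        rw [mul_assoc, key.2 h, ← mul_assoc, e', mul_assoc]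
    · intro i j
      rw [pivot_apply, pivot_apply, hNM, hNM, hNM]
      exact schur_schur hu1 hu2 hg' rfl hgg hgg' (hNM 0 0) hu1' hu2' hg _ _ _ _ _
    · intro i
      have := hv i.succ
      rw [Fin.sum_univ_succ, hh0] at this
      simp only [pivot_apply, sub_mul, Finset.sum_sub_distrib, mul_assoc, ← Finset.mul_sum]
      linear_combination (norm := noncomm_ring) this
    · have := hv'
      rw [Fin.sum_univ_succ, hh0] at this
      simp only [sub_mul, Finset.sum_sub_distrib, mul_assoc, ← Finset.mul_sum]
      linear_combination (norm := noncomm_ring) this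

end ManinDet

/-! ### Invertible matrices and Berezinians -/

section Invertible

variable {R : Type*} [Ring R] {T : Subring R} {t : R}

/-- Gaussian elimination: a matrix close to a scalar matrix has a right inverse. -/
theorem IsNear.exists_mulVec (ht : HasInverses T t) {n : ℕ} {M : Matrix (Fin n) (Fin n) R}
    (hM : IsNear T t M) (b : Fin n → R) : ∃ h : Fin n → R, ∀ a, ∑ j, M a j * h j = b a := by
  induction n with
  | zero => exact ⟨0, fun a => a.elim0⟩
  | succ n ih =>
    obtain ⟨u, hu, hu1, -⟩ := ht.exists_inv hM.zero
    obtain ⟨h, hh⟩ := ih (hM.pivot hu) fun i => b i.succ - M i.succ 0 * u * b 0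
    refine ⟨Fin.cons (u * (b 0 - ∑ j, M 0 j.succ * h j)) h, Fin.cases ?_ fun i => ?_⟩
    · rw [Fin.sum_univ_succ]
      simp only [Fin.cons_zero, Fin.cons_succ]
      linear_combination (norm := noncomm_ring) hu1 * (b 0 - ∑ j, M 0 j.succ * h j)
    · have := hh i
      simp only [pivot_apply, sub_mul, Finset.sum_sub_distrib, mul_assoc, ← Finset.mul_sum] at this
      rw [Fin.sum_univ_succ]
      simp only [Fin.cons_zero, Fin.cons_succ]
      linear_combination (norm := noncomm_ring) this

theorem IsNear.exists_vecMul (ht : HasInverses T t) {n : ℕ} {M : Matrix (Fin n) (Fin n) R}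
    (hM : IsNear T t M) (b : Fin n → R) : ∃ h : Fin n → R, ∀ a, ∑ j, h j * M j a = b a := by
  induction n with
  | zero => exact ⟨0, fun a => a.elim0⟩
  | succ n ih =>
    obtain ⟨u, hu, -, hu1⟩ := ht.exists_inv hM.zero
    obtain ⟨h, hh⟩ := ih (hM.pivot hu) fun i => b i.succ - b 0 * u * M 0 i.succ
    refine ⟨Fin.cons ((b 0 - ∑ j, h j * M j.succ 0) * u) h, Fin.cases ?_ fun i => ?_⟩
    · rw [Fin.sum_univ_succ]
      simp only [Fin.cons_zero, Fin.cons_succ]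
      linear_combination (norm := noncomm_ring) (b 0 - ∑ j, h j * M j.succ 0) * hu1
    · have := hh i
      simp only [pivot_apply, mul_sub, Finset.sum_sub_distrib, ← mul_assoc, ← Finset.sum_mul] at this
      rw [Fin.sum_univ_succ]
      simp only [Fin.cons_zero, Fin.cons_succ]
      linear_combination (norm := noncomm_ring) this

theorem IsNear.isUnit (ht : HasInverses T t) {n : ℕ} {M : Matrix (Fin n) (Fin n) R}
    (hM : IsNear T t M) : IsUnit M := by
  choose f hf using fun b : Fin n => hM.exists_mulVec ht fun a => (1 : Matrix _ _ R) a b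
  choose g hg using fun b : Fin n => hM.exists_vecMul ht fun a => (1 : Matrix _ _ R) b a
  have h1 : M * Matrix.of (fun j b => f b j) = 1 := by
    ext a b
    exact hf b a
  have h2 : Matrix.of g * M = 1 := by
    ext a b
    exact hg a b
  exact isUnit_iff_exists.2 ⟨_, h1, by rwa [← left_inv_eq_right_inv h2 h1]⟩

/-- The last entry of the inverse of a matrix is invertible if the leading block is: its inverse is
the Schur complement of that block. -/
theorem isUnit_last {n : ℕ} {N H : Matrix (Fin (n + 1)) (Fin (n + 1)) R} (h1 : N * H = 1)
    (h2 : H * N = 1) (hM : IsUnit (N.submatrix Fin.castSucc Fin.castSucc)) :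
    IsUnit (H (Fin.last n) (Fin.last n)) := by
  obtain ⟨A, hA1, hA2⟩ := isUnit_iff_exists.1 hM
  have e1 := fun a b => congrFun (congrFun h1 a) b
  have e2 := fun a b => congrFun (congrFun h2 a) b
  simp only [Matrix.mul_apply, Fin.sum_univ_castSucc] at e1 e2
  have hh : ∀ a, H a.castSucc (Fin.last n) =
      -∑ b, A a b * (N b.castSucc (Fin.last n) * H (Fin.last n) (Fin.last n)) := by
    intro a
    have := congrArg (fun M => (M.mulVec fun j => H j.castSucc (Fin.last n)) a) hA2
    simp only [← Matrix.mulVec_mulVec, Matrix.one_mulVec] at this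
    rw [← this, Matrix.mulVec, dotProduct, ← Finset.sum_neg_distrib]
    refine Finset.sum_congr rfl fun b _ => ?_
    have := e1 b.castSucc (Fin.last n)
    rw [Matrix.one_apply_ne (Fin.castSucc_lt_last b).ne] at this
    rw [← mul_neg, Matrix.mulVec, dotProduct]
    congr 1
    exact eq_neg_of_add_eq_zero_left this
  have hk : ∀ a, H (Fin.last n) a.castSucc =
      -∑ b, H (Fin.last n) (Fin.last n) * N (Fin.last n) b.castSucc * A b a := by
    intro a
    have := congrArg (fun M => (Matrix.vecMul (fun j => H (Fin.last n) j.castSucc) M) a) hA1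
    simp only [← Matrix.vecMul_vecMul, Matrix.vecMul_one] at this
    rw [← this, Matrix.vecMul, dotProduct, ← Finset.sum_neg_distrib]
    refine Finset.sum_congr rfl fun b _ => ?_
    have := e2 (Fin.last n) b.castSucc
    rw [Matrix.one_apply_ne (Fin.castSucc_lt_last b).ne'] at this
    rw [← neg_mul, Matrix.vecMul, dotProduct]
    congr 1
    exact eq_neg_of_add_eq_zero_left this
  refine isUnit_iff_exists.2 ⟨N (Fin.last n) (Fin.last n) -
    ∑ a, ∑ b, N (Fin.last n) a.castSucc * A a b * N b.castSucc (Fin.last n), ?_, ?_⟩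
  · have := e2 (Fin.last n) (Fin.last n)
    rw [Matrix.one_apply_eq] at this
    rw [mul_sub, ← this, sub_eq_add_neg, add_comm]
    congr 1
    simp only [hk, Finset.mul_sum, Finset.sum_mul, neg_mul, Finset.sum_neg_distrib, mul_assoc]
    rw [Finset.sum_comm]
  · have := e1 (Fin.last n) (Fin.last n)
    rw [Matrix.one_apply_eq] at this
    rw [sub_mul, ← this, sub_eq_add_neg, add_comm]
    congr 1
    simp only [hh, Finset.mul_sum, Finset.sum_mul, mul_neg, Finset.sum_neg_distrib, mul_assoc]

theorem IsNear.sufficientlyInvertible (ht : HasInverses T t) {n : ℕ} {M : Matrix (Fin n) (Fin n) R}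
    (hM : IsNear T t M) : SufficientlyInvertible M := fun i => by
  have hl : IsNear T t (leading M i) := hM.submatrix _ (Fin.castLE_injective _)
  have hu := hl.isUnit ht
  exact ⟨hu, isUnit_last (Ring.mul_inverse_cancel _ hu) (Ring.inverse_mul_cancel _ hu)
    ((hl.submatrix _ (Fin.castSucc_injective _)).isUnit ht)⟩

theorem map_ringInverse {A B : Type*} [Ring A] [Ring B] (f : A →+* B) {a : A} (ha : IsUnit a) :
    f (Ring.inverse a) = Ring.inverse (f a) := by
  refine (left_inv_eq_right_inv (Ring.inverse_mul_cancel _ (ha.map f)) ?_).symm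
  rw [← map_mul, Ring.mul_inverse_cancel _ ha, map_one]

theorem map_cornerInv {S : Type*} [Ring S] (f : R →+* S) {k : ℕ} {M : Matrix (Fin k) (Fin k) R}
    (hM : SufficientlyInvertible M) (i : Fin k) :
    cornerInv (M.map f) i = f (cornerInv M i) := by
  have := map_ringInverse f.mapMatrix (hM i).1
  exact (congrFun (congrFun this (Fin.last _)) (Fin.last _)).symm

theorem map_ber {S : Type*} [Ring S] (f : R →+* S) {k : ℕ} (par : Fin k → ZMod 2)
    {M : Matrix (Fin k) (Fin k) R} (hM : SufficientlyInvertible M) :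
    ber par (M.map f) = f (ber par M) := by
  rw [ber, ber, map_list_prod, List.map_ofFn]
  congr 2
  funext i
  have h1 := map_ringInverse f (hM i).2
  have h2 := map_ringInverse f (hM i).2.ringInverse
  simp only [quasiminor, map_cornerInv f hM, Function.comp_apply]
  rw [← h1, ← h2]
  split_ifs <;> rfl

/-- The last column of the inverse of a leading submatrix. -/
theorem leading_mul_inverse {k : ℕ} {M : Matrix (Fin k) (Fin k) R} {i : Fin k}
    (hM : IsUnit (leading M i)) :
    ∃ v : Fin k → R, v i = cornerInv M i ∧ (∀ j, i < j → v j = 0) ∧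
      ∀ j ≤ i, ∑ l, M j l * v l = if j = i then 1 else 0 := by
  have h := Ring.mul_inverse_cancel _ hM
  set A := Ring.inverse (leading M i) with hA
  let e : Fin (i + 1) ↪ Fin k := ⟨Fin.castLE i.isLt, Fin.castLE_injective _⟩
  refine ⟨fun j => if hj : (j : ℕ) < i + 1 then A ⟨j, hj⟩ (Fin.last _) else 0, ?_, ?_, ?_⟩
  · simp only [Nat.lt_succ_self, dif_pos]
    rfl
  · intro j hj
    have : (i : ℕ) < j := hj
    exact dif_neg (by omega)
  · intro j hj
    have hj' : (j : ℕ) < i + 1 := Nat.lt_succ_of_le hj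
    have h1 := congrFun (congrFun h ⟨j, hj'⟩) (Fin.last _)
    rw [Matrix.mul_apply, Matrix.one_apply] at h1
    have hs : ∑ l, M j l * (if hl : (l : ℕ) < i + 1 then A ⟨l, hl⟩ (Fin.last _) else 0) =
        ∑ l ∈ Finset.univ.map e,
          M j l * (if hl : (l : ℕ) < i + 1 then A ⟨l, hl⟩ (Fin.last _) else 0) := by
      refine (Finset.sum_subset (Finset.subset_univ _) fun l _ hl => ?_).symm
      rw [dif_neg, mul_zero]
      intro hl'
      exact hl (Finset.mem_map.2 ⟨⟨l, hl'⟩, Finset.mem_univ _, rfl⟩)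
    rw [hs, Finset.sum_map]
    have he : ∀ l : Fin (i + 1), ((e l : Fin k) : ℕ) = l := fun l => rfl
    have hif : (if j = i then (1 : R) else 0) =
        if (⟨j, hj'⟩ : Fin (i + 1)) = Fin.last _ then 1 else 0 := by
      refine if_congr ?_ rfl rfl
      rw [Fin.ext_iff, Fin.ext_iff, Fin.val_last]
    rw [hif, ← h1]
    refine Finset.sum_congr rfl fun l _ => ?_
    rw [dif_pos (by rw [he]; exact l.isLt)]
    rfl

/-- A telescoping product of the factors of the Berezinian. -/
theorem prod_telescope {n : ℕ} (G : ℕ → R) (β κ : Fin n → R)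
    (h : ∀ i : Fin n, G i * β i = κ i * G (i + 1)) :
    G 0 * (List.ofFn β).prod = (List.ofFn κ).prod * G n := by
  induction n generalizing G with
  | zero => simp
  | succ n ih =>
    rw [List.ofFn_succ, List.prod_cons, List.ofFn_succ, List.prod_cons, ← mul_assoc]
    have h0 := h 0
    simp only [Fin.val_zero, zero_add] at h0
    have := ih (fun k => G (k + 1)) (fun i => β i.succ) (fun i => κ i.succ) fun i => h i.succ
    simp only [zero_add] at this
    rw [h0, mul_assoc, this, mul_assoc]

end Invertible

/-! ### Manin matrices from oscillators -/

section Oscillators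

variable {R : Type*} [Ring R] [Algebra ℂ R] {d N : ℕ}

/-- Oscillators `X a r`, `Y a r` that commute up to the signs `ε r s`, except that the exchange of
`Y a r` with `X a s` produces `K s r`, together with an element `D` which acts on them as a
derivation does on a resolvent. -/
structure IsOscillator (ε : Fin N → Fin N → ℂ) (D : R) (X Y : Fin d → Fin N → R)
    (K : Matrix (Fin N) (Fin N) R) : Prop where
  symm : ∀ r s, ε r s = ε s r
  sq : ∀ r s, ε r s * ε r s = 1
  XX : ∀ a b r s, X a r * X b s = ε r s • (X b s * X a r)
  YY : ∀ a b r s, Y a r * Y b s = ε r s • (Y b s * Y a r)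
  YX : ∀ a b r s, Y b r * X a s = ε r s • (X a s * Y b r) + if a = b then K s r else 0
  KX : ∀ r s a t, K r s * X a t = X a t * K r s
  DX : ∀ a s, D * X a s - X a s * D = -∑ t, K s t * X a t
  DY : ∀ b r, D * Y b r = Y b r * D

/-- The matrix `δ_{ab} D - J_{ab} - ∑_r X_{ar} Y_{br}`, the sum over a finite set of indices. -/
def oscMatrix (D : R) (J : Matrix (Fin d) (Fin d) ℂ) (X Y : Fin d → Fin N → R)
    (s : Finset (Fin N)) : Matrix (Fin d) (Fin d) R :=
  Matrix.of fun a b => (if a = b then D else 0) - algebraMap ℂ R (J a b) - ∑ r ∈ s, X a r * Y b r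

theorem oscMatrix_apply (D : R) (J : Matrix (Fin d) (Fin d) ℂ) (X Y : Fin d → Fin N → R)
    (s : Finset (Fin N)) (a b : Fin d) : oscMatrix D J X Y s a b =
      (if a = b then D else 0) - algebraMap ℂ R (J a b) - ∑ r ∈ s, X a r * Y b r := rfl

variable {ε : Fin N → Fin N → ℂ} {D : R} {X Y : Fin d → Fin N → R} {K : Matrix (Fin N) (Fin N) R}
  {J : Matrix (Fin d) (Fin d) ℂ} {s : Finset (Fin N)}

theorem oscMatrix_comm (w : R) (a b : Fin d) :
    oscMatrix D J X Y s a b * w - w * oscMatrix D J X Y s a b =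
      (if a = b then D * w - w * D else 0) -
        ∑ r ∈ s, (X a r * Y b r * w - w * (X a r * Y b r)) := by
  rw [oscMatrix_apply, Finset.sum_sub_distrib, ← Finset.sum_mul, ← Finset.mul_sum]
  have := Algebra.commutes (J a b) w
  split_ifs <;> linear_combination (norm := noncomm_ring) -this

namespace IsOscillator

theorem comm_X (h : IsOscillator ε D X Y K) (a b k : Fin d) (t : Fin N) :
    oscMatrix D J X Y s a b * X k t - X k t * oscMatrix D J X Y s a b =
      -(if a = b then ∑ u, K t u * X k u else 0) -
        if k = b then ∑ u ∈ s, K t u * X a u else 0 := by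
  rw [oscMatrix_comm, h.DX]
  congr 1
  · split_ifs <;> simp
  · have : ∀ r, X a r * Y b r * X k t - X k t * (X a r * Y b r) =
        if k = b then K t r * X a r else 0 := by
      intro r
      rw [mul_assoc, h.YX, mul_add, mul_smul_comm, ← mul_assoc, h.XX a k r t, smul_mul_assoc,
        smul_smul, h.sq, one_smul, mul_assoc, add_sub_cancel_left, h.KX, mul_ite, mul_zero]
    simp only [this]
    split_ifs <;> simp

theorem comm_Y (h : IsOscillator ε D X Y K) (a b l : Fin d) (t : Fin N) :
    oscMatrix D J X Y s a b * Y l t - Y l t * oscMatrix D J X Y s a b =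
      if a = l then ∑ r ∈ s, K r t * Y b r else 0 := by
  rw [oscMatrix_comm, h.DY]
  have : ∀ r, X a r * Y b r * Y l t - Y l t * (X a r * Y b r) =
      -(if a = l then K r t * Y b r else 0) := by
    intro r
    rw [← mul_assoc (Y l t), h.YX, add_mul, mul_assoc, h.YY b l, mul_smul_comm, smul_mul_assoc,
      h.symm r t, mul_assoc, ite_mul, zero_mul]
    abel
  simp only [this, sub_self, ite_self, Finset.sum_neg_distrib, zero_sub, neg_neg]
  split_ifs <;> simp

theorem isManin (h : IsOscillator ε D X Y K) (hs : ∀ r ∈ s, ∀ t ∉ s, K r t = 0) :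
    IsManin (oscMatrix D J X Y s) := by
  have hK : ∀ r ∈ s, ∀ a, ∑ u, K r u * X a u = ∑ u ∈ s, K r u * X a u := fun r hr a =>
    (Finset.sum_subset (Finset.subset_univ s) fun u _ hu => by rw [hs r hr u hu, zero_mul]).symm
  set V : Fin d → Fin d → R := fun a b => ∑ r ∈ s, (∑ u ∈ s, K r u * X a u) * Y b r with hV
  have key : ∀ a b k l, oscMatrix D J X Y s a b * oscMatrix D J X Y s k l -
      oscMatrix D J X Y s k l * oscMatrix D J X Y s a b =
      (if a = b then V k l else 0) - (if k = l then V a b else 0) + (if k = b then V a l else 0) -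
        if a = l then V k b else 0 := by
    intro a b k l
    have hD : oscMatrix D J X Y s a b * D - D * oscMatrix D J X Y s a b = -V a b := by
      rw [oscMatrix_comm, sub_self, ite_self, zero_sub, hV]
      congr 1
      refine Finset.sum_congr rfl fun r hr => ?_
      rw [← hK r hr, mul_assoc, ← h.DY]
      linear_combination (norm := noncomm_ring) -h.DX a r * Y b r
    have hXY : ∀ r ∈ s, oscMatrix D J X Y s a b * (X k r * Y l r) -
        X k r * Y l r * oscMatrix D J X Y s a b =
        -(if a = b then (∑ u ∈ s, K r u * X k u) * Y l r else 0) -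
          (if k = b then (∑ u ∈ s, K r u * X a u) * Y l r else 0) +
          if a = l then ∑ t ∈ s, K t r * X k r * Y b t else 0 := by
      intro r hr
      have h1 := h.comm_X (J := J) (s := s) a b k r
      have h2 := h.comm_Y (J := J) (s := s) a b l r
      rw [hK r hr] at h1
      have h3 : X k r * (if a = l then ∑ r_1 ∈ s, K r_1 r * Y b r_1 else 0) =
          if a = l then ∑ t ∈ s, K t r * X k r * Y b t else 0 := by
        rw [mul_ite, mul_zero, Finset.mul_sum]
        simp only [← mul_assoc, h.KX]
      rw [← h3, ← h2, ← zero_mul (Y l r), ← ite_mul, ← ite_mul, ← neg_mul, ← sub_mul, ← h1]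
      noncomm_ring
    have hV' : ∑ r ∈ s, ∑ t ∈ s, K t r * X k r * Y b t = V k b := by
      rw [Finset.sum_comm]
      simp only [hV, Finset.sum_mul]
    conv_lhs => rw [oscMatrix_apply D J X Y s k l]
    have hJ := Algebra.commutes (J k l) (oscMatrix D J X Y s a b)
    have hS : oscMatrix D J X Y s a b * (∑ r ∈ s, X k r * Y l r) -
        (∑ r ∈ s, X k r * Y l r) * oscMatrix D J X Y s a b =
        -(if a = b then V k l else 0) - (if k = b then V a l else 0) +
          if a = l then V k b else 0 := by
      rw [Finset.mul_sum, Finset.sum_mul, ← Finset.sum_sub_distrib, Finset.sum_congr rfl hXY,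
        Finset.sum_add_distrib, Finset.sum_sub_distrib, Finset.sum_neg_distrib, ← hV']
      congr 1
      · congr 1
        · split_ifs <;> simp [hV]
        · split_ifs <;> simp [hV]
      · split_ifs <;> simp
    have hDD : oscMatrix D J X Y s a b * (if k = l then D else 0) -
        (if k = l then D else 0) * oscMatrix D J X Y s a b = -(if k = l then V a b else 0) := by
      split_ifs
      · exact hD
      · simp
    linear_combination (norm := noncomm_ring) hJ - hS + hDD
  intro a k b l
  linear_combination (norm := abel) key a b k l - key k b a l

end IsOscillator

/-- Adding one more index to an oscillator matrix is a Schur complement: the bordered matrix with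
last column `X_i c`, last row `Y_i` and corner `c` is super Manin. -/
theorem IsOscillator.isSuperManin (h : IsOscillator ε D X Y K) {i : Fin N} {c : R} {σ : ℤ}
    (hσ : (σ : ℂ) = ε i i) (hs : ∀ r ∈ s, ∀ t ∉ s, K r t = 0) (hi : i ∉ s)
    (hKi : ∀ t ∉ s, t ≠ i → K i t = 0) (hc : K i i * c = -1)
    (hXc : ∀ a r, X a r * c = c * X a r) (hYc : ∀ a r, Y a r * c = c * Y a r)
    (hDc : D * c - c * D = -1) :
    IsSuperManin σ (oscMatrix D J X Y s) (fun a => X a i * c) (fun b => Y b i) c := by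
  have hMc : ∀ a b, oscMatrix D J X Y s a b * c - c * oscMatrix D J X Y s a b =
      if a = b then -1 else 0 := by
    intro a b
    rw [oscMatrix_comm, hDc, Finset.sum_eq_zero, sub_zero]
    intro r _
    linear_combination (norm := noncomm_ring) X a r * hYc b r + hXc a r * Y b r
  have hY : ∀ a b l, oscMatrix D J X Y s a b * Y l i - Y l i * oscMatrix D J X Y s a b = 0 := by
    intro a b l
    rw [h.comm_Y, Finset.sum_eq_zero fun r hr => by rw [hs r hr i hi, zero_mul], ite_self]
  have hX : ∀ a b k, oscMatrix D J X Y s a b * (X k i * c) - X k i * c * oscMatrix D J X Y s a b =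
      -(if a = b then (∑ u ∈ s, K i u * X k u) * c else 0) -
        if k = b then (∑ u ∈ s, K i u * X a u) * c else 0 := by
    intro a b k
    have h1 := h.comm_X (J := J) (s := s) a b k i
    have h2 := hMc a b
    have h3 : ∑ u, K i u * X k u = ∑ u ∈ s, K i u * X k u + K i i * X k i := by
      rw [add_comm, ← Finset.sum_insert hi (f := fun u => K i u * X k u)]
      refine (Finset.sum_subset (Finset.subset_univ _) fun u _ hu => ?_).symm
      rw [Finset.mem_insert, not_or] at hu
      rw [hKi u hu.2 hu.1, zero_mul]
    rw [h3] at h1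
    have h4 : K i i * X k i * c = - X k i := by rw [h.KX, mul_assoc, hc, mul_neg, mul_one]
    have e : ∀ (p : Prop) [Decidable p] (x y : R), (if p then x else 0) * y =
      if p then x * y else 0 := fun p _ x y => by rw [ite_mul, zero_mul]
    rw [← e, ← e]
    by_cases hab : a = b
    · simp only [hab, if_true] at h1 h2 ⊢
      linear_combination (norm := noncomm_ring) h1 * c + X k i * h2 - h4
    · simp only [hab, if_false] at h1 h2 ⊢
      linear_combination (norm := noncomm_ring) h1 * c + X k i * h2
  have hsgn : ∀ w : R, σ • w = ε i i • w := fun w => by rw [← hσ, Int.cast_smul_eq_zsmul]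
  have hε : ∀ k : ℤ, σ = k → ∀ w : R, ε i i • w = k • w := fun k hk w => by rw [← hsgn, hk]
  constructor
  · exact h.isManin hs
  · intro a k b
    linear_combination (norm := abel) hX a b k - hX k b a
  · intro a b l
    linear_combination (norm := abel) hY a b l + hY a l b
  · intro a b
    rw [hMc, hsgn, ← mul_assoc, h.YX, add_mul, smul_mul_assoc, mul_assoc, mul_assoc, hYc]
    split_ifs
    · rw [hc]; abel
    · simp
  · intro h1 a k
    have := h.XX a k i i
    rw [hε 1 h1, one_smul] at this
    linear_combination (norm := noncomm_ring) this * c * c - X a i * hXc k i * c +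
      X k i * hXc a i * c
  · intro _ a
    rw [hXc, mul_assoc, hXc]
  · intro h1 b l
    rw [h.YY, hε (-1) h1, neg_one_smul]
  · intro _ b
    exact hYc b i

end Oscillators

/-! ### Normal ordering of column determinants -/

section NormalOrdering

variable {R : Type*} [Ring R] [Algebra ℂ R] {d N : ℕ}

/-- The operators `w ↦ δ_{ab} w D - J_{ab} w - ∑_r X_{ar} w Y_{br}`. They enclose a normally
ordered product `w` between a factor `X` on the left and a factor `Y` or `D` on the right, so that
products of them, applied to `1`, are the normally ordered products of entries of `oscMatrix`. -/
def insertion (D : R) (J : Matrix (Fin d) (Fin d) ℂ) (X Y : Fin d → Fin N → R) :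
    Matrix (Fin d) (Fin d) (Module.End ℤ R) :=
  Matrix.of fun a b => (if a = b then LinearMap.mulRight ℤ D else 0) -
    LinearMap.mulLeft ℤ (algebraMap ℂ R (J a b)) -
      ∑ r, LinearMap.mulLeft ℤ (X a r) * LinearMap.mulRight ℤ (Y b r)

theorem insertion_apply (D : R) (J : Matrix (Fin d) (Fin d) ℂ) (X Y : Fin d → Fin N → R)
    (a b : Fin d) (w : R) : insertion D J X Y a b w =
      (if a = b then w * D else 0) - algebraMap ℂ R (J a b) * w - ∑ r, X a r * (w * Y b r) := by
  rw [insertion, Matrix.of_apply, LinearMap.sub_apply, LinearMap.sub_apply, LinearMap.sum_apply]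
  split_ifs <;> rfl

variable {ε : Fin N → Fin N → ℂ} {D : R} {X Y : Fin d → Fin N → R} {K : Matrix (Fin N) (Fin N) R}
  {J : Matrix (Fin d) (Fin d) ℂ}

theorem IsOscillator.insertion_comm (h : IsOscillator ε D X Y K) (a b a' b' : Fin d) :
    insertion D J X Y a b * insertion D J X Y a' b' =
      insertion D J X Y a' b' * insertion D J X Y a b := by
  ext w
  rw [Module.End.mul_apply, Module.End.mul_apply]
  have hD : ∀ b w, (∑ r, X a r * (w * Y b r)) * D = ∑ r, X a r * (w * D * Y b r) := by
    intro b w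
    rw [Finset.sum_mul]
    refine Finset.sum_congr rfl fun r _ => ?_
    linear_combination (norm := noncomm_ring) -X a r * w * h.DY b r
  have hD' : ∀ b w, (∑ r, X a' r * (w * Y b r)) * D = ∑ r, X a' r * (w * D * Y b r) := by
    intro b w
    rw [Finset.sum_mul]
    refine Finset.sum_congr rfl fun r _ => ?_
    linear_combination (norm := noncomm_ring) -X a' r * w * h.DY b r
  have hJ : ∀ (j : ℂ) (a b : Fin d) (w : R), ∑ r, X a r * (algebraMap ℂ R j * w * Y b r) =
      algebraMap ℂ R j * ∑ r, X a r * (w * Y b r) := by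
    intro j a b w
    rw [Finset.mul_sum]
    refine Finset.sum_congr rfl fun r _ => ?_
    rw [← mul_assoc, ← mul_assoc, ← Algebra.commutes]
    noncomm_ring
  have hXY : ∑ r, X a r * ((∑ s, X a' s * (w * Y b' s)) * Y b r) =
      ∑ s, X a' s * ((∑ r, X a r * (w * Y b r)) * Y b' s) := by
    simp only [Finset.mul_sum, Finset.sum_mul]
    rw [Finset.sum_comm]
    refine Finset.sum_congr rfl fun s _ => Finset.sum_congr rfl fun r _ => ?_
    calc X a r * (X a' s * (w * Y b' s) * Y b r) = X a r * X a' s * w * (Y b' s * Y b r) := by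
          noncomm_ring
      _ = _ := by
        rw [h.XX, h.YY b' b, h.symm s r, mul_smul_comm, smul_mul_assoc, smul_mul_assoc, smul_smul,
          h.sq, one_smul]
        noncomm_ring
  have hJJ := Algebra.commutes (J a b) (algebraMap ℂ R (J a' b'))
  simp only [insertion_apply, sub_mul, mul_sub, Finset.sum_sub_distrib, hJ, hXY]
  by_cases h1 : a = b <;> by_cases h2 : a' = b' <;>
    simp only [h1, h2, if_true, if_false] at hD hD' hJJ ⊢ <;>
    simp only [hD, hD', mul_zero, zero_mul, Finset.sum_const_zero] <;>
    linear_combination (norm := noncomm_ring) hJJ * w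

/-- The column determinant of an oscillator matrix is its normally ordered version: moving all `X`
to the left and all `Y` to the right does not change the determinant, because the correction terms
cancel by symmetry. -/
theorem IsOscillator.cdet_eq_insertion (h : IsOscillator ε D X Y K) :
    cdet (oscMatrix D J X Y Finset.univ) = cdet (insertion D J X Y) 1 := by
  set M := oscMatrix D J X Y Finset.univ with hM
  set Φ := insertion D J X Y with hΦ
  let l : R →+* Module.End ℤ R := (Algebra.lmul ℤ R).toRingHom
  have hl : ∀ x y : R, l x y = x * y := fun x y => rfl
  let ev : Module.End ℤ R →+ R := AddMonoidHom.mk' (fun f => f 1) fun _ _ => rfl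
  have key := ev_cdet_add ev (fun s t ht => by
      change s (t 1) = 0
      rw [show t 1 = 0 from ht, map_zero]) Φ (Matrix.of fun a b => l (M a b) - Φ a b) ?_ ?_
  · have e : Φ + Matrix.of (fun a b => l (M a b) - Φ a b) = M.map l := by
      ext a b
      simp
    rw [e, map_cdet] at key
    refine Eq.trans ?_ key
    exact (mul_one _).symm
  · intro a b
    change (l (M a b) - Φ a b) 1 = 0
    rw [LinearMap.sub_apply, hl, hΦ, insertion_apply, hM, oscMatrix_apply]
    simp
  · have hC : ∀ a b k c, (l (M a b) - Φ a b) * Φ k c - Φ k c * (l (M a b) - Φ a b) =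
        l (M a b) * Φ k c - Φ k c * l (M a b) := by
      intro a b k c
      have := h.insertion_comm (J := J) a b k c
      linear_combination (norm := noncomm_ring) -this
    have hL : ∀ a b k c w, (l (M a b) * Φ k c - Φ k c * l (M a b)) w =
        ∑ t, ((if a = b then ∑ u, K t u * X k u else 0) +
          if k = b then ∑ u, K t u * X a u else 0) * (w * Y c t) := by
      intro a b k c w
      have e : ∀ t, ((if a = b then ∑ u, K t u * X k u else 0) +
          if k = b then ∑ u, K t u * X a u else 0) * (w * Y c t) =
          X k t * (M a b * w * Y c t) - M a b * (X k t * (w * Y c t)) := by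
        intro t
        have := h.comm_X (J := J) (s := Finset.univ) a b k t
        rw [← hM] at this
        linear_combination (norm := noncomm_ring) this * w * Y c t
      rw [Finset.sum_congr rfl fun t _ => e t, Finset.sum_sub_distrib, ← Finset.mul_sum,
        LinearMap.sub_apply, Module.End.mul_apply, Module.End.mul_apply, hl, hl, hΦ,
        insertion_apply, insertion_apply]
      have := Algebra.commutes (J k c) (M a b)
      split_ifs <;> linear_combination (norm := noncomm_ring) this * w
    intro a a' b c
    simp only [Matrix.of_apply, hC]
    ext w
    rw [hL, hL]
    refine Finset.sum_congr rfl fun t _ => ?_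
    rw [add_comm]

theorem reverse_ofFn {α : Type*} {n : ℕ} (f : Fin n → α) :
    (List.ofFn f).reverse = List.ofFn fun i => f i.rev := by
  refine List.ext_getElem (by simp) fun i h1 h2 => ?_
  simp only [List.getElem_reverse, List.getElem_ofFn, List.length_ofFn]
  congr 1
  ext
  simp only [Fin.val_rev]
  omega

/-- Passage to the opposite ring reverses the products in a column determinant, which is undone by
reversing the order of the rows and columns. -/
theorem cdet_op {R : Type*} [Ring R] {d : ℕ} (M : Matrix (Fin d) (Fin d) R) :
    cdet ((M.map MulOpposite.op).submatrix Fin.rev Fin.rev) = MulOpposite.op (cdet M) := by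
  rw [cdet, cdet, ← (Fin.revPerm.permCongr).sum_comp, ← MulOpposite.opAddEquiv_apply, map_sum]
  refine Finset.sum_congr rfl fun σ _ => ?_
  rw [Equiv.Perm.sign_permCongr, map_zsmul]
  congr 1
  rw [MulOpposite.opAddEquiv_apply, MulOpposite.op_list_prod, List.map_ofFn, reverse_ofFn]
  congr 2
  funext j
  simp

variable {R' : Type*} [Ring R'] [Algebra ℂ R'] {N' : ℕ} {ε' : Fin N' → Fin N' → ℂ} {D' : R'ᵐᵒᵖ}
  {X' Y' : Fin d → Fin N' → R'ᵐᵒᵖ} {K' : Matrix (Fin N') (Fin N') R'ᵐᵒᵖ}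

theorem IsOscillator.comp (h : IsOscillator ε D X Y K) (e : Fin d → Fin d)
    (he : Function.Injective e) :
    IsOscillator ε D (fun a => X (e a)) (fun a => Y (e a)) K where
  symm := h.symm
  sq := h.sq
  XX a b := h.XX (e a) (e b)
  YY a b := h.YY (e a) (e b)
  YX a b r s := by simpa only [he.eq_iff] using h.YX (e a) (e b) r s
  KX r s a := h.KX r s (e a)
  DX a := h.DX (e a)
  DY a := h.DY (e a)

/-- Two oscillator matrices, the second one in the opposite ring and with the transposed insertion
operators, have corresponding column determinants. -/
theorem IsOscillator.cdet_transfer (h : IsOscillator ε D X Y K) (h' : IsOscillator ε' D' X' Y' K')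
    {J' : Matrix (Fin d) (Fin d) ℂ} (τ : R ≃+ R') (h1 : τ 1 = 1) (M : Matrix (Fin d) (Fin d) R')
    (hM : M.map MulOpposite.op = oscMatrix D' J' X' Y' Finset.univ)
    (hτ : ∀ a b w, MulOpposite.op (τ (insertion D J X Y a b w)) =
      insertion D' J' X' Y' b a (MulOpposite.op (τ w))) :
    τ (cdet (oscMatrix D J X Y Finset.univ)) = cdet M := by
  let θ : R ≃ₗ[ℤ] R'ᵐᵒᵖ := (τ.trans MulOpposite.opAddEquiv).toIntLinearEquiv
  have hθ : ∀ w, θ w = MulOpposite.op (τ w) := fun w => rfl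
  let c : Module.End ℤ R →+* Module.End ℤ R'ᵐᵒᵖ := (θ.conjRingEquiv : _ ≃+* _)
  have hc : ∀ f w, c f (θ w) = θ (f w) := fun f w => by
    change θ (f (θ.symm (θ w))) = _
    rw [LinearEquiv.symm_apply_apply]
  have e1 : (insertion D J X Y).map c = (insertion D' J' X' Y').transpose := by
    ext a b x
    obtain ⟨w, rfl⟩ := θ.surjective x
    rw [Matrix.map_apply, hc, hθ, hτ, Matrix.transpose_apply, hθ]
  have hrev := h'.comp Fin.rev Fin.rev_injective
  have e2 : (M.map MulOpposite.op).submatrix Fin.rev Fin.rev =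
      oscMatrix D' (J'.submatrix Fin.rev Fin.rev) (fun a => X' a.rev) (fun a => Y' a.rev)
        Finset.univ := by
    rw [hM]
    ext a b
    simp only [Matrix.submatrix_apply, oscMatrix_apply, Fin.rev_inj]
  have e3 : insertion D' (J'.submatrix Fin.rev Fin.rev) (fun a => X' a.rev) (fun a => Y' a.rev) =
      (insertion D' J' X' Y').submatrix Fin.rev Fin.rev := by
    ext a b w
    simp only [Matrix.submatrix_apply, insertion_apply, Fin.rev_inj]
  have e4 := cdet_transpose_submatrix (insertion D' J' X' Y').transpose
    (fun a b a' b' => h'.insertion_comm b a b' a') Fin.revPerm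
  apply MulOpposite.op_injective
  rw [← cdet_op, e2, hrev.cdet_eq_insertion, e3, h.cdet_eq_insertion, ← hθ, ← hc, ← map_cdet, e1,
    hθ, h1, ← e4]
  rfl

end NormalOrdering

/-! ### Resolvents of Jordan matrices -/

section Resolvent

variable {B : Type*} [Ring B] [Algebra ℂ B] {k : ℕ} (c : Composition k)

/-- The resolvent `(t - J)⁻¹` of the Jordan matrix `J` with eigenvalues `z i`, expressed through
`ζ i = (t - z i)⁻¹`. -/
noncomputable def resolvent (ζ : Fin c.length → B) : Matrix (Fin k) (Fin k) B :=
  Matrix.of fun r r' => ∑ i, ∑ l ∈ Finset.range (c.blocksFun i), shiftC c i l r r' • ζ i ^ (l + 1)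

theorem resolvent_apply (ζ : Fin c.length → B) (r r' : Fin k) : resolvent c ζ r r' =
    ∑ i, ∑ l ∈ Finset.range (c.blocksFun i), shiftC c i l r r' • ζ i ^ (l + 1) := rfl

theorem shiftC_zero (i : Fin c.length) (r s : Fin k) :
    shiftC c i 0 r s = if c.index r = i then if r = s then 1 else 0 else 0 := by
  unfold shiftC IsShift
  rw [← ite_and]
  refine if_congr ⟨fun h => ⟨h.1, (Fin.ext (by simpa using h.2.2)).symm⟩, ?_⟩ rfl rfl
  rintro ⟨h, rfl⟩
  exact ⟨h, h, rfl⟩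

theorem shiftC_eq_zero_of_le (i : Fin c.length) {l : ℕ} (hl : c.blocksFun i ≤ l) (r s : Fin k) :
    shiftC c i l r s = 0 := if_neg (IsShift.zero c i l hl r s)

theorem jordan_eq (z : Fin c.length → ℂ) (r s : Fin k) :
    jordan c z r s = ∑ i, (shiftC c i 0 r s * z i + shiftC c i 1 r s) := by
  have h1 : ∀ i, shiftC c i 1 r s =
      if c.index r = i then if (s : ℕ) = r + 1 ∧ c.index r = c.index s then 1 else 0 else 0 := by
    intro i
    unfold shiftC IsShift
    rw [← ite_and]
    refine if_congr ⟨fun h => ⟨h.1, h.2.2, h.1.trans h.2.1.symm⟩, ?_⟩ rfl rfl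
    rintro ⟨h, h', h''⟩
    exact ⟨h, h'' ▸ h, h'⟩
  simp only [shiftC_zero, h1, Finset.sum_add_distrib, ite_mul, zero_mul, one_mul,
    Finset.sum_ite_eq, Finset.mem_univ, if_true, jordan]
  by_cases h : r = s
  · subst h
    rw [if_pos rfl, if_pos rfl, if_neg (by omega), add_zero]
  · rw [if_neg h, if_neg h, zero_add]

theorem jordan_eq_zero (z : Fin c.length → ℂ) {r s : Fin k} (h : s < r) : jordan c z r s = 0 := by
  have : (s : ℕ) < r := h
  rw [jordan, if_neg h.ne', if_neg]
  omega

variable {c} {t : B} {z : Fin c.length → ℂ} {ζ : Fin c.length → B}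

theorem shiftC_smul_eq_zero (b : B) {i : Fin c.length} {l : ℕ} {r s : Fin k}
    (h : ¬ (c.index r = c.index s ∧ r ≤ s)) : shiftC c i l r s • b = 0 := by
  rw [shiftC, if_neg, zero_smul]
  rintro ⟨h1, h2, h3⟩
  exact h ⟨h1.trans h2.symm, by rw [Fin.le_def]; omega⟩

theorem resolvent_eq_zero {r s : Fin k} (h : ¬ (c.index r = c.index s ∧ r ≤ s)) :
    resolvent c ζ r s = 0 := by
  rw [resolvent_apply]
  exact Finset.sum_eq_zero fun _ _ => Finset.sum_eq_zero fun _ _ => shiftC_smul_eq_zero _ h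

theorem resolvent_diag (r : Fin k) : resolvent c ζ r r = ζ (c.index r) := by
  rw [resolvent_apply, Finset.sum_eq_single (c.index r)]
  · rw [Finset.sum_eq_single 0]
    · simp [shiftC_zero]
    · intro l _ hl
      rw [shiftC, if_neg, zero_smul]
      rintro ⟨-, -, h⟩
      omega
    · intro h
      exact absurd (c.blocks_pos (c.blocksFun_mem_blocks _)) (by simpa using h)
  · intro i _ hi
    refine Finset.sum_eq_zero fun l _ => ?_
    rw [shiftC, if_neg, zero_smul]
    rintro ⟨h, -⟩
    exact hi h.symm
  · simp

/-- The matrix `t - J`. -/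
noncomputable def subJordan (c : Composition k) (t : B) (z : Fin c.length → ℂ) :
    Matrix (Fin k) (Fin k) B :=
  Matrix.of fun r s => (if r = s then t else 0) - algebraMap ℂ B (jordan c z r s)

theorem subJordan_apply (r s : Fin k) : subJordan c t z r s =
    (if r = s then t else 0) - algebraMap ℂ B (jordan c z r s) := rfl

theorem subJordan_eq (r s : Fin k) : subJordan c t z r s =
    ∑ i, (shiftC c i 0 r s • (t - algebraMap ℂ B (z i)) - shiftC c i 1 r s • 1) := by
  have h : ∑ i, shiftC c i 0 r s • t = if r = s then t else 0 := by
    simp [shiftC_zero]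
  rw [subJordan_apply, jordan_eq, map_sum, ← h, ← Finset.sum_sub_distrib]
  refine Finset.sum_congr rfl fun i _ => ?_
  rw [map_add, map_mul, smul_sub, ← Algebra.smul_def, ← Algebra.algebraMap_eq_smul_one, sub_sub]

theorem sum_sum_mul {B : Type*} [Ring B] {ι κ : Type*} [Fintype κ] (I : Finset ι) (f : ι → κ → B)
    (g : κ → B) :
    ∑ s, (∑ i ∈ I, f i s) * g s = ∑ i ∈ I, ∑ s, f i s * g s := by
  simp only [Finset.sum_mul]
  exact Finset.sum_comm

theorem sum_mul_sum {B : Type*} [Ring B] {ι κ : Type*} [Fintype κ] (I : Finset ι) (f : ι → κ → B)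
    (g : κ → B) :
    ∑ s, g s * ∑ i ∈ I, f i s = ∑ i ∈ I, ∑ s, g s * f i s := by
  simp only [Finset.mul_sum]
  exact Finset.sum_comm

/-- The product of two matrices that are polynomial in the nilpotent shifts. -/
theorem sum_shiftC_mul (i j : Fin c.length) (l l' : ℕ) (r r' : Fin k) (a b : B) :
    ∑ s, (shiftC c i l r s • a) * (shiftC c j l' s r' • b) =
      if i = j then shiftC c i (l + l') r r' • (a * b) else 0 := by
  simp only [smul_mul_smul_comm, ← Finset.sum_smul, shiftC_mul]
  split_ifs <;> simp

theorem sum_telescope (ζ : Fin c.length → B) (r r' : Fin k) :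
    ∑ i, ∑ l ∈ Finset.range (c.blocksFun i),
      (shiftC c i l r r' • ζ i ^ l - shiftC c i (l + 1) r r' • ζ i ^ (l + 1)) =
      if r = r' then 1 else 0 := by
  have : ∀ i, ∑ l ∈ Finset.range (c.blocksFun i),
      (shiftC c i l r r' • ζ i ^ l - shiftC c i (l + 1) r r' • ζ i ^ (l + 1)) =
      shiftC c i 0 r r' • 1 := by
    intro i
    rw [Finset.sum_range_sub' (fun l => shiftC c i l r r' • ζ i ^ l),
      shiftC_eq_zero_of_le c i le_rfl, pow_zero, zero_smul, sub_zero]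
  simp only [this, ← Finset.sum_smul, shiftC_zero]
  split_ifs <;> simp

theorem resolvent_mul_subJordan (hζ : ∀ i, ζ i * (t - algebraMap ℂ B (z i)) = 1) :
    resolvent c ζ * subJordan c t z = 1 := by
  ext r r'
  rw [Matrix.mul_apply, Matrix.one_apply, ← sum_telescope ζ]
  simp only [resolvent_apply, sum_sum_mul]
  refine Finset.sum_congr rfl fun i _ => Finset.sum_congr rfl fun l _ => ?_
  simp only [subJordan_eq, sum_mul_sum]
  simp only [mul_sub, Finset.sum_sub_distrib, sum_shiftC_mul, Finset.sum_ite_eq, Finset.mem_univ,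
    if_true, mul_one, add_zero]
  rw [← mul_sub, pow_succ, mul_assoc, hζ, mul_one]

theorem subJordan_mul_resolvent (hζ : ∀ i, (t - algebraMap ℂ B (z i)) * ζ i = 1) :
    subJordan c t z * resolvent c ζ = 1 := by
  ext r r'
  rw [Matrix.mul_apply, Matrix.one_apply, ← sum_telescope ζ]
  simp only [resolvent_apply, sum_mul_sum]
  refine Finset.sum_congr rfl fun i _ => Finset.sum_congr rfl fun l _ => ?_
  simp only [subJordan_eq, sum_sum_mul]
  simp only [sub_mul, Finset.sum_sub_distrib, sum_shiftC_mul, Finset.sum_ite_eq', Finset.mem_univ,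
    if_true, one_mul, zero_add, add_comm 1 l]
  rw [← sub_mul, pow_succ', ← mul_assoc, hζ, one_mul]

/-- The commutator of the resolvent with an element that has constant commutator with `t`. -/
theorem resolvent_comm (hζ : ∀ i, ζ i * (t - algebraMap ℂ B (z i)) = 1)
    (hζ' : ∀ i, (t - algebraMap ℂ B (z i)) * ζ i = 1) {y : B} {κ : ℤ} (hy : y * t - t * y = κ)
    (r s : Fin k) : y * resolvent c ζ r s - resolvent c ζ r s * y =
      -(κ * ∑ u, resolvent c ζ r u * resolvent c ζ u s) := by
  set K := resolvent c ζ
  set T := subJordan c t z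
  have h1 : K * T = 1 := resolvent_mul_subJordan hζ
  have h2 : T * K = 1 := subJordan_mul_resolvent hζ'
  let Y : Matrix (Fin k) (Fin k) B := Matrix.diagonal fun _ => y
  have h3 : Y * T - T * Y = Matrix.diagonal fun _ => (κ : B) := by
    ext a b
    rw [Matrix.sub_apply, Matrix.diagonal_mul, Matrix.mul_diagonal, Matrix.diagonal_apply,
      show T a b = _ from subJordan_apply a b]
    have := Algebra.commutes (jordan c z a b) y
    split_ifs
    · linear_combination (norm := noncomm_ring) hy + this
    · linear_combination (norm := noncomm_ring) this
  have h4 : Y * K - K * Y = -(K * (Matrix.diagonal fun _ => (κ : B)) * K) := by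
    linear_combination (norm := noncomm_ring) -K * h3 * K - h1 * Y * K + K * Y * h2
  have h5 := congrFun (congrFun h4 r) s
  rw [Matrix.sub_apply, Matrix.neg_apply, Matrix.diagonal_mul, Matrix.mul_diagonal,
    Matrix.mul_apply] at h5
  rw [h5, Finset.mul_sum]
  congr 1
  refine Finset.sum_congr rfl fun u _ => ?_
  rw [Matrix.mul_diagonal, ← mul_assoc, Int.cast_comm]

theorem resolvent_comm_of_comm (hζ : ∀ i, ζ i * (t - algebraMap ℂ B (z i)) = 1)
    (hζ' : ∀ i, (t - algebraMap ℂ B (z i)) * ζ i = 1) {y : B} (hy : y * t = t * y)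
    (r s : Fin k) : y * resolvent c ζ r s = resolvent c ζ r s * y := by
  have := resolvent_comm (κ := 0) hζ hζ' (y := y) (by rw [hy, sub_self, Int.cast_zero]) r s
  rw [Int.cast_zero, zero_mul, neg_zero] at this
  exact sub_eq_zero.1 this

theorem resolvent_comm_resolvent (hζ : ∀ i, ζ i * (t - algebraMap ℂ B (z i)) = 1)
    (hζ' : ∀ i, (t - algebraMap ℂ B (z i)) * ζ i = 1) (r s r' s' : Fin k) :
    resolvent c ζ r s * resolvent c ζ r' s' = resolvent c ζ r' s' * resolvent c ζ r s :=
  resolvent_comm_of_comm hζ hζ' (resolvent_comm_of_comm hζ hζ' rfl r s).symm r' s'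

end Resolvent

/-! ### The oscillators of the duality -/

section Weyl

/-- Free oscillators `A`, `A'` become oscillators in the sense of `IsOscillator` when `A` is
multiplied by a matrix `G` with commuting entries that behaves like a resolvent under `D`, up to the
sign `θ` of the commutator of `A'` with `A`. -/
theorem IsOscillator.of_resolvent {B : Type*} [Ring B] [Algebra ℂ B] {d N : ℕ}
    {ε : Fin N → Fin N → ℂ} {D : B} {A A' : Fin d → Fin N → B} {G : Matrix (Fin N) (Fin N) B}
    {θ : ℤ} (symm : ∀ r s, ε r s = ε s r) (sq : ∀ r s, ε r s * ε r s = 1)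
    (AA : ∀ a b r s, A a r * A b s = ε r s • (A b s * A a r))
    (AA' : ∀ a b r s, A' a r * A' b s = ε r s • (A' b s * A' a r))
    (A'A : ∀ a b r s, A' b r * A a s =
      ε r s • (A a s * A' b r) + if a = b ∧ r = s then (θ : B) else 0)
    (GA : ∀ r s a t, G r s * A a t = A a t * G r s)
    (GA' : ∀ r s a t, G r s * A' a t = A' a t * G r s)
    (GG : ∀ r s r' s', G r s * G r' s' = G r' s' * G r s)
    (hG : ∀ r s, G r s ≠ 0 → ∀ t, ε r t = ε s t)
    (DA : ∀ a r, D * A a r = A a r * D) (DA' : ∀ a r, D * A' a r = A' a r * D)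
    (DG : ∀ r s, D * G r s - G r s * D = -(θ * ∑ u, G r u * G u s)) :
    IsOscillator ε D (fun a s => ∑ r, A a r * G r s) A'
      (Matrix.of fun s r => (θ : B) * G r s) where
  symm := symm
  sq := sq
  YY := AA'
  DY := DA'
  XX a b r s := by
    rw [Finset.sum_mul_sum, Finset.sum_mul_sum, Finset.sum_comm, Finset.smul_sum]
    refine Finset.sum_congr rfl fun v _ => ?_
    rw [Finset.smul_sum]
    refine Finset.sum_congr rfl fun u _ => ?_
    by_cases h1 : G u r = 0
    · simp [h1]
    by_cases h2 : G v s = 0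
    · simp [h2]
    have e : ε r s = ε u v := by
      rw [← hG u r h1, symm u s, ← hG v s h2, symm]
    calc A a u * G u r * (A b v * G v s) = A a u * A b v * (G u r * G v s) := by
          linear_combination (norm := noncomm_ring) A a u * GA u r b v * G v s
      _ = ε r s • (A b v * A a u * (G v s * G u r)) := by
          rw [AA, smul_mul_assoc, GG u r v s, e]
      _ = _ := by
          congr 1
          linear_combination (norm := noncomm_ring) -A b v * GA v s a u * G u r
  YX a b r s := by
    rw [Finset.mul_sum, Finset.sum_mul, Finset.smul_sum]
    have h : ∀ u, A' b r * (A a u * G u s) = ε r s • (A a u * G u s * A' b r) +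
        if u = r then (if a = b then (θ : B) * G u s else 0) else 0 := by
      intro u
      by_cases h1 : G u s = 0
      · simp [h1]
      rw [← mul_assoc, A'A, add_mul, smul_mul_assoc, mul_assoc, ← GA', ← mul_assoc,
        symm r u, hG u s h1, symm s r]
      congr 1
      by_cases h2 : a = b
      · rcases eq_or_ne u r with rfl | h3
        · simp [h2]
        · simp [h2, h3, h3.symm]
      · simp [h2]
    rw [Finset.sum_congr rfl fun u _ => h u, Finset.sum_add_distrib, Finset.sum_ite_eq',
      if_pos (Finset.mem_univ _)]
    rfl
  KX r s a t := by
    rw [Matrix.of_apply, Finset.mul_sum, Finset.sum_mul]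
    refine Finset.sum_congr rfl fun u _ => ?_
    have := Int.cast_comm θ (A a u * G u t)
    linear_combination (norm := noncomm_ring) θ * GA s r a u * G u t + θ * A a u * GG s r u t +
      this * G s r
  DX a s := by
    rw [Finset.mul_sum, Finset.sum_mul, ← Finset.sum_sub_distrib, ← Finset.sum_neg_distrib]
    have h : ∀ u, D * (A a u * G u s) - A a u * G u s * D =
        -∑ t, θ * G t s * (A a u * G u t) := by
      intro u
      have h1 : ∀ t, θ * G t s * (A a u * G u t) = A a u * (θ * (G u t * G t s)) := by
        intro t
        have := Int.cast_comm θ (A a u)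
        linear_combination (norm := noncomm_ring) θ * GA t s a u * G u t +
          θ * A a u * GG t s u t + this * G u t * G t s
      rw [Finset.sum_congr rfl fun t _ => h1 t, ← Finset.mul_sum, ← Finset.mul_sum, ← mul_neg,
        ← DG]
      linear_combination (norm := noncomm_ring) DA a u * G u s
    rw [Finset.sum_congr rfl fun u _ => h u, Finset.sum_neg_distrib, Finset.sum_neg_distrib,
      Finset.sum_comm]
    simp only [Matrix.of_apply, Finset.mul_sum]

/-- A pair of conjugate elements `z` and `∂`, and families `L`, `R` commuting with this pair which
satisfy the relations of a Weyl superalgebra, with `L a r` and `R a r` conjugate of parity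
`par r`. -/
structure IsWeylSystem {B : Type*} [Ring B] [Algebra ℂ B] {d N : ℕ} (par : Fin N → ZMod 2)
    (Z D : B) (L R : Fin d → Fin N → B) : Prop where
  DZ : D * Z - Z * D = 1
  LL : ∀ a b r s, L a r * L b s = sgn (par r * par s) • (L b s * L a r)
  RR : ∀ a b r s, R a r * R b s = sgn (par r * par s) • (R b s * R a r)
  RL : ∀ a b r s, R b r * L a s =
    sgn (par r * par s) • (L a s * R b r) + if a = b ∧ r = s then 1 else 0
  ZL : ∀ a r, Z * L a r = L a r * Z
  ZR : ∀ a r, Z * R a r = R a r * Z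
  DL : ∀ a r, D * L a r = L a r * D
  DR : ∀ a r, D * R a r = R a r * D

/-- The elements `ζ i` are the inverses of `t - z i`. -/
structure IsShiftInverse {B : Type*} [Ring B] [Algebra ℂ B] {l : ℕ} (t : B) (z : Fin l → ℂ)
    (ζ : Fin l → B) : Prop where
  left : ∀ i, ζ i * (t - algebraMap ℂ B (z i)) = 1
  right : ∀ i, (t - algebraMap ℂ B (z i)) * ζ i = 1

theorem IsShiftInverse.comm {B : Type*} [Ring B] [Algebra ℂ B] {l : ℕ} {t : B} {z : Fin l → ℂ}
    {ζ : Fin l → B} (h : IsShiftInverse t z ζ) {y : B} (hy : y * t = t * y) (i : Fin l) :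
    y * ζ i = ζ i * y := by
  have := Algebra.commutes (z i) y
  linear_combination (norm := noncomm_ring) -(ζ i * this * ζ i) - ζ i * hy * ζ i -
    h.left i * y * ζ i + ζ i * y * h.right i

variable {B : Type*} [Ring B] [Algebra ℂ B] {d N : ℕ} {par : Fin N → ZMod 2}
  {Z D : B} {L R : Fin d → Fin N → B} {γ : Composition N} {z : Fin γ.length → ℂ}
  {ζ η : Fin γ.length → B}

theorem sgn_par_eq {hγ : ∀ r s, γ.index r = γ.index s → par r = par s} {ζ : Fin γ.length → B}
    {r s : Fin N} (h : resolvent γ ζ r s ≠ 0) : par r = par s :=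
  hγ r s (by by_contra h'; exact h (resolvent_eq_zero fun hh => h' hh.1))

namespace IsWeylSystem

variable (L R γ) in
/-- The oscillators `∑_{r'} L_{ar'} K_{rr'}` for the resolvent `K` of a Jordan matrix. -/
noncomputable def xi (ζ : Fin γ.length → B) (a : Fin d) (s : Fin N) : B :=
  ∑ r, L a r * resolvent γ ζ s r

variable (R γ) in
/-- The oscillators `∑_{r'} R_{ar'} K_{r'r}` for the resolvent `K` of a Jordan matrix. -/
noncomputable def rho (η : Fin γ.length → B) (a : Fin d) (s : Fin N) : B :=
  ∑ r, R a r * resolvent γ η r s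

theorem LR (h : IsWeylSystem par Z D L R) (a b : Fin d) (r s : Fin N) : L b r * R a s =
    sgn (par r * par s) • (R a s * L b r) - if a = b ∧ r = s then algebraMap ℂ B (sgn (par r))
      else 0 := by
  rw [h.RL b a s r, smul_add, smul_smul, mul_comm (par s), sgn_sq, one_smul]
  by_cases hh : a = b ∧ r = s
  · obtain ⟨rfl, rfl⟩ := hh
    simp [sgn_mul_self, Algebra.algebraMap_eq_smul_one]
  · rw [if_neg hh, if_neg (fun h' => hh ⟨h'.1.symm, h'.2.symm⟩)]
    simp

/-- The oscillators of the matrix `∂ - J - ∑ L_{ar'} K_{rr'}(z) R_{br}`. -/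
theorem oscillator_gl (h : IsWeylSystem par Z D L R)
    (hγ : ∀ r s, γ.index r = γ.index s → par r = par s) (hζ : IsShiftInverse Z z ζ) :
    IsOscillator (fun r s => sgn (par r * par s)) D (xi L γ ζ) R (resolvent γ ζ) := by
  have := IsOscillator.of_resolvent (θ := 1) (ε := fun r s => sgn (par r * par s)) (D := D)
    (A := L) (A' := R) (G := (resolvent γ ζ).transpose) (fun r s => by rw [mul_comm])
    (fun r s => sgn_sq _) h.LL h.RR (fun a b r s => by rw [h.RL a b r s, Int.cast_one])
    (fun r s a t => (resolvent_comm_of_comm hζ.left hζ.right (h.ZL a t).symm _ _).symm)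
    (fun r s a t => (resolvent_comm_of_comm hζ.left hζ.right (h.ZR a t).symm _ _).symm)
    (fun r s r' s' => resolvent_comm_resolvent hζ.left hζ.right _ _ _ _)
    (fun r s hrs t => by rw [sgn_par_eq (hγ := hγ) hrs]) h.DL h.DR
    (fun r s => by
      simp only [Matrix.transpose_apply]
      rw [resolvent_comm (κ := 1) hζ.left hζ.right (by rw [h.DZ, Int.cast_one])]
      simp only [resolvent_comm_resolvent hζ.left hζ.right s])
  have e : (Matrix.of fun s r => ((1 : ℤ) : B) * (resolvent γ ζ).transpose r s) =
      resolvent γ ζ := by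
    ext r s
    simp
  rwa [e] at this

/-- The oscillators of the matrix `z - Jᵗ - ∑ ρ_{ar} (-1)^{|r|} L_{br}`. -/
theorem oscillator_super (h : IsWeylSystem par Z D L R)
    (hγ : ∀ r s, γ.index r = γ.index s → par r = par s) (hη : IsShiftInverse D z η) :
    IsOscillator (fun r s => sgn (par r * par s)) Z (rho R γ η) (fun b r => sgn (par r) • L b r)
      (-(resolvent γ η).transpose) := by
  have := IsOscillator.of_resolvent (θ := -1) (ε := fun r s => sgn (par r * par s)) (D := Z)
    (A := R) (A' := fun b r => sgn (par r) • L b r) (G := resolvent γ η)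
    (fun r s => by rw [mul_comm])
    (fun r s => sgn_sq _) h.RR
    (fun a b r s => by
      rw [smul_mul_smul_comm, smul_mul_smul_comm, h.LL, smul_smul, smul_smul]
      congr 1; ring)
    (fun a b r s => by
      rw [smul_mul_assoc, h.LR, smul_sub, mul_smul_comm, smul_smul, smul_smul, sub_eq_add_neg,
        mul_comm (sgn (par r))]
      congr 1
      by_cases hh : a = b ∧ r = s
      · rw [if_pos hh, if_pos hh, Algebra.algebraMap_eq_smul_one, smul_smul, sgn_sq]
        simp
      · simp [if_neg hh])
    (fun r s a t => (resolvent_comm_of_comm hη.left hη.right (h.DR a t).symm _ _).symm)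
    (fun r s a t => (resolvent_comm_of_comm hη.left hη.right (by
      rw [smul_mul_assoc, mul_smul_comm, h.DL]) _ _).symm)
    (fun r s r' s' => resolvent_comm_resolvent hη.left hη.right _ _ _ _)
    (fun r s hrs t => by rw [sgn_par_eq (hγ := hγ) hrs]) h.ZR
    (fun a r => by rw [smul_mul_assoc, mul_smul_comm, h.ZL])
    (fun r s => resolvent_comm (κ := -1) hη.left hη.right (by
      rw [← neg_sub, h.DZ]; simp) r s)
  have e : (Matrix.of fun s r => ((-1 : ℤ) : B) * resolvent γ η r s) =
      -(resolvent γ η).transpose := by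
    ext r s
    simp
  rwa [e] at this

/-- The oscillators, in the opposite ring, of the matrix `z - Jᵗ - ∑ L_{br} ρ_{ar}`. -/
theorem oscillator_op (h : IsWeylSystem par Z D L R)
    (hγ : ∀ r s, γ.index r = γ.index s → par r = par s) (hη : IsShiftInverse D z η) :
    IsOscillator (fun r s => sgn (par r * par s)) (MulOpposite.op Z)
      (fun a r => MulOpposite.op (rho R γ η a r)) (fun b r => MulOpposite.op (L b r))
      ((resolvent γ η).transpose.map MulOpposite.op) := by
  have := IsOscillator.of_resolvent (θ := 1) (ε := fun r s => sgn (par r * par s))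
    (D := MulOpposite.op Z) (A := fun a r => MulOpposite.op (R a r))
    (A' := fun b r => MulOpposite.op (L b r)) (G := (resolvent γ η).map MulOpposite.op)
    (fun r s => by rw [mul_comm])
    (fun r s => sgn_sq _)
    (fun a b r s => by
      rw [← MulOpposite.op_mul, ← MulOpposite.op_mul, ← MulOpposite.op_smul, h.RR b a,
        mul_comm (par s)])
    (fun a b r s => by
      rw [← MulOpposite.op_mul, ← MulOpposite.op_mul, ← MulOpposite.op_smul, h.LL b a,
        mul_comm (par s)])
    (fun a b r s => by
      rw [← MulOpposite.op_mul, ← MulOpposite.op_mul, ← MulOpposite.op_smul, h.RL b a,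
        mul_comm (par s)]
      by_cases hh : a = b ∧ r = s
      · obtain ⟨rfl, rfl⟩ := hh
        simp
      · rw [if_neg hh, if_neg (fun h' => hh ⟨h'.1.symm, h'.2.symm⟩), add_zero, add_zero])
    (fun r s a t => congrArg MulOpposite.op
      (resolvent_comm_of_comm hη.left hη.right (h.DR a t).symm r s))
    (fun r s a t => congrArg MulOpposite.op
      (resolvent_comm_of_comm hη.left hη.right (h.DL a t).symm r s))
    (fun r s r' s' => congrArg MulOpposite.op
      (resolvent_comm_resolvent hη.left hη.right r' s' r s))
    (fun r s hrs t => by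
      rw [sgn_par_eq (hγ := hγ) (ζ := η) fun h0 =>
        hrs (by rw [Matrix.map_apply, h0, MulOpposite.op_zero])])
    (fun a r => congrArg MulOpposite.op (h.ZR a r).symm)
    (fun a r => congrArg MulOpposite.op (h.ZL a r).symm)
    (fun r s => by
      have h1 := congrArg MulOpposite.op
        (resolvent_comm (c := γ) (κ := -1) hη.left hη.right (y := Z) (by
          rw [← neg_sub, h.DZ]; simp) r s)
      simp only [resolvent_comm_resolvent hη.left hη.right r] at h1
      rw [MulOpposite.op_sub, MulOpposite.op_mul, MulOpposite.op_mul] at h1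
      rw [← neg_sub]
      simp only [Matrix.map_apply]
      rw [h1, ← MulOpposite.opAddEquiv_apply]
      simp)
  have e : (Matrix.of fun s r => ((1 : ℤ) : Bᵐᵒᵖ) * (resolvent γ η).map MulOpposite.op r s) =
      (resolvent γ η).transpose.map MulOpposite.op := by
    ext r s
    simp
  have e' : (fun a s => ∑ r, MulOpposite.op (R a r) * (resolvent γ η).map MulOpposite.op r s) =
      fun a r => MulOpposite.op (rho R γ η a r) := by
    funext a s
    rw [rho, ← MulOpposite.opAddEquiv_apply, map_sum]
    refine Finset.sum_congr rfl fun r _ => ?_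
    exact congrArg MulOpposite.op
      (resolvent_comm_of_comm hη.left hη.right (h.DR a r).symm r s).symm
  rwa [e, e'] at this

end IsWeylSystem

end Weyl

/-! ### Conjugation of column determinants -/

section Conjugation

variable {B : Type*} [Ring B]

theorem prod_conj {n : ℕ} {y : B} {q e : Fin n → B} (h : ∀ r, y * q r = q r * (y + e r))
    (he : ∀ r s, e r * q s = q s * e r) :
    y * (List.ofFn q).prod = (List.ofFn q).prod * (y + ∑ r, e r) := by
  induction n with
  | zero => simp
  | succ n ih =>
    have h1 : e 0 * (List.ofFn fun i : Fin n => q i.succ).prod =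
        (List.ofFn fun i : Fin n => q i.succ).prod * e 0 :=
      Commute.list_prod_right _ _ fun x hx => by
        obtain ⟨i, rfl⟩ := List.mem_ofFn.1 hx
        exact he 0 i.succ
    have h2 := ih (fun i => h i.succ) fun r s => he r.succ s.succ
    rw [List.ofFn_succ, List.prod_cons, Fin.sum_univ_succ]
    linear_combination (norm := noncomm_ring)
      h 0 * (List.ofFn fun i : Fin n => q i.succ).prod + q 0 * h1 + q 0 * h2

theorem list_prod_conj {n : ℕ} {Q : B} {u v : Fin n → B} (h : ∀ i, u i * Q = Q * v i) :
    (List.ofFn u).prod * Q = Q * (List.ofFn v).prod := by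
  induction n with
  | zero => simp
  | succ n ih =>
    rw [List.ofFn_succ, List.prod_cons, List.ofFn_succ, List.prod_cons, mul_assoc,
      ih fun i => h i.succ, ← mul_assoc, h 0, mul_assoc]

theorem cdet_conj {d : ℕ} {Q : B} {M N : Matrix (Fin d) (Fin d) B}
    (h : ∀ a b, M a b * Q = Q * N a b) : cdet M * Q = Q * cdet N := by
  rw [cdet, cdet, Finset.sum_mul, Finset.mul_sum]
  refine Finset.sum_congr rfl fun σ _ => ?_
  rw [smul_mul_assoc, mul_smul_comm, list_prod_conj fun i => h (σ i) i]

theorem exists_inv_prod {T : Subring B} {n : ℕ} {q : Fin n → B} (hq : ∀ i, q i ∈ T)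
    (h : ∀ i, ∃ u ∈ T, q i * u = 1 ∧ u * q i = 1) :
    (List.ofFn q).prod ∈ T ∧ ∃ u ∈ T, (List.ofFn q).prod * u = 1 ∧ u * (List.ofFn q).prod = 1 := by
  induction n with
  | zero => exact ⟨by simp, 1, T.one_mem, by simp, by simp⟩
  | succ n ih =>
    obtain ⟨h1, u, hu, hu1, hu2⟩ := ih (fun i => hq i.succ) fun i => h i.succ
    obtain ⟨v, hv, hv1, hv2⟩ := h 0
    rw [List.ofFn_succ, List.prod_cons]
    refine ⟨T.mul_mem (hq 0) h1, u * v, T.mul_mem hu hv, ?_, ?_⟩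
    · rw [mul_assoc, ← mul_assoc _ u, hu1, one_mul, hv1]
    · rw [mul_assoc, ← mul_assoc v, hv2, one_mul, hu2]

variable [Algebra ℂ B] {d N : ℕ} (par : Fin N → ZMod 2) (γ : Composition N)

/-- The product over all indices `r` of `(t - z)^{±1}`, where `z` belongs to the block of `r`, with
the exponent `(-1)^{|r|}`; here `ζ i` is the inverse of `t - z i`. -/
noncomputable def twist (t : B) (z : Fin γ.length → ℂ) (ζ : Fin γ.length → B) : B :=
  (List.ofFn fun r => if par r = 0 then t - algebraMap ℂ B (z (γ.index r))
    else ζ (γ.index r)).prod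

variable {par γ} {t : B} {z : Fin γ.length → ℂ} {ζ : Fin γ.length → B}

theorem twist_comm_of_comm (hζ : IsShiftInverse t z ζ) {y : B} (hy : y * t = t * y) :
    y * twist par γ t z ζ = twist par γ t z ζ * y := by
  refine Commute.list_prod_right _ _ fun x hx => ?_
  obtain ⟨r, rfl⟩ := List.mem_ofFn.1 hx
  change y * _ = _ * y
  split_ifs
  · have := Algebra.commutes (z (γ.index r)) y
    linear_combination (norm := noncomm_ring) hy + this
  · exact hζ.comm hy _

/-- The commutator of the product `twist` with an element that has constant commutator with `t`: a
logarithmic derivative. -/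
theorem twist_conj (hζ : IsShiftInverse t z ζ) {y : B} {κ : ℤ} (hy : y * t - t * y = κ) :
    y * twist par γ t z ζ = twist par γ t z ζ *
      (y + ∑ r, (κ : B) * (sgn (par r) • ζ (γ.index r))) := by
  have hζt : ∀ i, ζ i * t = t * ζ i := fun i => (hζ.comm rfl i).symm
  have hκ := fun x : B => Int.cast_comm κ x
  refine prod_conj (fun r => ?_) fun r s => ?_
  · have h1 := hζ.right (γ.index r)
    have h2 := hζ.left (γ.index r)
    have h3 := Algebra.commutes (z (γ.index r)) y
    have hy' : y * (t - algebraMap ℂ B (z (γ.index r))) -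
        (t - algebraMap ℂ B (z (γ.index r))) * y = κ := by
      linear_combination (norm := noncomm_ring) hy + h3
    set c := t - algebraMap ℂ B (z (γ.index r))
    have hcκ := hκ c
    rcases zmod_two_cases (par r) with h | h
    · rw [h, if_pos rfl, sgn_zero, one_smul]
      linear_combination (norm := noncomm_ring) hy' - κ * h1 + hcκ * ζ (γ.index r)
    · rw [h, if_neg one_ne_zero, sgn_one, neg_one_smul]
      set g := ζ (γ.index r)
      linear_combination (norm := noncomm_ring) -g * hy' * g - h2 * y * g +
        g * y * h1
  · have hc : ∀ w : B, w * t = t * w → (κ : B) * (sgn (par r) • ζ (γ.index r)) * w =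
        w * ((κ : B) * (sgn (par r) • ζ (γ.index r))) := by
      intro w hw
      have h1 := hζ.comm hw (γ.index r)
      rw [mul_assoc, smul_mul_assoc, ← h1, mul_smul_comm, mul_smul_comm, mul_smul_comm,
        ← mul_assoc, hκ, mul_assoc]
    refine hc _ ?_
    split_ifs
    · have := Algebra.commutes (z (γ.index s)) t
      linear_combination (norm := noncomm_ring) -this
    · exact hζt _

end Conjugation

namespace IsWeylSystem

variable {B : Type*} [Ring B] [Algebra ℂ B] {d N : ℕ} {par : Fin N → ZMod 2}
  {Z D : B} {L R : Fin d → Fin N → B} {γ : Composition N} {z : Fin γ.length → ℂ}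
  {ζ η : Fin γ.length → B} {J : Matrix (Fin d) (Fin d) ℂ}

/-- The image of the Lax matrix of `gl_d`, where `ζ i` stands for the inverse of `z - z i`. -/
noncomputable def glLax (γ : Composition N) (par : Fin N → ZMod 2) (D : B)
    (J : Matrix (Fin d) (Fin d) ℂ) (L R : Fin d → Fin N → B) (ζ : Fin γ.length → B) :
    Matrix (Fin d) (Fin d) B :=
  Matrix.of fun a b => (if a = b then D else 0) - algebraMap ℂ B (J a b) -
    ∑ r, ∑ r', sgn (par r) • (R b r * L a r' * resolvent γ ζ r r')

theorem glLax_apply (a b : Fin d) : glLax γ par D J L R ζ a b =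
    (if a = b then D else 0) - algebraMap ℂ B (J a b) -
      ∑ r, ∑ r', sgn (par r) • (R b r * L a r' * resolvent γ ζ r r') := rfl

/-- The matrix `z - Jᵗ - ∑ L_{br} ρ_{ar}`, which corresponds to the normally ordered Lax matrix of
`gl_d` under the exchange of `z` and `∂`. -/
noncomputable def dualLax (γ : Composition N) (Z : B) (J : Matrix (Fin d) (Fin d) ℂ)
    (L R : Fin d → Fin N → B) (η : Fin γ.length → B) : Matrix (Fin d) (Fin d) B :=
  Matrix.of fun a b => (if a = b then Z else 0) - algebraMap ℂ B (J b a) -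
    ∑ r, L b r * rho R γ η a r

theorem dualLax_apply (a b : Fin d) : dualLax γ Z J L R η a b =
    (if a = b then Z else 0) - algebraMap ℂ B (J b a) - ∑ r, L b r * rho R γ η a r := rfl

/-- Moving `R` to the right of `L` in `glLax` produces the diagonal term `∑ (-1)^{|r|} (z - z_r)⁻¹`.
This is the logarithmic derivative of `twist`, so that conjugation by `twist` absorbs it into
`∂`. -/
theorem glLax_conj (h : IsWeylSystem par Z D L R)
    (hγ : ∀ r s, γ.index r = γ.index s → par r = par s) (hζ : IsShiftInverse Z z ζ) (a b : Fin d) :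
    glLax γ par D J L R ζ a b * twist par γ Z z ζ =
      twist par γ Z z ζ * oscMatrix D J (xi L γ ζ) R Finset.univ a b := by
  have hc : ∀ y : B, y * Z = Z * y → y * twist par γ Z z ζ = twist par γ Z z ζ * y := fun y hy =>
    twist_comm_of_comm hζ hy
  have hD := twist_conj (par := par) hζ (y := D) (κ := 1) (by rw [h.DZ, Int.cast_one])
  simp only [Int.cast_one, one_mul] at hD
  set F := twist par γ Z z ζ
  set E := ∑ r, sgn (par r) • ζ (γ.index r)
  set W := ∑ r, xi L γ ζ a r * R b r
  have hK := fun r s => (resolvent_comm_of_comm hζ.left hζ.right (c := γ) (y := Z) rfl r s)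
  have hE : E * F = F * E := hc _ (by
    rw [Finset.sum_mul, Finset.mul_sum]
    refine Finset.sum_congr rfl fun r _ => ?_
    rw [smul_mul_assoc, mul_smul_comm, hζ.comm rfl])
  have hx : ∀ r, xi L γ ζ a r * Z = Z * xi L γ ζ a r := by
    intro r
    rw [xi, Finset.sum_mul, Finset.mul_sum]
    refine Finset.sum_congr rfl fun r' _ => ?_
    linear_combination (norm := noncomm_ring) -h.ZL a r' * resolvent γ ζ r r' - L a r' * hK r r'
  have hW : W * F = F * W := hc _ (by
    rw [Finset.sum_mul, Finset.mul_sum]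
    refine Finset.sum_congr rfl fun r _ => ?_
    linear_combination (norm := noncomm_ring) hx r * R b r - xi L γ ζ a r * h.ZR b r)
  have hS : ∑ r, ∑ r', sgn (par r) • (R b r * L a r' * resolvent γ ζ r r') =
      W + if a = b then E else 0 := by
    have : ∀ r r', sgn (par r) • (R b r * L a r' * resolvent γ ζ r r') =
        L a r' * resolvent γ ζ r r' * R b r +
          if r = r' then (if a = b then sgn (par r) • ζ (γ.index r) else 0) else 0 := by
      intro r r'
      by_cases h0 : resolvent γ ζ r r' = 0
      · have : r ≠ r' ∨ ζ (γ.index r) = 0 := by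
          rcases eq_or_ne r r' with rfl | h1
          · right
            rwa [resolvent_diag] at h0
          · exact Or.inl h1
        rcases this with h1 | h1 <;> simp [h0, h1]
      rw [h.RL, ← sgn_par_eq (hγ := hγ) h0, sgn_mul_self, add_mul, smul_add, smul_mul_assoc,
        smul_smul, sgn_sq, one_smul, mul_assoc, mul_assoc,
        resolvent_comm_of_comm hζ.left hζ.right (h.ZR b r).symm]
      congr 1
      by_cases h1 : a = b
      · rcases eq_or_ne r r' with rfl | h2
        · simp [h1, resolvent_diag]
        · simp [h2]
      · simp [h1]
    simp only [this, Finset.sum_add_distrib, Finset.sum_ite_eq, Finset.mem_univ, if_true, W, E, xi,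
      Finset.sum_mul]
    congr 1
    split_ifs <;> simp
  have hJ := Algebra.commutes (J a b) F
  rw [glLax_apply, oscMatrix_apply, hS]
  change _ = F * (_ - _ - W)
  split_ifs
  · linear_combination (norm := noncomm_ring) hD - hJ - hW - hE
  · linear_combination (norm := noncomm_ring) -hJ - hW

/-- As in `glLax_conj`, with the roles of `z` and `∂` exchanged: conjugation by `twist` absorbs the
commutators of `L` with `ρ`. -/
theorem dualLax_conj (h : IsWeylSystem par Z D L R)
    (hγ : ∀ r s, γ.index r = γ.index s → par r = par s) (hη : IsShiftInverse D z η) (a b : Fin d) :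
    dualLax γ Z J L R η a b * twist par γ D z η = twist par γ D z η *
      oscMatrix Z J.transpose (rho R γ η) (fun b r => sgn (par r) • L b r) Finset.univ a b := by
  have hc : ∀ y : B, y * D = D * y → y * twist par γ D z η = twist par γ D z η * y := fun y hy =>
    twist_comm_of_comm hη hy
  have hZ := twist_conj (par := par) hη (y := Z) (κ := -1) (by rw [← neg_sub, h.DZ]; simp)
  simp only [Int.cast_neg, Int.cast_one, neg_one_mul, Finset.sum_neg_distrib] at hZ
  have hosc := h.oscillator_super hγ hη
  set F := twist par γ D z η
  set E := ∑ r, sgn (par r) • η (γ.index r) with hEdef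
  set W := ∑ r, rho R γ η a r * (sgn (par r) • L b r)
  have hK := fun r s => (resolvent_comm_of_comm hη.left hη.right (c := γ) (y := D) rfl r s)
  have hE : E * F = F * E := hc _ (by
    rw [Finset.sum_mul, Finset.mul_sum]
    refine Finset.sum_congr rfl fun r _ => ?_
    rw [smul_mul_assoc, mul_smul_comm, hη.comm rfl])
  have hx : ∀ r, rho R γ η a r * D = D * rho R γ η a r := by
    intro r
    rw [rho, Finset.sum_mul, Finset.mul_sum]
    refine Finset.sum_congr rfl fun r' _ => ?_
    linear_combination (norm := noncomm_ring) -h.DR a r' * resolvent γ η r' r - R a r' * hK r' r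
  have hW : W * F = F * W := hc _ (by
    rw [Finset.sum_mul, Finset.mul_sum]
    refine Finset.sum_congr rfl fun r _ => ?_
    rw [mul_smul_comm, smul_mul_assoc, mul_smul_comm]
    congr 1
    linear_combination (norm := noncomm_ring) hx r * L b r - rho R γ η a r * h.DL b r)
  have hS : ∑ r, L b r * rho R γ η a r = W - if a = b then E else 0 := by
    have : ∀ r, L b r * rho R γ η a r = rho R γ η a r * (sgn (par r) • L b r) -
        if a = b then sgn (par r) • η (γ.index r) else 0 := by
      intro r
      have h1 := congrArg (fun x => sgn (par r) • x) (hosc.YX a b r r)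
      simp only [sgn_mul_self, smul_mul_assoc, smul_add, smul_smul, sgn_sq, one_smul] at h1
      rw [h1, sub_eq_add_neg]
      congr 1
      split_ifs
      · simp [resolvent_diag]
      · simp
    rw [Finset.sum_congr rfl fun r _ => this r, Finset.sum_sub_distrib]
    congr 1
    split_ifs <;> simp [hEdef]
  have hJ := Algebra.commutes (J b a) F
  rw [dualLax_apply, oscMatrix_apply, hS]
  change _ = F * (_ - _ - W)
  rw [Matrix.transpose_apply]
  split_ifs
  · linear_combination (norm := noncomm_ring) hZ - hJ - hW + hE
  · linear_combination (norm := noncomm_ring) -hJ - hW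

end IsWeylSystem

/-! ### The Berezinian as a quotient of column determinants -/

namespace IsWeylSystem

variable {B : Type*} [Ring B] [Algebra ℂ B] {d N : ℕ} {par : Fin N → ZMod 2}
  {Z D : B} {L R : Fin d → Fin N → B} {γ : Composition N} {z : Fin γ.length → ℂ}
  {η : Fin γ.length → B} {ξ : Composition d} {w : Fin ξ.length → ℂ} {ω : Fin ξ.length → B}

/-- The image of the Lax matrix of the general linear Lie superalgebra, where `ω i` stands for the
inverse of `z - w i`. -/
noncomputable def superLax (ξ : Composition d) (par : Fin N → ZMod 2) (D : B)
    (J : Matrix (Fin N) (Fin N) ℂ) (L R : Fin d → Fin N → B) (ω : Fin ξ.length → B) :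
    Matrix (Fin N) (Fin N) B :=
  Matrix.of fun i j => (if i = j then D else 0) - algebraMap ℂ B (J i j) -
    ∑ α, ∑ α', sgn (par i) • (L α' i * R α j * resolvent ξ ω α α')

theorem superLax_apply (J : Matrix (Fin N) (Fin N) ℂ) (i j : Fin N) :
    superLax ξ par D J L R ω i j = (if i = j then D else 0) - algebraMap ℂ B (J i j) -
      ∑ α, ∑ α', sgn (par i) • (L α' i * R α j * resolvent ξ ω α α') := rfl

variable (par R γ) in
/-- The matrix `z - J_ξᵗ - ∑_{r < i} ρ_{ar} (-1)^{|r|} L_{br}`. -/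
noncomputable def partialLax (Z : B) (w : Fin ξ.length → ℂ) (L : Fin d → Fin N → B)
    (η : Fin γ.length → B) (i : ℕ) : Matrix (Fin d) (Fin d) B :=
  oscMatrix Z (jordan ξ w).transpose (rho R γ η) (fun b r => sgn (par r) • L b r)
    (Finset.univ.filter fun r => (r : ℕ) < i)

theorem filter_lt_succ (i : Fin N) : (Finset.univ.filter fun r : Fin N => (r : ℕ) < i + 1) =
    insert i (Finset.univ.filter fun r : Fin N => (r : ℕ) < i) := by
  ext r
  simp only [Finset.mem_filter, Finset.mem_univ, true_and, Finset.mem_insert, Fin.ext_iff]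
  omega

theorem partialLax_succ (i : Fin N) (a b : Fin d) : partialLax par R γ Z w L η (i + 1) a b =
    partialLax par R γ Z w L η i a b - rho R γ η a i * (sgn (par i) • L b i) := by
  rw [partialLax, partialLax, oscMatrix_apply, oscMatrix_apply, filter_lt_succ,
    Finset.sum_insert (by simp)]
  abel

section Column

variable {v : Fin N → B} {i : Fin N}

theorem subJordan_mulVec_eq_zero (hv : ∀ j, i < j → v j = 0) {l : Fin N} (hl : i < l) :
    ∑ j, subJordan γ D z l j * v j = 0 := by
  refine Finset.sum_eq_zero fun j _ => ?_
  rcases lt_or_ge i j with h | h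
  · rw [hv j h, mul_zero]
  · have hjl := h.trans_lt hl
    rw [subJordan_apply, jordan_eq_zero γ z hjl, if_neg hjl.ne', map_zero, sub_zero, zero_mul]

theorem subJordan_mulVec_self (hv : ∀ j, i < j → v j = 0) :
    ∑ j, subJordan γ D z i j * v j = (D - algebraMap ℂ B (z (γ.index i))) * v i := by
  rw [Finset.sum_eq_single i]
  · rw [subJordan_apply, if_pos rfl, jordan, if_pos rfl]
  · intro j _ hj
    rcases lt_or_gt_of_ne hj with h | h
    · rw [subJordan_apply, jordan_eq_zero γ z h, if_neg h.ne', map_zero, sub_zero, zero_mul]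
    · rw [hv j h, mul_zero]
  · simp

/-- Part of the last column of the inverse of a matrix that contains both `partialLax` and the
leading submatrices of `superLax` as Schur complements. -/
noncomputable def auxColumn (R : Fin d → Fin N → B) (ω : Fin ξ.length → B) (v : Fin N → B)
    (b : Fin d) : B :=
  -∑ α, resolvent ξ ω α b * ∑ j, R α j * v j

theorem superLax_mulVec (h : IsWeylSystem par Z D L R) (hω : IsShiftInverse Z w ω) (l : Fin N) :
    ∑ j, superLax ξ par D (jordan γ z) L R ω l j * v j =
      ∑ j, subJordan γ D z l j * v j + ∑ b, sgn (par l) • L b l * auxColumn R ω v b := by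
  have e : ∀ j, superLax ξ par D (jordan γ z) L R ω l j * v j = subJordan γ D z l j * v j +
      ∑ b, -∑ α, sgn (par l) • (L b l * (resolvent ξ ω α b * (R α j * v j))) := by
    intro j
    rw [superLax_apply, sub_mul, subJordan_apply, sub_eq_add_neg (b := _ * v j),
      Finset.sum_neg_distrib, Finset.sum_comm]
    congr 2
    simp only [Finset.sum_mul]
    refine Finset.sum_congr rfl fun b _ => Finset.sum_congr rfl fun α _ => ?_
    have := resolvent_comm_of_comm (c := ξ) hω.left hω.right (h.ZR α j).symm α b
    rw [smul_mul_assoc]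
    congr 1
    linear_combination (norm := noncomm_ring) L b l * this * v j
  simp only [e, Finset.sum_add_distrib]
  congr 1
  rw [Finset.sum_comm]
  refine Finset.sum_congr rfl fun b _ => ?_
  simp only [auxColumn, mul_neg, Finset.mul_sum, Finset.sum_neg_distrib, smul_mul_assoc]
  rw [Finset.sum_comm]

theorem auxColumn_spec (hω : IsShiftInverse Z w ω) (a : Fin d) :
    ∑ b, ((if a = b then Z else 0) - algebraMap ℂ B (jordan ξ w b a)) * auxColumn R ω v b =
      -∑ j, R a j * v j := by
  have h1 : ∀ α b, ((if a = b then Z else 0) - algebraMap ℂ B (jordan ξ w b a)) *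
      resolvent ξ ω α b = resolvent ξ ω α b * subJordan ξ Z w b a := by
    intro α b
    have h1 := resolvent_comm_of_comm (c := ξ) hω.left hω.right (y := Z) rfl α b
    have h2 := Algebra.commutes (jordan ξ w b a) (resolvent ξ ω α b)
    rw [subJordan_apply, if_congr eq_comm rfl rfl]
    split_ifs
    · linear_combination (norm := noncomm_ring) h1 - h2
    · linear_combination (norm := noncomm_ring) -h2
  have h2 : ∀ α, ∑ b, resolvent ξ ω α b * subJordan ξ Z w b a = if α = a then 1 else 0 :=
    fun α => (Matrix.mul_apply.symm.trans
      (congrFun (congrFun (resolvent_mul_subJordan hω.left) α) a)).trans Matrix.one_apply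
  simp only [auxColumn, mul_neg, Finset.sum_neg_distrib, Finset.mul_sum (Finset.univ (α := Fin d)),
    ← mul_assoc, h1]
  rw [Finset.sum_comm]
  simp only [← Finset.sum_mul, h2, ite_mul, one_mul, zero_mul, Finset.sum_ite_eq', Finset.mem_univ,
    if_true]

/-- If `v` is the last column of the inverse of the leading submatrix of `superLax` that ends at `i`,
then `auxColumn` and `v i` form the last column of the inverse of the super Manin matrix which
extends `partialLax` by the index `i`; this is the equation for its upper rows. -/
theorem partialLax_mulVec (h : IsWeylSystem par Z D L R) (hη : IsShiftInverse D z η)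
    (hω : IsShiftInverse Z w ω) (hv : ∀ j, i < j → v j = 0)
    (hLv : ∀ j ≤ i, ∑ l, superLax ξ par D (jordan γ z) L R ω j l * v l = if j = i then 1 else 0)
    (a : Fin d) :
    ∑ b, partialLax par R γ Z w L η i a b * auxColumn R ω v b +
      rho R γ η a i * (D - algebraMap ℂ B (z (γ.index i))) * v i = 0 := by
  have h1 : ∑ b, partialLax par R γ Z w L η i a b * auxColumn R ω v b = -∑ j, R a j * v j -
      ∑ r ∈ Finset.univ.filter (fun r : Fin N => (r : ℕ) < i),
        rho R γ η a r * ∑ b, sgn (par r) • L b r * auxColumn R ω v b := by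
    rw [← auxColumn_spec hω]
    simp only [partialLax, oscMatrix_apply, sub_mul _ (∑ r ∈ _, _), Finset.sum_sub_distrib,
      Finset.sum_mul, Finset.mul_sum, mul_assoc]
    rw [Finset.sum_comm (t := Finset.univ.filter _)]
    rfl
  have h2 : ∀ r ∈ Finset.univ.filter (fun r : Fin N => (r : ℕ) < i),
      rho R γ η a r * ∑ b, sgn (par r) • L b r * auxColumn R ω v b =
      -(rho R γ η a r * ∑ j, subJordan γ D z r j * v j) := by
    intro r hr
    have hri : r < i := (Finset.mem_filter.1 hr).2
    have := hLv r hri.le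
    rw [h.superLax_mulVec hω, if_neg hri.ne] at this
    rw [eq_neg_of_add_eq_zero_right this, mul_neg]
  have h3 : ∑ j, R a j * v j = ∑ r, rho R γ η a r * ∑ j, subJordan γ D z r j * v j := by
    have hK : ∀ j, v j = ∑ r, resolvent γ η j r * ∑ l, subJordan γ D z r l * v l := by
      intro j
      have := congrArg (fun M => M.mulVec v j) (resolvent_mul_subJordan (c := γ) hη.left)
      simp only [← Matrix.mulVec_mulVec, Matrix.one_mulVec] at this
      exact this.symm
    simp only [rho, Finset.sum_mul]
    rw [Finset.sum_comm]
    refine Finset.sum_congr rfl fun j _ => ?_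
    rw [hK j, Finset.mul_sum]
    simp only [mul_assoc]
  have h4 : ∑ r, rho R γ η a r * ∑ j, subJordan γ D z r j * v j =
      ∑ r ∈ Finset.univ.filter (fun r : Fin N => (r : ℕ) < i + 1),
        rho R γ η a r * ∑ j, subJordan γ D z r j * v j := by
    refine (Finset.sum_subset (Finset.subset_univ _) fun r _ hr => ?_).symm
    have : i < r := by
      by_contra hh
      refine hr (Finset.mem_filter.2 ⟨Finset.mem_univ r, ?_⟩)
      rw [Fin.lt_def] at hh
      omega
    rw [subJordan_mulVec_eq_zero hv this, mul_zero]
  rw [h1, h3, h4, filter_lt_succ, Finset.sum_insert (by simp), Finset.sum_congr rfl h2,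
    Finset.sum_neg_distrib, subJordan_mulVec_self hv]
  noncomm_ring

end Column

variable {T : Subring B}

theorem add_self_eq_zero (r : B) (h : r + r = 0) : r = 0 := by
  rw [← two_smul ℂ, smul_eq_zero_iff_right two_ne_zero] at h
  exact h

theorem resolvent_mem (hT : ∀ (c : ℂ), ∀ x ∈ T, c • x ∈ T)
    (hη : ∀ i, η i ∈ T) (r s : Fin N) : resolvent γ η r s ∈ T := by
  rw [resolvent_apply]
  exact T.sum_mem fun i _ => T.sum_mem fun l _ => hT _ _ (T.pow_mem (hη i) _)

theorem smul_mem_of_algebraMap_mem (hT : ∀ c : ℂ, algebraMap ℂ B c ∈ T) (c : ℂ) {x : B}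
    (hx : x ∈ T) : c • x ∈ T := by
  rw [Algebra.smul_def]
  exact T.mul_mem (hT c) hx

theorem rho_mem (hT : ∀ c : ℂ, algebraMap ℂ B c ∈ T) (hR : ∀ a r, R a r ∈ T)
    (hη : ∀ i, η i ∈ T) (a : Fin d) (r : Fin N) : rho R γ η a r ∈ T :=
  T.sum_mem fun _ _ => T.mul_mem (hR _ _)
    (resolvent_mem (fun c _ hx => smul_mem_of_algebraMap_mem hT c hx) hη _ _)

/-- Although `D` is not in `T`, the product of `ρ` with the corresponding `D - z` is, as the
resolvent contains a factor inverse to `D - z`. -/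
theorem rho_mul_mem (hT : ∀ c : ℂ, algebraMap ℂ B c ∈ T) (hR : ∀ a r, R a r ∈ T)
    (hηT : ∀ i, η i ∈ T) (hη : IsShiftInverse D z η) (a : Fin d) (i : Fin N) :
    rho R γ η a i * (D - algebraMap ℂ B (z (γ.index i))) ∈ T := by
  have hK := resolvent_mem (γ := γ) (fun c _ hx => smul_mem_of_algebraMap_mem hT c hx) hηT
  rw [rho, Finset.sum_mul]
  refine T.sum_mem fun r _ => ?_
  rw [mul_assoc]
  refine T.mul_mem (hR _ _) ?_
  have h1 := congrFun (congrFun (resolvent_mul_subJordan (c := γ) hη.left) r) i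
  rw [Matrix.mul_apply, ← Finset.add_sum_erase _ _ (Finset.mem_univ i), subJordan_apply,
    if_pos rfl, jordan, if_pos rfl, Matrix.one_apply] at h1
  rw [eq_sub_of_add_eq h1]
  refine T.sub_mem ?_ (T.sum_mem fun s hs => T.mul_mem (hK _ _) ?_)
  · split_ifs
    exacts [T.one_mem, T.zero_mem]
  · rw [subJordan_apply, if_neg (Finset.ne_of_mem_erase hs), zero_sub]
    exact T.neg_mem (hT _)

theorem sub_sub_sub_cancel_outer {B : Type*} [AddCommGroup B] (x p q : B) :
    x - p - q - x = -(p + q) := by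
  abel

theorem partialLax_isNear (hT : ∀ c : ℂ, algebraMap ℂ B c ∈ T) (hL : ∀ a r, L a r ∈ T)
    (hR : ∀ a r, R a r ∈ T) (hη : ∀ i, η i ∈ T) (i : ℕ) :
    IsNear T Z (partialLax par R γ Z w L η i) := by
  intro a b
  rw [partialLax, oscMatrix_apply, sub_sub_sub_cancel_outer]
  exact T.neg_mem (T.add_mem (hT _) (T.sum_mem fun r _ => T.mul_mem (rho_mem hT hR hη a r)
    (smul_mem_of_algebraMap_mem hT _ (hL _ _))))

theorem superLax_isNear (hT : ∀ c : ℂ, algebraMap ℂ B c ∈ T) (hL : ∀ a r, L a r ∈ T)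
    (hR : ∀ a r, R a r ∈ T) (hω : ∀ i, ω i ∈ T) (J : Matrix (Fin N) (Fin N) ℂ) :
    IsNear T D (superLax ξ par D J L R ω) := by
  intro a b
  rw [superLax_apply, sub_sub_sub_cancel_outer]
  exact T.neg_mem (T.add_mem (hT _) (T.sum_mem fun r _ => T.sum_mem fun r' _ =>
    smul_mem_of_algebraMap_mem hT _ (T.mul_mem (T.mul_mem (hL _ _) (hR _ _))
      (resolvent_mem (fun c _ hx => smul_mem_of_algebraMap_mem hT c hx) hω _ _))))

theorem partialLax_isManin (h : IsWeylSystem par Z D L R)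
    (hγ : ∀ r s, γ.index r = γ.index s → par r = par s) (hη : IsShiftInverse D z η) (i : ℕ) :
    IsManin (partialLax par R γ Z w L η i) := by
  refine (h.oscillator_super hγ hη).isManin fun r hr t ht => ?_
  simp only [Finset.mem_filter, Finset.mem_univ, true_and] at hr ht
  rw [Matrix.neg_apply, Matrix.transpose_apply, resolvent_eq_zero, neg_zero]
  rintro ⟨-, hle⟩
  exact ht (lt_of_le_of_lt hle hr)

/-- The Berezinian of the super Lax matrix is, up to invertible factors that are constant in `L` and
`R`, the column determinant of the matrix `z - J_ξᵗ - ∑ ρ_{ar} (-1)^{|r|} L_{br}`. -/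
theorem cdet_mul_ber (h : IsWeylSystem par Z D L R)
    (hγ : ∀ r s, γ.index r = γ.index s → par r = par s) (hη : IsShiftInverse D z η)
    (hω : IsShiftInverse Z w ω) (hTZ : HasInverses T Z) (hTD : HasInverses T D)
    (hT : ∀ c : ℂ, algebraMap ℂ B c ∈ T) (hL : ∀ a r, L a r ∈ T)
    (hR : ∀ a r, R a r ∈ T) (hηT : ∀ i, η i ∈ T)
    (hs : SufficientlyInvertible (superLax ξ par D (jordan γ z) L R ω)) :
    cdet (partialLax par R γ Z w L η 0) * ber par (superLax ξ par D (jordan γ z) L R ω) =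
      twist par γ D z η * cdet (partialLax par R γ Z w L η N) := by
  refine prod_telescope (fun i => cdet (partialLax par R γ Z w L η i)) _ _ fun i => ?_
  obtain ⟨v, hv, hv0, hLv⟩ := leading_mul_inverse (hs i).1
  have hosc := h.oscillator_super hγ hη
  have hle : ∀ r t : Fin N, ¬ t ≤ r → (-(resolvent γ η).transpose) r t = 0 := by
    intro r t hrt
    rw [Matrix.neg_apply, Matrix.transpose_apply, resolvent_eq_zero fun hh => hrt hh.2, neg_zero]
  set c := D - algebraMap ℂ B (z (γ.index i)) with hc
  have hcomm : ∀ y : B, y * D = D * y → y * c = c * y := by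
    intro y hy
    have := Algebra.commutes (z (γ.index i)) y
    rw [hc]
    linear_combination (norm := noncomm_ring) hy + this
  have hσ : ((if par i = 0 then 1 else -1 : ℤ) : ℂ) = sgn (par i * par i) := by
    rw [sgn_mul_self, sgn]
    split_ifs <;> simp
  have hρ : ∀ a r, rho R γ η a r * D = D * rho R γ η a r := by
    intro a r
    rw [rho, Finset.sum_mul, Finset.mul_sum]
    refine Finset.sum_congr rfl fun r' _ => ?_
    have := resolvent_comm_of_comm hη.left hη.right (c := γ) (y := D) rfl r' r
    linear_combination (norm := noncomm_ring) -h.DR a r' * resolvent γ η r' r - R a r' * this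
  -- `ρ` is multiplied by `D - z` on the right, so that `partialLax (i + 1)` is the Schur complement
  -- of the last entry `D - z`
  have hM : IsSuperManin (if par i = 0 then 1 else -1) (partialLax par R γ Z w L η i)
      (fun a => rho R γ η a i * c) (fun b => sgn (par i) • L b i) c := by
    refine hosc.isSuperManin hσ (fun r hr t ht => hle _ _ fun hh => ?_) (by simp)
      (fun t ht hti => hle _ _ fun hh => ?_) ?_ (fun a r => hcomm _ (hρ a r)) (fun a r => ?_) ?_
    · simp only [Finset.mem_filter, Finset.mem_univ, true_and] at hr ht
      exact ht (lt_of_le_of_lt hh hr)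
    · simp only [Finset.mem_filter, Finset.mem_univ, true_and] at ht
      exact ht (lt_of_le_of_ne hh fun hh' => hti (Fin.ext hh'))
    · rw [Matrix.neg_apply, Matrix.transpose_apply, resolvent_diag, neg_mul, hc, hη.left]
    · refine hcomm _ ?_
      rw [smul_mul_assoc, mul_smul_comm, h.DL]
    · have := Algebra.commutes (z (γ.index i)) Z
      rw [hc]
      linear_combination (norm := noncomm_ring) this - h.DZ
  have key := hM.cdet_exchange add_self_eq_zero hTZ hTD (by split_ifs <;> simp)
    (partialLax_isNear hT hL hR hηT i) (fun a => rho_mul_mem hT hR hηT hη a i)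
    (fun b => smul_mem_of_algebraMap_mem hT _ (hL b i))
    (by rw [hc, sub_right_comm, sub_self, zero_sub]; exact T.neg_mem (hT _))
    (hη.right (γ.index i)) (hη.left (γ.index i)) (h.partialLax_isManin hγ hη (i + 1))
    (fun a b => by
      rw [partialLax_succ, mul_assoc (rho R γ η a i), hη.right, mul_one])
    (h.partialLax_mulVec hη hω hv0 hLv) (by
      have := hLv i le_rfl
      rwa [h.superLax_mulVec hω, subJordan_mulVec_self hv0, if_pos rfl, add_comm] at this)
  rw [hv] at key
  by_cases hp : par i = 0
  · simp only [hp, if_true, forall_const] at key ⊢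
    rw [key.1, mul_assoc, quasiminor, Ring.mul_inverse_cancel _ (hs i).2, mul_one]
  · simp only [hp, if_false, forall_const] at key ⊢
    rw [quasiminor, Ring.inverse_inverse (hs i).2, key.2]

theorem partialLax_zero : partialLax par R γ Z w L η 0 =
    Matrix.of fun a b => (if a = b then Z else 0) - algebraMap ℂ B (jordan ξ w b a) := by
  ext a b
  rw [partialLax, oscMatrix_apply, Finset.sum_eq_zero, sub_zero]
  · rfl
  · intro r hr
    simp at hr

theorem partialLax_card : partialLax par R γ Z w L η N =
    oscMatrix Z (jordan ξ w).transpose (rho R γ η) (fun b r => sgn (par r) • L b r)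
      Finset.univ := by
  rw [partialLax, Finset.filter_true_of_mem fun r _ => r.isLt]

end IsWeylSystem

/-! ### Comparison of the algebras of coefficients -/

namespace PDO

section Differential

variable {A : Type*} [Ring A] [Algebra ℂ A] (S : Subalgebra ℂ A)

theorem le_of_wt_ne_zero {j k : ℤ} {t : ℕ} (hj : 0 ≤ j) (h : wt j k t ≠ 0) : (t : ℤ) ≤ j := by
  lift j to ℕ using hj
  by_contra hh
  rw [wt, Ring.choose_natCast, Nat.choose_eq_zero_of_lt (by omega)] at h
  simp at h

/-- The differential operators of order at most `m` whose leading coefficient lies in `S`. -/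
def differential (m : ℕ) : AddSubgroup (PDO A) where
  carrier := {a | (∀ i j, a.coeff i j ≠ 0 → 0 ≤ j ∧ j ≤ m) ∧ ∀ i, a.coeff i m ∈ S}
  zero_mem' := ⟨fun i j h => absurd rfl h, fun _ => S.zero_mem⟩
  add_mem' := by
    rintro a b ⟨ha, ha'⟩ ⟨hb, hb'⟩
    refine ⟨fun i j h => ?_, fun i => S.add_mem (ha' i) (hb' i)⟩
    by_cases h0 : a.coeff i j = 0
    · exact hb i j fun h1 => h (by rw [coeff_add, h0, h1, add_zero])
    · exact ha i j h0
  neg_mem' := by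
    rintro a ⟨ha, ha'⟩
    exact ⟨fun i j h => ha i j fun h0 => h (by rw [coeff_neg, h0, neg_zero]),
      fun i => S.neg_mem (ha' i)⟩

variable {S}

theorem mul_mem_differential {a b : PDO A} {m n : ℕ} (ha : a ∈ differential S m)
    (hb : b ∈ differential S n) : a * b ∈ differential S (m + n) := by
  refine ⟨fun I J h => ?_, fun I => ?_⟩
  · obtain ⟨i, j, t, h1, h2, h3⟩ := exists_of_coeff_mul_ne_zero h
    have h4 := ha.1 _ _ h1
    have h5 := hb.1 _ _ h2
    have h6 := le_of_wt_ne_zero h4.1 h3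
    push_cast
    omega
  · rw [coeff_mul]
    refine finsum_induction (· ∈ S) S.zero_mem (fun _ _ => S.add_mem) ?_
    rintro ⟨i, j, t⟩
    by_cases h1 : a.coeff i j = 0
    · simp [mulTerm, h1]
    by_cases h2 : b.coeff (I - i + t) ((m + n : ℕ) - j + t) = 0
    · simp only [mulTerm, h2, mul_zero, smul_zero, S.zero_mem]
    have h4 := ha.1 _ _ h1
    have h5 := hb.1 _ _ h2
    push_cast at h5
    have hj : j = m := by omega
    have ht : t = 0 := by omega
    subst hj ht
    refine S.toSubring.zsmul_mem (S.mul_mem (ha.2 _) ?_) _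
    have e : ((m + n : ℕ) : ℤ) - m + (0 : ℕ) = n := by push_cast; ring
    rw [e]
    exact hb.2 _

theorem mem_differential_one {a : PDO A} (ha : a ∈ differential (⊤ : Subalgebra ℂ A) 0) :
    a ∈ differential S 1 := by
  refine ⟨fun i j h => ?_, fun i => ?_⟩
  · have := ha.1 i j h
    push_cast at this ⊢
    omega
  · by_cases h : a.coeff i (1 : ℕ) = 0
    · rw [h]; exact S.zero_mem
    · have := (ha.1 _ _ h).2
      norm_num at this

theorem C_mem_differential (c : A) : C c ∈ differential (⊤ : Subalgebra ℂ A) 0 :=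
  ⟨fun i j h => by
    rw [coeff_C] at h
    split_ifs at h with h0
    · simp [h0.2]
    · exact absurd rfl h, fun _ => Algebra.mem_top⟩

theorem invSub_mem_differential (c : A) : invSub c ∈ differential (⊤ : Subalgebra ℂ A) 0 :=
  ⟨fun i j h => by
    rw [coeff_invSub] at h
    split_ifs at h with h0
    · simp [h0.1]
    · exact absurd rfl h, fun _ => Algebra.mem_top⟩

theorem D_mem_differential : (D : PDO A) ∈ differential S 1 := by
  refine ⟨fun i j h => ?_, fun i => ?_⟩
  · rw [D, coeff_monomial] at h
    split_ifs at h with h0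
    · simp [h0.2]
    · exact absurd rfl h
  · rw [D, coeff_monomial]
    split_ifs
    exacts [S.one_mem, S.zero_mem]

theorem list_prod_mem_differential {n : ℕ} {f : Fin n → PDO A} (hf : ∀ i, f i ∈ differential S 1) :
    (List.ofFn f).prod ∈ differential S n := by
  induction n with
  | zero =>
    refine ⟨fun i j h => ?_, fun i => ?_⟩
    · rw [List.ofFn_zero, List.prod_nil, coeff_one] at h
      split_ifs at h with h0
      · simp [h0.2]
      · exact absurd rfl h
    · rw [List.ofFn_zero, List.prod_nil, coeff_one]
      split_ifs
      exacts [S.one_mem, S.zero_mem]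
  | succ n ih =>
    have := mul_mem_differential (hf 0) (ih fun i => hf i.succ)
    rw [add_comm 1 n] at this
    rwa [List.ofFn_succ, List.prod_cons]

theorem cdet_mem_differential {n : ℕ} {M : Matrix (Fin n) (Fin n) (PDO A)}
    (hM : ∀ a b, M a b ∈ differential S 1) : cdet M ∈ differential S n :=
  (differential S n).sum_mem fun _ _ =>
    (differential S n).zsmul_mem (list_prod_mem_differential fun i => hM _ i) _

/-- The leading coefficients lie in `S` by definition of `differential`, so that only those of lower
order have to be tested. -/
theorem mem_coeffsIn_of_differential {n : ℕ} {a : PDO A} (ha : a ∈ differential S n) :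
    a ∈ coeffsIn S ↔ ∀ (i : Fin n) (r : ℤ), a.coeff r ((i : ℕ) : ℤ) ∈ S := by
  refine ⟨fun h i r => h _ _, fun h r j => ?_⟩
  by_cases h0 : a.coeff r j = 0
  · rw [h0]; exact S.zero_mem
  · obtain ⟨h1, h2⟩ := ha.1 _ _ h0
    lift j to ℕ using h1
    rcases (Nat.cast_le.1 h2).lt_or_eq with h3 | rfl
    · exact h ⟨j, h3⟩ r
    · exact ha.2 r

end Differential

end PDO

open PDO

section Comparison

theorem mem_iff_of_conj {B : Type*} [Ring B] {T : Subring B} {x y F G F' G' : B}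
    (h : x * F = G * y) (hF : F ∈ T) (hG : G ∈ T) (hF' : F' ∈ T) (hG' : G' ∈ T)
    (h1 : F * F' = 1) (h2 : G' * G = 1) : x ∈ T ↔ y ∈ T := by
  constructor
  · intro hx
    have : y = G' * (x * F) := by rw [h, ← mul_assoc, h2, one_mul]
    rw [this]
    exact T.mul_mem hG' (T.mul_mem hx hF)
  · intro hy
    have : x = G * y * F' := by rw [← h, mul_assoc, h1, mul_one]
    rw [this]
    exact T.mul_mem (T.mul_mem hG hy) hF'

variable {A : Type*} [Ring A] [Algebra ℂ A] {S : Subalgebra ℂ A}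

theorem isShiftInverse_invSub {l : ℕ} (z : Fin l → ℂ) :
    IsShiftInverse (Z : PDO A) z fun i => invSub (algebraMap ℂ A (z i)) :=
  ⟨fun _ => invSub_mul_sub _, fun _ => sub_mul_invSub _⟩

theorem exists_isShiftInverse_D {l : ℕ} (z : Fin l → ℂ) :
    ∃ η : Fin l → PDO A, (∀ i, η i ∈ nonpos (⊥ : Subalgebra ℂ A)) ∧ IsShiftInverse D z η := by
  choose η h1 h2 h3 using fun i => exists_inv_D_add (S := (⊥ : Subalgebra ℂ A))
    ((nonpos _).neg_mem (algebraMap_mem_nonpos (z i)))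
  exact ⟨η, h1, fun i => by rw [sub_eq_add_neg, h3], fun i => by rw [sub_eq_add_neg, h2]⟩

theorem nonpos_bot_le (S : Subalgebra ℂ A) : nonpos (⊥ : Subalgebra ℂ A) ≤ nonpos S :=
  fun _ ha => ⟨fun i j => bot_le (a := S) (ha.1 i j), ha.2⟩

theorem exists_inv_twist {N : ℕ} {par : Fin N → ZMod 2} {γ : Composition N}
    {z : Fin γ.length → ℂ} {t : PDO A} {ζ : Fin γ.length → PDO A} {T : Subring (PDO A)}
    (hT : ∀ c : ℂ, algebraMap ℂ (PDO A) c ∈ T) (ht : t ∈ T) (hζT : ∀ i, ζ i ∈ T)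
    (hζ : IsShiftInverse t z ζ) : twist par γ t z ζ ∈ T ∧
      ∃ u ∈ T, twist par γ t z ζ * u = 1 ∧ u * twist par γ t z ζ = 1 := by
  refine exists_inv_prod (fun r => ?_) fun r => ?_
  · split_ifs
    exacts [T.sub_mem ht (hT _), hζT _]
  · split_ifs
    · exact ⟨ζ (γ.index r), hζT _, hζ.right _, hζ.left _⟩
    · exact ⟨t - algebraMap ℂ _ (z (γ.index r)), T.sub_mem ht (hT _), hζ.left _, hζ.right _⟩

variable {d N : ℕ} {par : Fin N → ZMod 2} {lo ro : Fin d → Fin N → A} {γ : Composition N}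
  {z : Fin γ.length → ℂ} {η : Fin γ.length → PDO A} {J : Matrix (Fin d) (Fin d) ℂ}

theorem swap_invSub_mul {l : ℕ} {z : Fin l → ℂ} {η : Fin l → PDO A} (hη : IsShiftInverse D z η)
    (i : Fin l) (a : PDO A) : swap (invSub (algebraMap ℂ A (z i)) * a) = swap a * η i := by
  have h1 : swap a = swap (invSub (algebraMap ℂ A (z i)) * a) * (D - algebraMap ℂ _ (z i)) := by
    set b := invSub (algebraMap ℂ A (z i)) * a with hb
    have h2 : a = Z * b - C (algebraMap ℂ A (z i)) * b := by
      rw [hb, ← sub_mul, ← mul_assoc, sub_mul_invSub, one_mul]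
    rw [h2, map_sub, swap_Z_mul, swap_C_mul, mul_sub, ← Algebra.commutes, algebraMap_eq]
  rw [h1, mul_assoc, hη.right, mul_one]

theorem swap_smul (c : ℂ) (a : PDO A) : swap (c • a) = c • swap a := by
  rw [Algebra.smul_def, Algebra.smul_def, algebraMap_eq, swap_C_mul]

theorem swap_resolvent_mul (hη : IsShiftInverse D z η) (r s : Fin N) (a : PDO A) :
    swap (resolvent γ (fun i => invSub (algebraMap ℂ A (z i))) r s * a) =
      swap a * resolvent γ η r s := by
  have hpow : ∀ i (k : ℕ) (a : PDO A), swap (invSub (algebraMap ℂ A (z i)) ^ k * a) =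
      swap a * η i ^ k := by
    intro i k
    induction k with
    | zero => intro a; simp
    | succ k ih => intro a; rw [pow_succ, mul_assoc, ih, swap_invSub_mul hη, pow_succ', mul_assoc]
  simp only [resolvent_apply, Finset.sum_mul, Finset.mul_sum, map_sum, smul_mul_assoc, swap_smul,
    hpow, mul_smul_comm]

open IsWeylSystem

/-- The exchange of `z` and `∂` takes the normally ordered Lax matrix of `gl_d` to `dualLax`. -/
theorem swap_cdet
    (h : IsWeylSystem par (Z : PDO A) D (fun a r => C (lo a r)) fun a r => C (ro a r))
    (hγ : ∀ r s, γ.index r = γ.index s → par r = par s) (hη : IsShiftInverse D z η) :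
    swap (cdet (oscMatrix D J (xi (fun a r => C (lo a r)) γ fun i => invSub (algebraMap ℂ A (z i)))
      (fun a r => C (ro a r)) Finset.univ)) =
    cdet (dualLax γ Z J (fun a r => C (lo a r)) (fun a r => C (ro a r)) η) := by
  refine (h.oscillator_gl hγ (isShiftInverse_invSub z)).cdet_transfer (h.oscillator_op hγ hη)
    (J' := J.transpose) swap swap_one _ ?_ ?_
  · ext a b
    rw [Matrix.map_apply, dualLax_apply, oscMatrix_apply, Matrix.transpose_apply,
      ← MulOpposite.opAddEquiv_apply, map_sub, map_sub, map_sum]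
    split_ifs <;> rfl
  · intro a b x
    have hsum : ∑ r, swap (xi (fun a r => C (lo a r)) γ
        (fun i => invSub (algebraMap ℂ A (z i))) a r * (x * C (ro b r))) =
        ∑ r, C (lo a r) * swap x * rho (fun a r => C (ro a r)) γ η b r := by
      simp only [xi, rho, Finset.sum_mul, Finset.mul_sum, map_sum]
      rw [Finset.sum_comm]
      refine Finset.sum_congr rfl fun r _ => Finset.sum_congr rfl fun r' _ => ?_
      rw [mul_assoc (C (lo a r)), swap_C_mul, swap_resolvent_mul hη, swap_mul_C,
        mul_assoc (swap x), mul_assoc, resolvent_comm_of_comm hη.left hη.right (D_mul_C _).symm]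
    have hJ := Algebra.commutes (J a b) (swap x)
    rw [insertion_apply, insertion_apply, map_sub, map_sub, map_sum, hsum, Matrix.transpose_apply,
      ← MulOpposite.opAddEquiv_apply, map_sub, map_sub, map_sum, algebraMap_eq, swap_C_mul,
      ← algebraMap_eq, hJ, if_congr (eq_comm (a := b)) rfl rfl]
    congr 1
    congr 1
    split_ifs
    · rw [swap_mul_D]; rfl
    · rw [map_zero, map_zero]

variable {ξ : Composition d} {w : Fin ξ.length → ℂ}

theorem superLax_sufficientlyInvertible (J : Matrix (Fin N) (Fin N) ℂ) :
    SufficientlyInvertible (superLax ξ par D J (fun a r => C (lo a r)) (fun a r => C (ro a r))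
      fun i => invSub (algebraMap ℂ A (w i))) :=
  (superLax_isNear (T := nonpos ⊤) algebraMap_mem_nonpos
    (fun _ _ => C_mem_nonpos Algebra.mem_top) (fun _ _ => C_mem_nonpos Algebra.mem_top)
    (fun _ => invSub_mem_nonpos _) J).sufficientlyInvertible fun _ hr => exists_inv_D_add hr

/-- The column determinant and the Berezinian have coefficients in the same subalgebras: up to the
exchange of `z` and `∂`, they differ by invertible factors with scalar coefficients. -/
theorem cdet_glLax_mem_iff
    (h : IsWeylSystem par (Z : PDO A) D (fun a r => C (lo a r)) fun a r => C (ro a r))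
    (hγ : ∀ r s, γ.index r = γ.index s → par r = par s) :
    cdet (glLax γ par D (jordan ξ w) (fun a r => C (lo a r)) (fun a r => C (ro a r))
      fun i => invSub (algebraMap ℂ A (z i))) ∈ coeffsIn S ↔
    ber par (superLax ξ par D (jordan γ z) (fun a r => C (lo a r)) (fun a r => C (ro a r))
      fun i => invSub (algebraMap ℂ A (w i))) ∈ coeffsIn S := by
  obtain ⟨η, hηT, hη⟩ := exists_isShiftInverse_D (A := A) z
  have hle := (nonpos_bot_le S).trans nonpos_le_coeffsIn
  have hζ := isShiftInverse_invSub (A := A) z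
  obtain ⟨hF, F', hF', hF1, hF2⟩ := exists_inv_twist (par := par) (T := coeffsIn S)
    algebraMap_mem_coeffsIn Z_mem_coeffsIn
    (fun i => nonpos_le_coeffsIn (invSub_mem_nonpos (z i))) hζ
  obtain ⟨hQ, Q', hQ', hQ1, hQ2⟩ := exists_inv_twist (par := par) (T := coeffsIn S)
    algebraMap_mem_coeffsIn D_mem_coeffsIn (fun i => hle (hηT i)) hη
  have h1 := cdet_conj (h.glLax_conj (J := jordan ξ w) hγ hζ)
  have h2 := cdet_conj (h.dualLax_conj (J := jordan ξ w) hγ hη)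
  have hbot : IsNear (nonpos (⊥ : Subalgebra ℂ A)) Z
      (partialLax par (fun a r => C (ro a r)) γ Z w (fun a r => C (lo a r)) η 0) := by
    intro a b
    rw [partialLax_zero, Matrix.of_apply, sub_right_comm, sub_self, zero_sub]
    exact (nonpos _).neg_mem (algebraMap_mem_nonpos _)
  obtain ⟨G', hG'', hG1, hG2⟩ := (h.partialLax_isManin (w := w) hγ hη 0).exists_inv_cdet
    add_self_eq_zero (fun _ hr => exists_inv_Z_add hr) hbot
  have h3 := h.cdet_mul_ber (T := nonpos ⊤) (w := w) hγ hη (isShiftInverse_invSub w)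
    (fun _ hr => exists_inv_Z_add hr) (fun _ hr => exists_inv_D_add hr) algebraMap_mem_nonpos
    (fun _ _ => C_mem_nonpos Algebra.mem_top) (fun _ _ => C_mem_nonpos Algebra.mem_top)
    (fun i => nonpos_bot_le ⊤ (hηT i)) (superLax_sufficientlyInvertible _)
  rw [partialLax_card] at h3
  have hG : cdet (partialLax par (fun a r => C (ro a r)) γ Z w (fun a r => C (lo a r)) η 0) ∈
      coeffsIn S := by
    refine (coeffsIn S).sum_mem fun σ _ => (coeffsIn S).zsmul_mem
      ((coeffsIn S).list_prod_mem fun x hx => ?_) _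
    obtain ⟨i, rfl⟩ := List.mem_ofFn.1 hx
    rw [partialLax_zero, Matrix.of_apply]
    refine (coeffsIn S).sub_mem ?_ (algebraMap_mem_coeffsIn _)
    split_ifs
    exacts [Z_mem_coeffsIn, (coeffsIn S).zero_mem]
  rw [mem_iff_of_conj h1 hF hF hF' hF' hF1 hF2, ← swap_mem_coeffsIn, swap_cdet h hγ hη]
  exact mem_iff_of_conj (h2.trans h3.symm) hQ hG hQ' (hle hG'') hQ1 hG2

end Comparison

/-! ### The images of the Lax matrices and of the Gaudin algebras -/

section Images

open PDO IsWeylSystem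

/-- Exchanging variables and derivatives for `r < k`, as `Lop` and `Rop` do, preserves the relations
of the Weyl superalgebra. -/
theorem weylSystem {d N : ℕ} (par : Fin N → ZMod 2) (k : ℕ) :
    IsWeylSystem par (Z : PDO (Weyl d par)) D (fun a r => C (Lop par k a r))
      fun a r => C (Rop par k a r) where
  DZ := by rw [D_mul_Z]; abel
  LL a b r s := by rw [← C_mul, ← C_mul, L_L, C_smul]
  RR a b r s := by rw [← C_mul, ← C_mul, R_R, C_smul]
  RL a b r s := by
    rw [← C_mul, ← C_mul, R_L, C_add, C_smul]
    congr 1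
    by_cases hh : a = b ∧ r = s
    · obtain ⟨rfl, rfl⟩ := hh
      rw [if_pos ⟨rfl, rfl⟩, if_pos ⟨rfl, rfl⟩, one_smul]; rfl
    · rw [if_neg hh, if_neg fun h' => hh ⟨h'.1.symm, h'.2⟩, zero_smul, C_zero]
  ZL a r := Z_mul_C _
  ZR a r := Z_mul_C _
  DL a r := D_mul_C _
  DR a r := D_mul_C _

theorem sum_resolvent {B : Type*} [Ring B] [Algebra ℂ B] {k : ℕ} (c : Composition k)
    (ζ : Fin c.length → B) (H : Fin k → Fin k → B) :
    ∑ i, ∑ l ∈ Finset.range (c.blocksFun i),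
      (∑ p : Fin k × Fin k, shiftC c i l p.1 p.2 • H p.1 p.2) * ζ i ^ (l + 1) =
      ∑ r, ∑ r', H r r' * resolvent c ζ r r' := by
  rw [← Fintype.sum_prod_type' fun r r' => H r r' * resolvent c ζ r r']
  simp only [resolvent_apply, Finset.mul_sum]
  rw [Finset.sum_comm]
  refine Finset.sum_congr rfl fun i _ => ?_
  rw [Finset.sum_comm]
  refine Finset.sum_congr rfl fun l _ => ?_
  rw [Finset.sum_mul]
  refine Finset.sum_congr rfl fun x _ => ?_
  rw [smul_mul_assoc, mul_smul_comm]

theorem map_lax {N l : ℕ} (par : Fin N → ZMod 2) (g : Fin l → ℕ) (μ : Matrix (Fin N) (Fin N) ℂ)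
    (z : Fin l → ℂ) {A : Type*} [Ring A] [Algebra ℂ A] (f : Env par g →ₐ[ℂ] A) (i j : Fin N) :
    (lax par g μ z).map (PDO.map (f : Env par g →+* A)) i j = (if i = j then D else 0) +
      sgn (par i) • (algebraMap ℂ (PDO A) (μ i j) - ∑ a, ∑ k ∈ Finset.range (g a),
        C (f (Env.E par g i j a k)) * invSub (algebraMap ℂ A (z a)) ^ (k + 1)) := by
  rw [Matrix.map_apply, lax, Psi, map_add, map_mul, map_sub, map_sum, PDO.map_C, PDO.map_C]
  simp only [map_sum, map_mul, map_pow, PDO.map_C, map_invSub, AlgHom.coe_toRingHom,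
    AlgHom.commutes, apply_ite (PDO.map _), map_D, map_zero]
  rw [Algebra.smul_def]
  rfl

variable {d p q m n : ℕ} (ξ : Composition d) (γp : Composition p) (γq : Composition q)
  (γm : Composition m) (γn : Composition n) (w : Fin ξ.length → ℂ)
  (z : Fin (blocks γp γq γm γn).length → ℂ)

theorem parity_eq (r s : Fin (p + q + m + n))
    (h : (blocks γp γq γm γn).index r = (blocks γp γq γm γn).index s) :
    parity p q m n r = parity p q m n s := by
  obtain ⟨h1, h2, h3⟩ := blocks_index γp γq γm γn r s h
  simp only [parity, h1, h2, h3]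

theorem map_lax_gl : (lax (fun _ : Fin d => 0) (blocks γp γq γm γn).blocksFun (-jordan ξ w) z).map
      (PDO.map (glHom γp γq γm γn d : _ →+* Weyl d (parity p q m n))) =
    glLax (blocks γp γq γm γn) (parity p q m n) D (jordan ξ w)
      (fun a r => C (Lop (parity p q m n) (p + q) a r))
      (fun a r => C (Rop (parity p q m n) (p + q) a r))
      fun i => invSub (algebraMap ℂ _ (z i)) := by
  ext1 a b
  rw [map_lax, glLax_apply, sgn_zero, one_smul, Matrix.neg_apply, map_neg]
  simp only [glHom_E]
  have h : ∀ i k, C (glImage (parity p q m n) (p + q) (blocks γp γq γm γn) a b i k) =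
      ∑ x : Fin _ × Fin _, shiftC (blocks γp γq γm γn) i k x.1 x.2 •
        (sgn (parity p q m n x.1) • (C (Rop (parity p q m n) (p + q) b x.1) *
          C (Lop (parity p q m n) (p + q) a x.2))) := by
    intro i k
    rw [glImage_eq _ _ _ fun r r' hr => (blocks_index γp γq γm γn r r' hr).2.1, C_sum]
    simp only [C_smul, C_mul]
  simp only [h]
  rw [sum_resolvent _ _ fun r r' => sgn (parity p q m n r) •
    (C (Rop (parity p q m n) (p + q) b r) * C (Lop (parity p q m n) (p + q) a r'))]
  simp only [smul_mul_assoc]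
  abel

theorem map_lax_super : (lax (parity p q m n) ξ.blocksFun
      (fun i j => -sgn (parity p q m n i) * jordan (blocks γp γq γm γn) z i j) w).map
      (PDO.map (superHom p q m n ξ : _ →+* Weyl d (parity p q m n))) =
    superLax ξ (parity p q m n) D (jordan (blocks γp γq γm γn) z)
      (fun a r => C (Lop (parity p q m n) (p + q) a r))
      (fun a r => C (Rop (parity p q m n) (p + q) a r))
      fun i => invSub (algebraMap ℂ _ (w i)) := by
  ext1 i j
  refine (map_lax _ _ _ _ (superHom p q m n ξ) i j).trans ?_
  rw [superLax_apply]
  simp only [superHom_E]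
  have h : ∀ a k, C (superImage (parity p q m n) (p + q) ξ i j a k) =
      ∑ x : Fin _ × Fin _, shiftC ξ a k x.1 x.2 •
        (C (Lop (parity p q m n) (p + q) x.2 i) * C (Rop (parity p q m n) (p + q) x.1 j)) := by
    intro a k
    rw [superImage_eq, C_sum]
    simp only [C_smul, C_mul]
  simp only [h]
  rw [sum_resolvent _ _ fun α α' =>
    C (Lop (parity p q m n) (p + q) α' i) * C (Rop (parity p q m n) (p + q) α j)]
  rw [smul_sub, map_mul, map_neg, neg_mul, smul_neg, ← Algebra.smul_def, smul_smul, sgn_sq,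
    one_smul]
  simp only [Finset.smul_sum]
  abel

theorem lax_sufficientlyInvertible {N l : ℕ} (par : Fin N → ZMod 2) (g : Fin l → ℕ)
    (μ : Matrix (Fin N) (Fin N) ℂ) (z : Fin l → ℂ) :
    SufficientlyInvertible (lax par g μ z) := by
  refine IsNear.sufficientlyInvertible (T := nonpos ⊤) (t := D)
    (fun _ hr => exists_inv_D_add hr) fun i j => ?_
  have hC : ∀ c, (C c : PDO (Env par g)) ∈ nonpos (⊤ : Subalgebra ℂ _) :=
    fun c => C_mem_nonpos Algebra.mem_top
  rw [lax, add_sub_cancel_left]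
  exact (nonpos _).mul_mem (hC _) ((nonpos _).sub_mem (hC _) ((nonpos _).sum_mem fun a _ =>
    (nonpos _).sum_mem fun k _ => (nonpos _).mul_mem (hC _)
      ((nonpos _).pow_mem (invSub_mem_nonpos _) _)))

/-- The generators of the Gaudin algebra of `gl_d` leave out the coefficient of `∂^d` in the column
determinant. This makes no difference, as that coefficient is a scalar. -/
theorem gaudinGL_map_le_iff (S : Subalgebra ℂ (Weyl d (parity p q m n))) :
    (gaudinGL d (blocks γp γq γm γn).blocksFun (-jordan ξ w) z).map (glHom γp γq γm γn d) ≤ S ↔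
      cdet (glLax (blocks γp γq γm γn) (parity p q m n) D (jordan ξ w)
        (fun a r => C (Lop (parity p q m n) (p + q) a r))
        (fun a r => C (Rop (parity p q m n) (p + q) a r))
        fun i => invSub (algebraMap ℂ _ (z i))) ∈ coeffsIn S := by
  rw [mem_coeffsIn_of_differential (n := d), ← map_lax_gl, map_cdet, Subalgebra.map_le, gaudinGL,
    Algebra.adjoin_le_iff]
  · constructor
    · intro h i r
      exact h ⟨i, r, rfl⟩
    · rintro h _ ⟨i, r, rfl⟩
      exact h i r
  · refine cdet_mem_differential fun a b => ?_
    rw [glLax_apply, sub_sub]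
    refine (differential S 1).sub_mem ?_ (mem_differential_one ?_)
    · split_ifs
      exacts [D_mem_differential, (differential S 1).zero_mem]
    · have hmul : ∀ x ∈ differential (⊤ : Subalgebra ℂ (Weyl d (parity p q m n))) 0,
          ∀ y ∈ differential (⊤ : Subalgebra ℂ (Weyl d (parity p q m n))) 0,
          x * y ∈ differential (⊤ : Subalgebra ℂ (Weyl d (parity p q m n))) 0 :=
        fun x hx y hy => mul_mem_differential (m := 0) (n := 0) hx hy
      have hsmul : ∀ (c : ℂ), ∀ x ∈ differential (⊤ : Subalgebra ℂ (Weyl d (parity p q m n))) 0,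
          c • x ∈ differential (⊤ : Subalgebra ℂ (Weyl d (parity p q m n))) 0 := by
        intro c x hx
        rw [Algebra.smul_def]
        exact hmul _ (C_mem_differential _) x hx
      have hpow : ∀ (c : ℂ) (k : ℕ), (invSub (algebraMap ℂ (Weyl d (parity p q m n)) c)) ^ k ∈
          differential (⊤ : Subalgebra ℂ (Weyl d (parity p q m n))) 0 := by
        intro c k
        induction k with
        | zero => exact C_mem_differential 1
        | succ k ih => rw [pow_succ]; exact hmul _ ih _ (invSub_mem_differential _)
      refine AddSubgroup.add_mem _ (C_mem_differential _) (AddSubgroup.sum_mem _ fun r _ =>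
        AddSubgroup.sum_mem _ fun r' _ => hsmul _ _ (hmul _ (hmul _ (C_mem_differential _) _
          (C_mem_differential _)) _ ?_))
      rw [resolvent_apply]
      exact AddSubgroup.sum_mem _ fun i _ => AddSubgroup.sum_mem _ fun k _ => hsmul _ _ (hpow _ _)

theorem gaudinSuper_map_le_iff_ber {N l : ℕ} (par : Fin N → ZMod 2) (g : Fin l → ℕ)
    (μ : Matrix (Fin N) (Fin N) ℂ) (z : Fin l → ℂ) {A : Type*} [Ring A] [Algebra ℂ A]
    (f : Env par g →ₐ[ℂ] A) (S : Subalgebra ℂ A) : (gaudinSuper par g μ z).map f ≤ S ↔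
      ber par ((lax par g μ z).map (PDO.map (f : Env par g →+* A))) ∈ coeffsIn S := by
  rw [map_ber _ _ (lax_sufficientlyInvertible _ _ _ _), Subalgebra.map_le, gaudinSuper,
    Algebra.adjoin_le_iff]
  constructor
  · intro h i r
    exact h ⟨r, i, rfl⟩
  · rintro h _ ⟨i, r, rfl⟩
    exact h r i

theorem gaudinSuper_map_le_iff (S : Subalgebra ℂ (Weyl d (parity p q m n))) :
    (gaudinSuper (parity p q m n) ξ.blocksFun
      (fun i j => -sgn (parity p q m n i) * jordan (blocks γp γq γm γn) z i j) w).map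
        (superHom p q m n ξ) ≤ S ↔
      ber (parity p q m n) (superLax ξ (parity p q m n) D (jordan (blocks γp γq γm γn) z)
        (fun a r => C (Lop (parity p q m n) (p + q) a r))
        (fun a r => C (Rop (parity p q m n) (p + q) a r))
        fun i => invSub (algebraMap ℂ _ (w i))) ∈ coeffsIn S := by
  rw [← map_lax_super]
  exact gaudinSuper_map_le_iff_ber _ _ _ _ _ _

theorem gaudin_map_eq :
    (gaudinGL d (blocks γp γq γm γn).blocksFun (-jordan ξ w) z).map (glHom γp γq γm γn d) =
      (gaudinSuper (parity p q m n) ξ.blocksFun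
        (fun i j => -sgn (parity p q m n i) * jordan (blocks γp γq γm γn) z i j) w).map
          (superHom p q m n ξ) :=
  eq_of_forall_ge_iff fun S => by
    rw [gaudinGL_map_le_iff, gaudinSuper_map_le_iff]
    exact cdet_glLax_mem_iff (weylSystem _ _) (parity_eq γp γq γm γn)

end Images

end GaudinDuality

theorem theorem4p5 (d p q m n : ℕ) (hd : 0 < d) (hN : 0 < p + q + m + n)
    (ξ : Composition d) (γp : Composition p) (γq : Composition q) (γm : Composition m)
    (γn : Composition n) (w : Fin ξ.length → ℂ)
    (z : Fin (blocks γp γq γm γn).length → ℂ) :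
    SufficientlyInvertible (lax (parity p q m n) ξ.blocksFun
      (fun i j => -sgn (parity p q m n i) * jordan (blocks γp γq γm γn) z i j) w) ∧
    (gaudinGL d (blocks γp γq γm γn).blocksFun (-jordan ξ w) z).map (glHom γp γq γm γn d) =
      (gaudinSuper (parity p q m n) ξ.blocksFun
        (fun i j => -sgn (parity p q m n i) * jordan (blocks γp γq γm γn) z i j) w).map
          (superHom p q m n ξ) ∧
    (gaudinGL d (blocks γp γq γm γn).blocksFun (-jordan ξ w) z).map
        ((Weyl d (parity p q m n)).val.comp (glHom γp γq γm γn d)) =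
      (gaudinSuper (parity p q m n) ξ.blocksFun
        (fun i j => -sgn (parity p q m n i) * jordan (blocks γp γq γm γn) z i j) w).map
          ((Weyl d (parity p q m n)).val.comp (superHom p q m n ξ)) := by
  refine ⟨lax_sufficientlyInvertible _ _ _ _, gaudin_map_eq ξ γp γq γm γn w z, ?_⟩
  rw [← Subalgebra.map_map, ← Subalgebra.map_map, gaudin_map_eq ξ γp γq γm γn w z]
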